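/- Let $\theta_1,\theta_2\in\mathbb R$ with $\theta_1\neq 0$, let $\mathbf C=\begin{pmatrix}1&0\\0&\theta_1\\0&\theta_2\end{pmatrix}$, and let $I\subsetneq\mathbb R$ be an interval with non-empty interior, with boundary (set of finite endpoints) $\partial I$. Put $\Omega_{per}=I\times\mathbb R\times(0,1)$, $Q=I\times\mathbb R$ and, for $\tau\in\partial I$, $\Sigma^\tau_{per}=\{\tau\}\times\mathbb R\times(0,1)$; let $n=\pm e_x$ be the unit normal on $\Sigma^\tau_{per}$ which is outward with respect to $\Omega_{per}$. All functions are complex valued, and derivatives are taken in the sense of distributions. For a function $V$ on $\Omega_{per}$ let $E V$ be its $1$-periodic extension in the third variable and $\mathcal S V((x,z),s)=(E V)(x,\theta_1 z,\theta_2 z+s)$ for $(x,z)\in Q$, $s\in(0,1)$; for $\Phi$ on $\Sigma^\tau_{per}$ set likewise $\mathcal S\Phi(z,s)=(E\Phi)(\tau,\theta_1 z,\theta_2 z+s)$. Define $$H^1_{\mathbf C,per}(\Omega_{per})=\{V\in L^2(\Omega_{per}) : \mathcal S V\in L^2(0,1;H^1(Q))\},$$ $$H_{\mathbf C,per}(\mathrm{div};\Omega_{per})=\{W\in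 L^2(\Omega_{per})^2 : \mathcal S W\in L^2(0,1;H(\mathrm{div};Q))\},$$ $$H^{1/2}_{\mathbf C,per}(\Sigma^\tau_{per})=\{\Phi\in L^2(\Sigma^\tau_{per}) : \mathcal S\Phi\in L^2(0,1;H^{1/2}(\mathbb R))\}.$$ The last space carries the norm $\|\mathcal S\Phi\|_{L^2(0,1;H^{1/2}(\mathbb R))}$; its topological dual is $H^{-1/2}_{\mathbf C,per}(\Sigma^\tau_{per})$, with duality product $\langle\cdot,\cdot\rangle_{\Sigma^\tau_{per}}$ extending the $L^2$ scalar product $(\Psi,\Phi)\mapsto\int\Psi\,\overline\Phi$ (linear in $\Psi$, antilinear in $\Phi$). Let $C^\infty_{0,per}$ be the set of restrictions to $\Omega_{per}$ of smooth functions on $\mathbb R^3$ which are $1$-periodic in the third variable and compactly supported in the first two. Then: (0) Every $V\in H^1_{\mathbf C,per}(\Omega_{per})$ has $\mathbf C^{T}\nabla V\in L^2(\Omega_{per})^2$ and every $W\in H_{\mathbf C,per}(\mathrm{div};\Omega_{per})$ has $\nabla^{T}\mathbf C W\in L^2(\Omega_{per})$. These two spaces are equipped with the norms $(\|V\|^2+\|\mathbf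 C^T\nabla V\|^2)^{1/2}$ and $(\|W\|^2+\|\nabla^T\mathbf C W\|^2)^{1/2}$. For $\tau\in\partial I$ the trace $V\mapsto V|_{\Sigma^\tau_{per}}$, $V\in C^\infty_{0,per}$, has a unique continuous linear extension from $H^1_{\mathbf C,per}(\Omega_{per})$ to $H^{1/2}_{\mathbf C,per}(\Sigma^\tau_{per})$, still written $V|_{\Sigma^\tau_{per}}$. (1) For every $\tau\in\partial I$ the normal trace $W\mapsto(\mathbf C W\cdot n)|_{\Sigma^\tau_{per}}$, $W\in[C^\infty_{0,per}]^2$, has a unique continuous linear extension $\gamma^\tau_{1,per}$ from $H_{\mathbf C,per}(\mathrm{div};\Omega_{per})$ to $H^{-1/2}_{\mathbf C,per}(\Sigma^\tau_{per})$, and $\gamma^\tau_{1,per}$ is surjective. (2) For all $V\in H^1_{\mathbf C,per}(\Omega_{per})$ and $W\in H_{\mathbf C,per}(\mathrm{div};\Omega_{per})$, $$\int_{\Omega_{per}}\Big[(\nabla^{T}\mathbf C W)\,\overline V+W\cdot\overline{\mathbf C^{T}\nabla V}\Big]=\sum_{\tau\in\partial I}\big\langle\gamma^\tau_{1,per}W,\;V|_{\Sigma^\tau_{per}}\big\rangle_{\Sigma^\tau_{per}}.$$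 -/

import Mathlib

open MeasureTheory Set
open scoped ContDiff ENNReal ComplexConjugate

noncomputable section

namespace CutPer

/-! ### `L²` spaces, weak gradients and weak divergences with respect to a pair of directions -/

/-- Vectors with two complex components, with the Hermitian norm. -/
abbrev C2 : Type := EuclideanSpace ℂ (Fin 2)

section Weak

set_option linter.unusedSectionVars false

variable {E : Type*} [NormedAddCommGroup E] [NormedSpace ℝ E] [MeasureSpace E]

/-- `L²(U; F)`, for the Lebesgue measure. -/
abbrev L2 (U : Set E) (F : Type*) [NormedAddCommGroup F] : Type _ :=
  Lp F 2 ((volume : Measure E).restrict U)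

/-- Real-valued test functions on the interior of `U`. -/
def IsTest (U : Set E) (φ : E → ℝ) : Prop :=
  ContDiff ℝ ∞ φ ∧ HasCompactSupport φ ∧ tsupport φ ⊆ interior U

/-- `G = (∂_{d 0} V, ∂_{d 1} V)` in the sense of distributions in (the interior of) `U`. -/
def IsWeakGrad (U : Set E) (d : Fin 2 → E) (V : E → ℂ) (G : E → C2) : Prop :=
  ∀ φ : E → ℝ, IsTest U φ → ∀ j : Fin 2,
    ∫ x in U, (fderiv ℝ φ x (d j)) • V x = - ∫ x in U, φ x • G x j

/-- `D = ∂_{d 0} W₀ + ∂_{d 1} W₁` in the sense of distributions in (the interior of) `U`. -/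
def IsWeakDiv (U : Set E) (d : Fin 2 → E) (W : E → C2) (D : E → ℂ) : Prop :=
  ∀ φ : E → ℝ, IsTest U φ →
    ∫ x in U, ∑ j : Fin 2, (fderiv ℝ φ x (d j)) • W x j = - ∫ x in U, φ x • D x

variable [BorelSpace E] [IsLocallyFiniteMeasure (volume : Measure E)]

theorem integrable_smul_of_compactSupport {F : Type*} [NormedAddCommGroup F] [NormedSpace ℝ F]
    {U : Set E} (f : L2 U F) {ψ : E → ℝ} (h : Continuous ψ) (h' : HasCompactSupport ψ) :
    Integrable (fun x => ψ x • f x) (volume.restrict U) :=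
  ((Lp.memLp f).locallyIntegrable (by norm_num)).integrable_smul_left_of_hasCompactSupport h h'

theorem integrable_smul_apply_of_compactSupport
    {U : Set E} (f : L2 U C2) {ψ : E → ℝ} (h : Continuous ψ) (h' : HasCompactSupport ψ)
    (j : Fin 2) : Integrable (fun x => ψ x • f x j) (volume.restrict U) := by
  have := (EuclideanSpace.proj (𝕜 := ℂ) j : C2 →L[ℂ] ℂ).integrable_comp
    (integrable_smul_of_compactSupport f h h')
  exact this

theorem IsTest.deriv_continuous {U : Set E} {φ : E → ℝ} (h : IsTest U φ) (v : E) :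
    Continuous fun x => fderiv ℝ φ x v :=
  (h.1.continuous_fderiv (by simp)).clm_apply continuous_const

theorem IsTest.deriv_compact {U : Set E} {φ : E → ℝ} (h : IsTest U φ) (v : E) :
    HasCompactSupport fun x => fderiv ℝ φ x v :=
  h.2.1.fderiv_apply ℝ v

/-- The Hilbert space of all `V ∈ L²(U)` whose derivatives in the directions `d 0`, `d 1` are in
`L²(U)`. An element is recorded as the pair `(V, G)`, `G` being the (unique) weak gradient of `V`,
so that the norm is `(‖V‖² + ‖G‖²)^{1/2}`. -/
def gradSpace (U : Set E) (d : Fin 2 → E) : Submodule ℂ (WithLp 2 (L2 U ℂ × L2 U C2)) where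
  carrier := {p | IsWeakGrad U d p.fst p.snd}
  zero_mem' := by
    intro φ hφ j
    have h1 := Lp.coeFn_zero ℂ 2 ((volume : Measure E).restrict U)
    have h2 := Lp.coeFn_zero C2 2 ((volume : Measure E).restrict U)
    simp only [WithLp.zero_fst, WithLp.zero_snd]
    refine (integral_eq_zero_of_ae ?_).trans (neg_eq_zero.2 (integral_eq_zero_of_ae ?_)).symm
    · filter_upwards [h1] with x hx
      rw [hx]
      simp
    · filter_upwards [h2] with x hx
      rw [hx]
      simp
  add_mem' := by
    intro p q hp hq φ hφ j
    have h1 := Lp.coeFn_add p.fst q.fst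
    have h2 := Lp.coeFn_add p.snd q.snd
    simp only [WithLp.add_fst, WithLp.add_snd]
    rw [integral_congr_ae (g := fun x => (fderiv ℝ φ x (d j)) • p.fst x +
        (fderiv ℝ φ x (d j)) • q.fst x),
      integral_congr_ae (f := fun x => φ x • (p.snd + q.snd : L2 U C2) x j)
        (g := fun x => φ x • p.snd x j + φ x • q.snd x j)]
    · rw [integral_add (integrable_smul_of_compactSupport _ (hφ.deriv_continuous _)
          (hφ.deriv_compact _)) (integrable_smul_of_compactSupport _ (hφ.deriv_continuous _)
          (hφ.deriv_compact _)),
        integral_add (integrable_smul_apply_of_compactSupport _ hφ.1.continuous hφ.2.1 j)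
          (integrable_smul_apply_of_compactSupport _ hφ.1.continuous hφ.2.1 j),
        hp φ hφ j, hq φ hφ j]
      ring
    · filter_upwards [h2] with x hx
      rw [hx]
      simp [mul_add]
    · filter_upwards [h1] with x hx
      rw [hx]
      simp [mul_add]
  smul_mem' := by
    intro c p hp φ hφ j
    have h1 := Lp.coeFn_smul c p.fst
    have h2 := Lp.coeFn_smul c p.snd
    simp only [WithLp.smul_fst, WithLp.smul_snd]
    rw [integral_congr_ae (g := fun x => c • ((fderiv ℝ φ x (d j)) • p.fst x)),
      integral_congr_ae (f := fun x => φ x • (c • p.snd : L2 U C2) x j)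
        (g := fun x => c • (φ x • p.snd x j))]
    · rw [integral_smul, integral_smul, hp φ hφ j, smul_neg]
    · filter_upwards [h2] with x hx
      simp only [hx, Pi.smul_apply, PiLp.smul_apply]
      rw [smul_comm]
    · filter_upwards [h1] with x hx
      simp only [hx, Pi.smul_apply]
      rw [smul_comm]

/-- The Hilbert space of all `W ∈ L²(U)²` such that `∂_{d 0} W₀ + ∂_{d 1} W₁ ∈ L²(U)`.
An element is recorded as the pair `(W, D)`, `D` being the (unique) weak divergence of `W`,
so that the norm is `(‖W‖² + ‖D‖²)^{1/2}`. -/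
def divSpace (U : Set E) (d : Fin 2 → E) : Submodule ℂ (WithLp 2 (L2 U C2 × L2 U ℂ)) where
  carrier := {p | IsWeakDiv U d p.fst p.snd}
  zero_mem' := by
    intro φ hφ
    have h1 := Lp.coeFn_zero C2 2 ((volume : Measure E).restrict U)
    have h2 := Lp.coeFn_zero ℂ 2 ((volume : Measure E).restrict U)
    simp only [WithLp.zero_fst, WithLp.zero_snd]
    refine (integral_eq_zero_of_ae ?_).trans (neg_eq_zero.2 (integral_eq_zero_of_ae ?_)).symm
    · filter_upwards [h1] with x hx
      rw [hx]
      simp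
    · filter_upwards [h2] with x hx
      rw [hx]
      simp
  add_mem' := by
    intro p q hp hq φ hφ
    have h1 := Lp.coeFn_add p.fst q.fst
    have h2 := Lp.coeFn_add p.snd q.snd
    have key : ∀ r : L2 U C2, Integrable
        (fun x => ∑ j : Fin 2, (fderiv ℝ φ x (d j)) • r x j) (volume.restrict U) := fun r =>
      integrable_finsetSum _ fun j _ => integrable_smul_apply_of_compactSupport r
        (hφ.deriv_continuous _) (hφ.deriv_compact _) j
    simp only [WithLp.add_fst, WithLp.add_snd]
    rw [integral_congr_ae (g := fun x => (∑ j : Fin 2, (fderiv ℝ φ x (d j)) • p.fst x j) +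
        ∑ j : Fin 2, (fderiv ℝ φ x (d j)) • q.fst x j),
      integral_congr_ae (f := fun x => φ x • (p.snd + q.snd : L2 U ℂ) x)
        (g := fun x => φ x • p.snd x + φ x • q.snd x)]
    · rw [integral_add (key _) (key _),
        integral_add (integrable_smul_of_compactSupport _ hφ.1.continuous hφ.2.1)
          (integrable_smul_of_compactSupport _ hφ.1.continuous hφ.2.1),
        hp φ hφ, hq φ hφ]
      ring
    · filter_upwards [h2] with x hx
      rw [hx]
      simp [mul_add]
    · filter_upwards [h1] with x hx
      rw [hx]
      simp
      ring
  smul_mem' := by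
    intro c p hp φ hφ
    have h1 := Lp.coeFn_smul c p.fst
    have h2 := Lp.coeFn_smul c p.snd
    simp only [WithLp.smul_fst, WithLp.smul_snd]
    rw [integral_congr_ae (g := fun x => c • ∑ j : Fin 2, ((fderiv ℝ φ x (d j)) • p.fst x j)),
      integral_congr_ae (f := fun x => φ x • (c • p.snd : L2 U ℂ) x)
        (g := fun x => c • (φ x • p.snd x))]
    · rw [integral_smul, integral_smul, hp φ hφ, smul_neg]
    · filter_upwards [h2] with x hx
      simp only [hx, Pi.smul_apply]
      rw [smul_comm]
    · filter_upwards [h1] with x hx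
      simp only [hx, Pi.smul_apply, PiLp.smul_apply, Finset.smul_sum]
      exact Finset.sum_congr rfl fun j _ => smul_comm _ _ _

end Weak

/-! ### Geometry -/

/-- The columns of the cut matrix `C = [[1, 0], [0, θ₁], [0, θ₂]]`. Hence the derivatives in the
directions `cutFrame θ₁ θ₂ j` are the two components of `Cᵀ∇`, and the associated divergence of
`W` is `∇ᵀ C W`. -/
def cutFrame (θ₁ θ₂ : ℝ) : Fin 2 → ℝ × ℝ × ℝ := ![(1, 0, 0), (0, θ₁, θ₂)]

/-- The canonical basis of `ℝ²`. -/
def planeFrame : Fin 2 → ℝ × ℝ := ![(1, 0), (0, 1)]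

/-- `Ω_per = I × ℝ × (0, 1)`. -/
def OmegaPer (I : Set ℝ) : Set (ℝ × ℝ × ℝ) := I ×ˢ (univ : Set ℝ) ×ˢ Ioo (0 : ℝ) 1

/-- `Q = I × ℝ`. -/
def Q (I : Set ℝ) : Set (ℝ × ℝ) := I ×ˢ (univ : Set ℝ)

/-- The face `Σ^τ_per = {τ} × ℝ × (0, 1)`, identified with `ℝ × (0, 1)`. -/
def SigmaPer : Set (ℝ × ℝ) := (univ : Set ℝ) ×ˢ Ioo (0 : ℝ) 1

/-- Lebesgue measure on `(0, 1)`. -/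
abbrev unitMeasure : Measure ℝ := volume.restrict (Ioo (0 : ℝ) 1)

/-- The shear transform `S V ((x, z), s) = (E V)(x, θ₁ z, θ₂ z + s)`, where `E V` is the
`1`-periodic extension of `V` in the last variable: `(E V)(x, z₁, z₂) = V (x, z₁, z₂ - ⌊z₂⌋)`. -/
def shear {F : Type*} (θ₁ θ₂ : ℝ) (V : ℝ × ℝ × ℝ → F) (p : ℝ × ℝ) (s : ℝ) : F :=
  V (p.1, θ₁ * p.2, Int.fract (θ₂ * p.2 + s))

/-- The shear transform of a function on the face: `S Φ (z, s) = (E Φ)(θ₁ z, θ₂ z + s)`. -/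
def faceShear (θ₁ θ₂ : ℝ) (Φ : ℝ × ℝ → ℂ) (z s : ℝ) : ℂ :=
  Φ (θ₁ * z, Int.fract (θ₂ * z + s))

/-! ### The shear transform is well defined on classes of functions modulo null sets -/

theorem fract_qmp : Measure.QuasiMeasurePreserving (Int.fract : ℝ → ℝ) volume unitMeasure := by
  refine ⟨measurable_fract, Measure.AbsolutelyContinuous.mk fun N hN h0 => ?_⟩
  rw [Measure.map_apply measurable_fract hN]
  rw [Measure.restrict_apply hN] at h0
  refine measure_mono_null (t := (⋃ n : ℤ, (fun t : ℝ => t + -(n : ℝ)) ⁻¹' (N ∩ Ioo 0 1)) ∪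
    range (fun n : ℤ => (n : ℝ))) ?_ ?_
  · intro t ht
    by_cases h : Int.fract t = 0
    · right
      refine ⟨⌊t⌋, ?_⟩
      have := Int.self_sub_floor t
      simp only
      linarith
    · left
      refine mem_iUnion.2 ⟨⌊t⌋, ?_⟩
      have e : t + -(⌊t⌋ : ℝ) = Int.fract t := by rw [← Int.self_sub_floor]; ring
      simp only [mem_preimage, e]
      exact ⟨ht, lt_of_le_of_ne (Int.fract_nonneg t) (Ne.symm h), Int.fract_lt_one t⟩
  · refine measure_union_null (measure_iUnion_null fun n => ?_)
      ((countable_range _).measure_zero volume)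
    rw [measure_preimage_add_right]
    exact h0

theorem face_qmp (θ₁ θ₂ : ℝ) (hθ : θ₁ ≠ 0) :
    Measure.QuasiMeasurePreserving
      (fun p : ℝ × ℝ => (θ₁ * p.1, Int.fract (θ₂ * p.1 + p.2)))
      ((volume : Measure ℝ).prod volume) ((volume : Measure ℝ).prod unitMeasure) := by
  have h1 : Measure.QuasiMeasurePreserving (fun z : ℝ => θ₁ * z) volume volume := by
    refine ⟨by fun_prop, ?_⟩
    rw [Real.map_volume_mul_left hθ]
    exact Measure.smul_absolutelyContinuous
  have h2 : MeasurePreserving (fun p : ℝ × ℝ => (p.1, θ₂ * p.1 + p.2))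
      ((volume : Measure ℝ).prod volume) ((volume : Measure ℝ).prod volume) :=
    (MeasurePreserving.id _).skew_product (g := fun z s => θ₂ * z + s) (by fun_prop)
      (Filter.Eventually.of_forall fun z => (measurePreserving_add_left volume (θ₂ * z)).map_eq)
  exact (QuasiMeasurePreserving.prodMap h1 fract_qmp).comp h2.quasiMeasurePreserving

theorem volume_face :
    (volume : Measure (ℝ × ℝ)).restrict SigmaPer = (volume : Measure ℝ).prod unitMeasure := by
  rw [SigmaPer, Measure.volume_eq_prod, ← Measure.prod_restrict, Measure.restrict_univ]

theorem volume_Q (I : Set ℝ) :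
    (volume : Measure (ℝ × ℝ)).restrict (Q I) = (volume.restrict I).prod volume := by
  rw [Q, Measure.volume_eq_prod, ← Measure.prod_restrict, Measure.restrict_univ]

theorem volume_Omega (I : Set ℝ) :
    (volume : Measure (ℝ × ℝ × ℝ)).restrict (OmegaPer I) =
      (volume.restrict I).prod ((volume : Measure ℝ).prod unitMeasure) := by
  rw [OmegaPer, Measure.volume_eq_prod, ← Measure.prod_restrict, ← volume_face, SigmaPer]

theorem face_ae (θ₁ θ₂ : ℝ) (hθ : θ₁ ≠ 0) {P : ℝ × ℝ → Prop}
    (h : ∀ᵐ y ∂(volume.restrict SigmaPer), P y) :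
    ∀ᵐ s ∂unitMeasure, ∀ᵐ z : ℝ, P (θ₁ * z, Int.fract (θ₂ * z + s)) := by
  rw [volume_face] at h
  have h1 := (face_qmp θ₁ θ₂ hθ).ae h
  have h2 := Measure.ae_ae_of_ae_prod
    ((Measure.measurePreserving_swap (μ := (volume : Measure ℝ))
      (ν := (volume : Measure ℝ))).quasiMeasurePreserving.ae h1)
  exact ae_restrict_of_ae h2

theorem shear_qmp (I : Set ℝ) (θ₁ θ₂ : ℝ) (hθ : θ₁ ≠ 0) :
    Measure.QuasiMeasurePreserving
      (fun p : (ℝ × ℝ) × ℝ => (p.1.1, θ₁ * p.1.2, Int.fract (θ₂ * p.1.2 + p.2)))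
      (((volume : Measure (ℝ × ℝ)).restrict (Q I)).prod volume)
      ((volume : Measure (ℝ × ℝ × ℝ)).restrict (OmegaPer I)) := by
  rw [volume_Omega, volume_Q]
  exact (QuasiMeasurePreserving.prodMap (Measure.QuasiMeasurePreserving.id (volume.restrict I))
    (face_qmp θ₁ θ₂ hθ)).comp
    (measurePreserving_prodAssoc (volume.restrict I) volume volume).quasiMeasurePreserving

theorem shear_ae (I : Set ℝ) (θ₁ θ₂ : ℝ) (hθ : θ₁ ≠ 0) {P : ℝ × ℝ × ℝ → Prop}
    (h : ∀ᵐ y ∂(volume.restrict (OmegaPer I)), P y) :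
    ∀ᵐ s ∂unitMeasure, ∀ᵐ p ∂((volume : Measure (ℝ × ℝ)).restrict (Q I)),
      P (p.1, θ₁ * p.2, Int.fract (θ₂ * p.2 + s)) := by
  have h1 := (shear_qmp I θ₁ θ₂ hθ).ae h
  have h2 := Measure.ae_ae_of_ae_prod
    ((Measure.measurePreserving_swap (μ := (volume : Measure ℝ))
      (ν := (volume : Measure (ℝ × ℝ)).restrict (Q I))).quasiMeasurePreserving.ae h1)
  exact ae_restrict_of_ae h2

/-! ### The spaces `H¹_{C,per}(Ω_per)` and `H_{C,per}(div; Ω_per)` -/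

/-- `H¹(Q)`. -/
abbrev H1Q (I : Set ℝ) : Type := gradSpace (Q I) planeFrame

/-- `H(div; Q)`. -/
abbrev HdivQ (I : Set ℝ) : Type := divSpace (Q I) planeFrame

/-- `{V ∈ L²(Ω_per) : S V ∈ L²(0, 1; H¹(Q))}`, as a subspace of `L²(Ω_per)`. -/
def gradPer (I : Set ℝ) (θ₁ θ₂ : ℝ) (hθ : θ₁ ≠ 0) : Submodule ℂ (L2 (OmegaPer I) ℂ) where
  carrier := {V | ∃ F : Lp (H1Q I) 2 unitMeasure, ∀ᵐ s ∂unitMeasure,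
    ((F s).1.fst : ℝ × ℝ → ℂ) =ᵐ[volume.restrict (Q I)] fun p => shear θ₁ θ₂ V p s}
  zero_mem' := by
    refine ⟨0, ?_⟩
    filter_upwards [Lp.coeFn_zero (H1Q I) 2 unitMeasure,
      shear_ae I θ₁ θ₂ hθ (Lp.coeFn_zero ℂ 2 (volume.restrict (OmegaPer I)))] with s h1 h2
    rw [h1]
    change ((0 : L2 (Q I) ℂ) : ℝ × ℝ → ℂ) =ᵐ[_]
      fun p => shear θ₁ θ₂ ((0 : L2 (OmegaPer I) ℂ) : ℝ × ℝ × ℝ → ℂ) p s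
    filter_upwards [Lp.coeFn_zero ℂ 2 (volume.restrict (Q I)), h2] with p h3 h4
    rw [h3, shear, h4]
    rfl
  add_mem' := by
    rintro V V' ⟨F, hF⟩ ⟨F', hF'⟩
    refine ⟨F + F', ?_⟩
    filter_upwards [Lp.coeFn_add F F', shear_ae I θ₁ θ₂ hθ (Lp.coeFn_add V V'), hF, hF']
      with s h1 h2 h3 h4
    rw [h1]
    simp only [Pi.add_apply, Submodule.coe_add, WithLp.add_fst]
    filter_upwards [Lp.coeFn_add (F s).1.fst (F' s).1.fst, h2, h3, h4] with p h5 h6 h7 h8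
    rw [h5, Pi.add_apply, h7, h8]
    simp only [shear, h6, Pi.add_apply]
  smul_mem' := by
    rintro c V ⟨F, hF⟩
    refine ⟨c • F, ?_⟩
    filter_upwards [Lp.coeFn_smul c F, shear_ae I θ₁ θ₂ hθ (Lp.coeFn_smul c V), hF]
      with s h1 h2 h3
    rw [h1]
    simp only [Pi.smul_apply, Submodule.coe_smul, WithLp.smul_fst]
    filter_upwards [Lp.coeFn_smul c (F s).1.fst, h2, h3] with p h5 h6 h7
    rw [h5, Pi.smul_apply, h7]
    simp only [shear, h6, Pi.smul_apply]

/-- `{W ∈ L²(Ω_per)² : S W ∈ L²(0, 1; H(div; Q))}`, as a subspace of `L²(Ω_per)²`. -/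
def divPer (I : Set ℝ) (θ₁ θ₂ : ℝ) (hθ : θ₁ ≠ 0) : Submodule ℂ (L2 (OmegaPer I) C2) where
  carrier := {W | ∃ F : Lp (HdivQ I) 2 unitMeasure, ∀ᵐ s ∂unitMeasure,
    ((F s).1.fst : ℝ × ℝ → C2) =ᵐ[volume.restrict (Q I)] fun p => shear θ₁ θ₂ W p s}
  zero_mem' := by
    refine ⟨0, ?_⟩
    filter_upwards [Lp.coeFn_zero (HdivQ I) 2 unitMeasure,
      shear_ae I θ₁ θ₂ hθ (Lp.coeFn_zero C2 2 (volume.restrict (OmegaPer I)))] with s h1 h2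
    rw [h1]
    change ((0 : L2 (Q I) C2) : ℝ × ℝ → C2) =ᵐ[_]
      fun p => shear θ₁ θ₂ ((0 : L2 (OmegaPer I) C2) : ℝ × ℝ × ℝ → C2) p s
    filter_upwards [Lp.coeFn_zero C2 2 (volume.restrict (Q I)), h2] with p h3 h4
    rw [h3, shear, h4]
    rfl
  add_mem' := by
    rintro V V' ⟨F, hF⟩ ⟨F', hF'⟩
    refine ⟨F + F', ?_⟩
    filter_upwards [Lp.coeFn_add F F', shear_ae I θ₁ θ₂ hθ (Lp.coeFn_add V V'), hF, hF']
      with s h1 h2 h3 h4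
    rw [h1]
    simp only [Pi.add_apply, Submodule.coe_add, WithLp.add_fst]
    filter_upwards [Lp.coeFn_add (F s).1.fst (F' s).1.fst, h2, h3, h4] with p h5 h6 h7 h8
    rw [h5, Pi.add_apply, h7, h8]
    simp only [shear, h6, Pi.add_apply]
  smul_mem' := by
    rintro c V ⟨F, hF⟩
    refine ⟨c • F, ?_⟩
    filter_upwards [Lp.coeFn_smul c F, shear_ae I θ₁ θ₂ hθ (Lp.coeFn_smul c V), hF]
      with s h1 h2 h3
    rw [h1]
    simp only [Pi.smul_apply, Submodule.coe_smul, WithLp.smul_fst]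
    filter_upwards [Lp.coeFn_smul c (F s).1.fst, h2, h3] with p h5 h6 h7
    rw [h5, Pi.smul_apply, h7]
    simp only [shear, h6, Pi.smul_apply]

/-- `H¹_{C,per}(Ω_per)` with the norm `(‖V‖² + ‖Cᵀ∇V‖²)^{1/2}`: an element is the pair
`(V, Cᵀ∇V)` with `V ∈ gradPer`. (The weak gradient `Cᵀ∇V` is uniquely determined by `V`.) -/
def H1per (I : Set ℝ) (θ₁ θ₂ : ℝ) (hθ : θ₁ ≠ 0) :
    Submodule ℂ (WithLp 2 (L2 (OmegaPer I) ℂ × L2 (OmegaPer I) C2)) :=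
  gradSpace (OmegaPer I) (cutFrame θ₁ θ₂) ⊓
    (gradPer I θ₁ θ₂ hθ).comap (WithLp.fstₗ 2 ℂ (L2 (OmegaPer I) ℂ) (L2 (OmegaPer I) C2))

/-- `H_{C,per}(div; Ω_per)` with the norm `(‖W‖² + ‖∇ᵀC W‖²)^{1/2}`: an element is the pair
`(W, ∇ᵀC W)` with `W ∈ divPer`. (The weak divergence `∇ᵀC W` is uniquely determined by `W`.) -/
def Hdivper (I : Set ℝ) (θ₁ θ₂ : ℝ) (hθ : θ₁ ≠ 0) :
    Submodule ℂ (WithLp 2 (L2 (OmegaPer I) C2 × L2 (OmegaPer I) ℂ)) :=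
  divSpace (OmegaPer I) (cutFrame θ₁ θ₂) ⊓
    (divPer I θ₁ θ₂ hθ).comap (WithLp.fstₗ 2 ℂ (L2 (OmegaPer I) C2) (L2 (OmegaPer I) ℂ))

/-! ### The trace spaces -/

/-- `H^{1/2}(ℝ)`: all `φ ∈ L²(ℝ)` such that the tempered distribution with Fourier transform
`(1 + |ξ|²)^{1/4} φ̂(ξ)` is a function `g ∈ L²(ℝ)`. An element is recorded as the pair `(φ, g)`; the
norm is equivalent to `‖g‖`. -/
def Hhalf : Submodule ℂ
    (WithLp 2 (Lp ℂ 2 (volume : Measure ℝ) × Lp ℂ 2 (volume : Measure ℝ))) where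
  carrier := {p | TemperedDistribution.besselPotential ℝ ℂ (1 / 2)
    (Lp.toTemperedDistributionCLM ℂ volume 2 p.fst) = Lp.toTemperedDistributionCLM ℂ volume 2 p.snd}
  zero_mem' := by
    change TemperedDistribution.besselPotential ℝ ℂ (1 / 2)
      (Lp.toTemperedDistributionCLM ℂ volume 2 0) = Lp.toTemperedDistributionCLM ℂ volume 2 0
    rw [map_zero, map_zero]
  add_mem' := by
    intro p q hp hq
    simp only [mem_ofPred_eq, WithLp.add_fst, WithLp.add_snd, map_add] at *
    rw [hp, hq]
  smul_mem' := by
    intro c p hp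
    simp only [mem_ofPred_eq, WithLp.smul_fst, WithLp.smul_snd, map_smul] at *
    rw [hp]

/-- `H^{1/2}_{C,per}(Σ^τ_per) = {Φ ∈ L²(Σ^τ_per) : S Φ ∈ L²(0, 1; H^{1/2}(ℝ))}`. An element is
recorded as the pair `(Φ, S Φ)`. Since `‖S Φ‖_{L²(0,1;L²)}` is a constant multiple of `‖Φ‖_{L²}`,
the norm is equivalent to `‖S Φ‖_{L²(0, 1; H^{1/2})}`. -/
def Hhalfper (θ₁ θ₂ : ℝ) (hθ : θ₁ ≠ 0) :
    Submodule ℂ (WithLp 2 (L2 SigmaPer ℂ × Lp Hhalf 2 unitMeasure)) where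
  carrier := {p | ∀ᵐ s ∂unitMeasure,
    ((p.snd s).1.fst : ℝ → ℂ) =ᵐ[volume] fun z => faceShear θ₁ θ₂ p.fst z s}
  zero_mem' := by
    simp only [mem_ofPred_eq, WithLp.zero_fst, WithLp.zero_snd]
    filter_upwards [Lp.coeFn_zero Hhalf 2 unitMeasure,
      face_ae θ₁ θ₂ hθ (Lp.coeFn_zero ℂ 2 (volume.restrict SigmaPer))] with s h1 h2
    rw [h1]
    change ((0 : Lp ℂ 2 (volume : Measure ℝ)) : ℝ → ℂ) =ᵐ[_]
      fun z => faceShear θ₁ θ₂ ((0 : L2 SigmaPer ℂ) : ℝ × ℝ → ℂ) z s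
    filter_upwards [Lp.coeFn_zero ℂ 2 (volume : Measure ℝ), h2] with p h3 h4
    rw [h3, faceShear, h4]
    rfl
  add_mem' := by
    intro p q hp hq
    simp only [mem_ofPred_eq, WithLp.add_fst, WithLp.add_snd] at *
    filter_upwards [Lp.coeFn_add p.snd q.snd, face_ae θ₁ θ₂ hθ (Lp.coeFn_add p.fst q.fst),
      hp, hq] with s h1 h2 h3 h4
    rw [h1]
    simp only [Pi.add_apply, Submodule.coe_add, WithLp.add_fst]
    filter_upwards [Lp.coeFn_add (p.snd s).1.fst (q.snd s).1.fst, h2, h3, h4] with z h5 h6 h7 h8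
    rw [h5, Pi.add_apply, h7, h8]
    simp only [faceShear, h6, Pi.add_apply]
  smul_mem' := by
    intro c p hp
    simp only [mem_ofPred_eq, WithLp.smul_fst, WithLp.smul_snd] at *
    filter_upwards [Lp.coeFn_smul c p.snd, face_ae θ₁ θ₂ hθ (Lp.coeFn_smul c p.fst), hp]
      with s h1 h2 h3
    rw [h1]
    simp only [Pi.smul_apply, Submodule.coe_smul, WithLp.smul_fst]
    filter_upwards [Lp.coeFn_smul c (p.snd s).1.fst, h2, h3] with z h5 h6 h7
    rw [h5, Pi.smul_apply, h7]
    simp only [faceShear, h6, Pi.smul_apply]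

/-- `H^{-1/2}_{C,per}(Σ^τ_per)`, the topological dual of `H^{1/2}_{C,per}(Σ^τ_per)`. Its elements are
continuous antilinear functionals, so that `⟨Ψ, Φ⟩ = Ψ Φ` extends the `L²` scalar product
`∫ Ψ conj(Φ)`. -/
abbrev Hminushalfper (θ₁ θ₂ : ℝ) (hθ : θ₁ ≠ 0) : Type :=
  Hhalfper θ₁ θ₂ hθ →L⋆[ℂ] ℂ

/-! ### Traces -/

/-- `f : ℝ³ → F` is smooth, `1`-periodic in the last variable, and vanishes when one of the first
two variables is large. The restrictions of these functions to `Ω_per` are the functions smooth up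
to the boundary, compactly supported in the first two directions and periodic in the third. -/
def IsSmoothPer {F : Type*} [NormedAddCommGroup F] [NormedSpace ℝ F]
    (f : ℝ × ℝ × ℝ → F) : Prop :=
  ContDiff ℝ ∞ f ∧ (∀ x z₁ z₂ : ℝ, f (x, z₁, z₂ + 1) = f (x, z₁, z₂)) ∧
    ∃ R : ℝ, ∀ x z₁ z₂ : ℝ, (R < |x| ∨ R < |z₁|) → f (x, z₁, z₂) = 0

/-- The first component of the unit normal vector `n = ± e_x` on the face `x = τ`, outward with
respect to `I × ℝ × (0, 1)`, for an endpoint `τ` of the interval `I`. -/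
def outward (I : Set ℝ) (τ : ℝ) : ℝ :=
  open scoped Classical in if τ ∈ upperBounds I then 1 else -1

/-- `C w · n` for `w ∈ ℂ²` and `n = ν e_x`. -/
def cutNormal (θ₁ θ₂ ν : ℝ) (w : C2) : ℂ :=
  ∑ j : Fin 2, ((ν * (cutFrame θ₁ θ₂ j).1 : ℝ) : ℂ) * w j

/-- `T` extends the trace `V ↦ V|_{x = τ}` of smooth functions. -/
def ExtendsTrace (I : Set ℝ) (θ₁ θ₂ : ℝ) (hθ : θ₁ ≠ 0) (τ : ℝ)
    (T : H1per I θ₁ θ₂ hθ →L[ℂ] Hhalfper θ₁ θ₂ hθ) : Prop :=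
  ∀ (V : H1per I θ₁ θ₂ hθ) (f : ℝ × ℝ × ℝ → ℂ), IsSmoothPer f →
    V.1.fst =ᵐ[volume.restrict (OmegaPer I)] f →
    (T V).1.fst =ᵐ[volume.restrict SigmaPer] fun y => f (τ, y)

/-- `T` extends the normal trace `W ↦ (C W · n)|_{x = τ}` of smooth functions, a function on the face
being identified with the antilinear functional `Φ ↦ ∫ (C W · n) conj(Φ)`. -/
def ExtendsNormalTrace (I : Set ℝ) (θ₁ θ₂ : ℝ) (hθ : θ₁ ≠ 0) (τ : ℝ)
    (T : Hdivper I θ₁ θ₂ hθ →L[ℂ] Hminushalfper θ₁ θ₂ hθ) : Prop :=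
  ∀ (W : Hdivper I θ₁ θ₂ hθ) (f : ℝ × ℝ × ℝ → C2), IsSmoothPer f →
    W.1.fst =ᵐ[volume.restrict (OmegaPer I)] f →
    ∀ Φ : Hhalfper θ₁ θ₂ hθ,
      T W Φ = ∫ y in SigmaPer, cutNormal θ₁ θ₂ (outward I τ) (f (τ, y)) * conj (Φ.1.fst y)

end CutPer

end

noncomputable section

namespace CutPer

/-! ### Intervals -/

/-! The shear `(s, (x, z)) ↦ (x, θ₁ z, fract (θ₂ z + s))` carries `(0, 1) × Q` to `Ω_per`, up to
null sets and the factor `|θ₁|⁻¹` in the measure, and it turns the two components of `Cᵀ∇` into the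
partial derivatives of the plane. So `H¹_{C,per}`, `H_{C,per}(div)` and the trace space are, up to
equivalence of norms, the spaces of square integrable families on `(0, 1)` with values in `H¹(Q)`,
`H(div; Q)` and `H^{1/2}(ℝ)` (`gradIso`, `divIso`, `halfIso`). The work is done on the half-plane or
strip `Q` and then integrated over `s`.

On `Q` four facts are needed. Density: if `V` is orthogonal in `H¹(Q)` to all smooth functions, then
`u = V` and `w = ∇V`, extended by zero, satisfy `div w = u` across the boundary of `Q` and `w = ∇u`
inside. Testing one relation against the other through a mollifier contracted towards an interior
point yields `∫ |u|² + |w|² = 0`. Exchanging the two relations gives density in `H(div; Q)`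
(`eq_zero_of_dual`). Trace: after a Fourier transform in `z`, the fundamental theorem of calculus in
`x` bounds `(1 + ξ²)^{1/2} |a(τ)|²` by `∫ (1 + ξ²) |a|² + |a'|²` (`norm_sq_trace_le`). Lift: the
multiplier `χ(x) exp(-(1 + ξ²)(x - τ)²)` equals `1` at `x = τ`, and its integrals in `x` gain
exactly the half power of `1 + ξ²` that `H^{1/2}` requires (`lintegral_synth_le`). Green: for
regular functions it is Fubini and calculus (`green_C1`). By density, a function with vanishing
traces pairs to zero with every field of `H(div; Q)` (`pairing_eq_zero_of_traceQ`).

The normal trace is defined by pairing `W` with a lift of `Φ` whose trace at the other endpoint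
vanishes. Green's formula follows because `V` minus the lifts of its traces has no traces
(`famPairing_green`). For surjectivity, the functional `V ↦ Ψ(V|_Σ)` is represented by some `R`
through Riesz. It kills test functions, so `div ∇R = R` on almost every leaf; pairing with the field
`∇R` is then the inner product with `R`, and a multiple of this field has normal trace `Ψ`
(`normalFam_surjective`). Uniqueness of both extensions holds because the families `χ(s) g(x, z)`,
with `χ` a test function on `(0, 1)` and `g` smooth with compact support, are total and come from
smooth periodic functions. -/

theorem interior_cases {I : Set ℝ} (hI : I.OrdConnected) (hI_int : (interior I).Nonempty)
    (hI_ne : I ≠ univ) :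
    (∃ a, interior I = Ioi a ∧ frontier I = {a} ∧ outward I a = -1) ∨
    (∃ b, interior I = Iio b ∧ frontier I = {b} ∧ outward I b = 1) ∨
    (∃ a b, a < b ∧ interior I = Ioo a b ∧ frontier I = {a, b} ∧ outward I a = -1 ∧
      outward I b = 1) := by
  have hlt : ∀ a : ℝ, ∀ x ∈ interior I, a < x → a ∉ upperBounds I := fun a x hx hax h =>
    absurd (h (interior_subset hx)) (not_le.2 hax)
  have h := hI.isPreconnected.mem_intervals
  have key : ∀ a b : ℝ, interior I = Ioo a b → frontier I = {a, b} → b ∈ upperBounds I →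
      (∃ a b, a < b ∧ interior I = Ioo a b ∧ frontier I = {a, b} ∧ outward I a = -1 ∧
      outward I b = 1) := by
    intro a b h1 h2 h3
    have hab : a < b := by
      obtain ⟨x, hx⟩ := hI_int
      rw [h1] at hx
      exact hx.1.trans hx.2
    refine ⟨a, b, hab, h1, h2, ?_, by simp [outward, h3]⟩
    obtain ⟨x, hx⟩ := hI_int
    have := hlt a x hx (by rw [h1] at hx; exact hx.1)
    simp [outward, this]
  have hne : ∀ a b : ℝ, interior I ⊆ Ioo a b → a < b := by
    intro a b h
    obtain ⟨x, hx⟩ := hI_int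
    exact (h hx).1.trans (h hx).2
  simp only [mem_insert_iff, mem_singleton_iff] at h
  -- Only the shape of the interval is used from here on, so the endpoints may be arbitrary names.
  generalize sInf I = a at h
  generalize sSup I = b at h
  rcases h with h | h | h | h | h | h | h | h | h | h
  · have hab := hne a b (by rw [h, interior_Icc])
    exact Or.inr (Or.inr (key a b (by rw [h, interior_Icc]) (by rw [h, frontier_Icc hab.le])
      (by rw [h]; exact fun x hx => hx.2)))
  · have hab := hne a b (by rw [h, interior_Ico])
    exact Or.inr (Or.inr (key a b (by rw [h, interior_Ico]) (by rw [h, frontier_Ico hab])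
      (by rw [h]; exact fun x hx => hx.2.le)))
  · have hab := hne a b (by rw [h, interior_Ioc])
    exact Or.inr (Or.inr (key a b (by rw [h, interior_Ioc]) (by rw [h, frontier_Ioc hab])
      (by rw [h]; exact fun x hx => hx.2)))
  · have hab := hne a b (by rw [h, interior_Ioo])
    exact Or.inr (Or.inr (key a b (by rw [h, interior_Ioo]) (by rw [h, frontier_Ioo hab])
      (by rw [h]; exact fun x hx => hx.2.le)))
  · refine Or.inl ⟨a, by rw [h, interior_Ici], by rw [h, frontier_Ici], ?_⟩
    have := hlt a (a + 1) (by rw [h, interior_Ici]; simp) (by simp)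
    simp [outward, this]
  · refine Or.inl ⟨a, by rw [h, interior_Ioi], by rw [h, frontier_Ioi], ?_⟩
    have := hlt a (a + 1) (by rw [h, interior_Ioi]; simp) (by simp)
    simp [outward, this]
  · refine Or.inr (Or.inl ⟨b, by rw [h, interior_Iic], by rw [h, frontier_Iic], ?_⟩)
    have : b ∈ upperBounds I := by rw [h]; exact fun x hx => hx
    simp [outward, this]
  · refine Or.inr (Or.inl ⟨b, by rw [h, interior_Iio], by rw [h, frontier_Iio], ?_⟩)
    have : b ∈ upperBounds I := by rw [h]; exact fun x hx => le_of_lt hx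
    simp [outward, this]
  · exact absurd h hI_ne
  · rw [h] at hI_int
    simp at hI_int

theorem finite_frontier {I : Set ℝ} (hI : I.OrdConnected) (hI_int : (interior I).Nonempty)
    (hI_ne : I ≠ univ) : (frontier I).Finite := by
  rcases interior_cases hI hI_int hI_ne with ⟨a, -, h, -⟩ | ⟨a, -, h, -⟩ | ⟨a, b, -, -, h, -⟩ <;>
    rw [h]
  · exact finite_singleton a
  · exact finite_singleton a
  · exact (finite_singleton b).insert a

theorem outward_sq (I : Set ℝ) (τ : ℝ) : outward I τ * outward I τ = 1 := by
  unfold outward; split_ifs <;> norm_num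

/-- The frontier is null. Test functions see only the interior of a set, whereas the `L²` spaces
live on the whole set; this bridges the two. -/
theorem restrict_interval {I : Set ℝ} (h : (frontier I).Finite) :
    (volume : Measure ℝ).restrict (interior I) = volume.restrict I := by
  refine Measure.restrict_congr_set ?_
  exact interior_ae_eq_of_null_frontier (h.measure_zero _)

/-- The fundamental theorem of calculus on an interval, possibly unbounded. -/
theorem integral_deriv_interval {I : Set ℝ} (hI : I.OrdConnected)
    (hI_int : (interior I).Nonempty) (hI_ne : I ≠ univ) [Fintype (frontier I)] {f f' : ℝ → ℂ}
    (hf : ∀ x, HasDerivAt f (f' x) x) (hf' : Continuous f') (hc : HasCompactSupport f) :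
    ∫ x in I, f' x = ∑ τ : frontier I, (outward I τ : ℂ) * f τ := by
  have hd : f' = deriv f := funext fun x => (hf x).deriv.symm
  have hc' : HasCompactSupport f' := hd ▸ hc.deriv
  have hint : Integrable f' := hf'.integrable_of_hasCompactSupport hc'
  have hz := hc.isCompact
  have hfc : Continuous f := continuous_iff_continuousAt.2 fun x => (hf x).continuousAt
  -- Compact support removes any contribution from infinity when the interval is a half-line.
  have htop : Filter.Tendsto f Filter.atTop (nhds 0) :=
    (hc.is_zero_at_infty).mono_left (by rw [cocompact_eq_atBot_atTop]; exact le_sup_right)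
  have hbot : Filter.Tendsto f Filter.atBot (nhds 0) :=
    (hc.is_zero_at_infty).mono_left (by rw [cocompact_eq_atBot_atTop]; exact le_sup_left)
  rw [← restrict_interval (finite_frontier hI hI_int hI_ne)]
  have hs : ∑ τ : frontier I, (outward I τ : ℂ) * f τ =
      ∑ τ ∈ (frontier I).toFinset, (outward I τ : ℂ) * f τ :=
    (Finset.sum_subtype (frontier I).toFinset (fun x => by simp)
      (fun τ => (outward I τ : ℂ) * f τ)).symm
  rw [hs]
  rcases interior_cases hI hI_int hI_ne with ⟨a, h1, h2, h3⟩ | ⟨a, h1, h2, h3⟩ |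
    ⟨a, b, hab, h1, h2, h3, h4⟩
  · have : (frontier I).toFinset = {a} := by ext x; simp [h2]
    rw [this, h1, integral_Ioi_of_hasDerivAt_of_tendsto' (fun x _ => hf x) hint.integrableOn htop]
    simp [h3]
  · have : (frontier I).toFinset = {a} := by ext x; simp [h2]
    rw [this, h1, ← integral_Iic_eq_integral_Iio,
      integral_Iic_of_hasDerivAt_of_tendsto' (fun x _ => hf x) hint.integrableOn hbot]
    simp [h3]
  · have : (frontier I).toFinset = {a, b} := by ext x; simp [h2]
    rw [this, h1, ← integral_Ioc_eq_integral_Ioo, ← intervalIntegral.integral_of_le hab.le,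
      intervalIntegral.integral_eq_sub_of_hasDerivAt (fun x _ => hf x) hint.intervalIntegrable,
      Finset.sum_pair hab.ne, h3, h4]
    push_cast
    ring

/-- A smooth cutoff function, equal to `1` at the end point `τ` of `I` and to `0` at the
other ones. -/
structure IsCutoff (I : Set ℝ) (τ : frontier I) (χ : ℝ → ℝ) : Prop where
  contDiff : ContDiff ℝ ∞ χ
  compact : HasCompactSupport χ
  self : χ τ = 1
  other : ∀ τ' : frontier I, τ' ≠ τ → χ τ' = 0

theorem exists_cutoff {I : Set ℝ} (h : (frontier I).Finite) (τ : frontier I) :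
    ∃ χ, IsCutoff I τ χ := by
  have h1 : IsClosed (frontier I \ {(τ : ℝ)}) := (h.subset sdiff_subset).isClosed
  obtain ⟨r, hr, hb⟩ := Metric.isOpen_iff.1 h1.isOpen_compl (τ : ℝ) (by simp)
  let χ : ContDiffBump (τ : ℝ) := ⟨r / 2, r, by positivity, by linarith⟩
  refine ⟨χ, χ.contDiff, χ.hasCompactSupport, χ.one_of_mem_closedBall (by simp [χ.rIn_pos.le]), ?_⟩
  intro τ' hτ
  refine χ.zero_of_le_dist ?_
  by_contra hlt
  have := hb (Metric.mem_ball.2 (not_le.1 hlt))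
  simp only [mem_compl_iff, mem_sdiff, mem_singleton_iff, not_and, not_not] at this
  exact hτ (Subtype.ext (this τ'.2))

/-- The fundamental theorem of calculus for `χ f`: the cutoff supplies compact support, not assumed
of `f`, and isolates a single endpoint. -/
theorem integral_cutoff_interval {I : Set ℝ} (hI : I.OrdConnected)
    (hI_int : (interior I).Nonempty) (hI_ne : I ≠ univ) {τ : frontier I} {χ : ℝ → ℝ}
    (hχ : IsCutoff I τ χ) {f f' : ℝ → ℂ}
    (hf : ∀ x, HasDerivAt f (f' x) x) (hf' : Continuous f') :
    ∫ x in I, (((deriv χ x : ℝ) : ℂ) * f x + χ x * f' x) = (outward I τ : ℂ) * f τ := by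
  classical
  have := (finite_frontier hI hI_int hI_ne).fintype
  have hfc : Continuous f := continuous_iff_continuousAt.2 fun x => (hf x).continuousAt
  have h1 : ∀ x, HasDerivAt (fun x => (χ x : ℂ)) ((deriv χ x : ℝ) : ℂ) x := fun x =>
    ((hχ.contDiff.differentiable (by simp)) x).hasDerivAt.ofReal_comp
  have h2 : Continuous (deriv χ) := hχ.contDiff.continuous_deriv (by simp)
  have hc : HasCompactSupport (fun x => (χ x : ℂ) * f x) :=
    (hχ.compact.comp_left (g := ((↑) : ℝ → ℂ)) (by simp)).mul_right
  rw [integral_deriv_interval hI hI_int hI_ne (f := fun x => (χ x : ℂ) * f x)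
    (fun x => (h1 x).mul (hf x)) (by have := hχ.contDiff.continuous; fun_prop) hc]
  rw [Finset.sum_eq_single τ (fun τ' _ h => by simp [hχ.other τ' h]) (by simp)]
  simp [hχ.self]

/-! ### Smooth functions with compact support as elements of the weak spaces -/

section WeakTheory

set_option linter.unusedSectionVars false

variable {E : Type*} [NormedAddCommGroup E] [NormedSpace ℝ E]

/-- Smooth functions with compact support. -/
def IsSmoothC {F : Type*} [NormedAddCommGroup F] [NormedSpace ℝ F] (f : E → F) : Prop :=
  ContDiff ℝ ∞ f ∧ HasCompactSupport f

/-- The derivatives of `f` in the directions `d 0`, `d 1`. -/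
def smoothGrad (d : Fin 2 → E) (f : E → ℂ) (x : E) : C2 :=
  WithLp.toLp 2 fun j => fderiv ℝ f x (d j)

/-- The divergence of `f` with respect to the directions `d 0`, `d 1`. -/
def smoothDiv (d : Fin 2 → E) (f : E → C2) (x : E) : ℂ :=
  ∑ j, fderiv ℝ f x (d j) j

theorem IsSmoothC.continuous {F : Type*} [NormedAddCommGroup F] [NormedSpace ℝ F] {f : E → F}
    (h : IsSmoothC f) : Continuous f := h.1.continuous

theorem IsSmoothC.fderiv_apply {F : Type*} [NormedAddCommGroup F] [NormedSpace ℝ F] {f : E → F}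
    (h : IsSmoothC f) (v : E) : IsSmoothC fun x => fderiv ℝ f x v :=
  ⟨(h.1.fderiv_right (m := ∞) (by simp)).clm_apply contDiff_const, h.2.fderiv_apply ℝ v⟩

theorem IsSmoothC.clm_comp {F G : Type*} [NormedAddCommGroup F] [NormedSpace ℝ F]
    [NormedAddCommGroup G] [NormedSpace ℝ G] {f : E → F} (h : IsSmoothC f) (L : F →L[ℝ] G) :
    IsSmoothC fun x => L (f x) :=
  ⟨L.contDiff.comp h.1, h.2.comp_left (map_zero L)⟩

theorem IsSmoothC.ofReal {f : E → ℝ} (h : IsSmoothC f) : IsSmoothC fun x => (f x : ℂ) :=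
  h.clm_comp Complex.ofRealCLM

/-- The inclusion of a coordinate axis in `ℂ²`. -/
def axis (j : Fin 2) : ℂ →L[ℝ] C2 :=
  (ContinuousLinearMap.toSpanSingleton ℂ (EuclideanSpace.single j (1 : ℂ) : C2)).restrictScalars ℝ

theorem axis_apply (j : Fin 2) (z : ℂ) : axis j z = EuclideanSpace.single j z := by
  ext i
  simp [axis]

/-- A coordinate of a vector of `ℂ²`. -/
def coord (j : Fin 2) : C2 →L[ℝ] ℂ :=
  (EuclideanSpace.proj (𝕜 := ℂ) j : C2 →L[ℂ] ℂ).restrictScalars ℝ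

@[simp] theorem coord_apply (j : Fin 2) (w : C2) : coord j w = w j := rfl

theorem IsSmoothC.grad {f : E → ℂ} (h : IsSmoothC f) (d : Fin 2 → E) :
    Continuous (smoothGrad d f) ∧ HasCompactSupport (smoothGrad d f) := by
  constructor
  · exact (PiLp.continuous_toLp 2 _).comp
      (continuous_pi fun j => (h.fderiv_apply (d j)).continuous)
  · have := h.2.fderiv ℝ
    exact this.comp_left (g := fun L : E →L[ℝ] ℂ => (WithLp.toLp 2 fun j => L (d j) : C2))
      (by ext; simp)

theorem IsSmoothC.div {f : E → C2} (h : IsSmoothC f) (d : Fin 2 → E) :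
    Continuous (smoothDiv d f) ∧ HasCompactSupport (smoothDiv d f) := by
  constructor
  · exact continuous_finsetSum _ fun j _ => ((h.fderiv_apply (d j)).clm_comp (coord j)).continuous
  · have := h.2.fderiv ℝ
    exact this.comp_left (g := fun L : E →L[ℝ] C2 => ∑ j, (L (d j)) j) (by simp)

theorem fderiv_ofReal {f : E → ℝ} (h : Differentiable ℝ f) (x v : E) :
    fderiv ℝ (fun y => (f y : ℂ)) x v = (fderiv ℝ f x v : ℂ) := by
  have := (Complex.ofRealCLM.hasFDerivAt.comp x (h x).hasFDerivAt).fderiv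
  rw [show (fun y => (f y : ℂ)) = Complex.ofRealCLM ∘ f from rfl, this]
  rfl

variable [MeasureSpace E] [BorelSpace E] [FiniteDimensional ℝ E]
  [(volume : Measure E).IsAddHaarMeasure]

theorem memLp_two {F : Type*} [NormedAddCommGroup F] (U : Set E) {f : E → F}
    (h : Continuous f) (h' : HasCompactSupport f) : MemLp f 2 (volume.restrict U) :=
  (h.memLp_of_hasCompactSupport h').restrict U

theorem inner_toLp_left {F : Type*} [NormedAddCommGroup F] [InnerProductSpace ℂ F]
    {X : Type*} [MeasurableSpace X] {μ : Measure X} {f : X → F} (hf : MemLp f 2 μ)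
    (V : Lp F 2 μ) : inner ℂ hf.toLp V = ∫ x, inner ℂ (f x) (V x) ∂μ := by
  rw [L2.inner_def]
  refine integral_congr_ae ?_
  filter_upwards [hf.coeFn_toLp] with x hx
  rw [hx]

theorem inner_toLp_right {F : Type*} [NormedAddCommGroup F] [InnerProductSpace ℂ F]
    {X : Type*} [MeasurableSpace X] {μ : Measure X} {f : X → F} (hf : MemLp f 2 μ)
    (V : Lp F 2 μ) : inner ℂ V hf.toLp = ∫ x, inner ℂ (V x) (f x) ∂μ := by
  rw [L2.inner_def]
  refine integral_congr_ae ?_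
  filter_upwards [hf.coeFn_toLp] with x hx
  rw [hx]

theorem IsTest.isSmoothC {U : Set E} {φ : E → ℝ} (h : IsTest U φ) : IsSmoothC φ := ⟨h.1, h.2.1⟩

/-- Read as an orthogonality relation, the distributional identity is visibly closed in `L²`, which
makes the graph spaces complete. -/
theorem isWeakGrad_iff_inner (U : Set E) (d : Fin 2 → E) (V : L2 U ℂ) (G : L2 U C2) :
    IsWeakGrad U d V G ↔ ∀ (φ : E → ℝ) (h : IsTest U φ) (j : Fin 2),
      inner ℂ (memLp_two U (h.isSmoothC.fderiv_apply (d j)).ofReal.continuous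
        (h.isSmoothC.fderiv_apply (d j)).ofReal.2).toLp V +
      inner ℂ (memLp_two U (h.isSmoothC.ofReal.clm_comp (axis j)).continuous
        (h.isSmoothC.ofReal.clm_comp (axis j)).2).toLp G = 0 := by
  refine forall_congr' fun φ => forall_congr' fun h => forall_congr' fun j => ?_
  rw [inner_toLp_left, inner_toLp_left, ← eq_neg_iff_add_eq_zero]
  simp [axis_apply, EuclideanSpace.inner_single_left, mul_comm]

/-- Here the relation says that `(W, D)` is orthogonal to the pairs `(∇φ, φ)`. Besides closedness,
this identifies the orthogonal complement of the test functions in `H¹` with fields whose divergence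
is known; see `exists_leafField`. -/
theorem isWeakDiv_iff_inner (U : Set E) (d : Fin 2 → E) (W : L2 U C2) (D : L2 U ℂ) :
    IsWeakDiv U d W D ↔ ∀ (φ : E → ℝ) (h : IsTest U φ),
      inner ℂ (memLp_two U (h.isSmoothC.ofReal.grad d).1
        (h.isSmoothC.ofReal.grad d).2).toLp W +
      inner ℂ (memLp_two U h.isSmoothC.ofReal.continuous
        h.isSmoothC.ofReal.2).toLp D = 0 := by
  refine forall_congr' fun φ => forall_congr' fun h => ?_
  rw [inner_toLp_left, inner_toLp_left, ← eq_neg_iff_add_eq_zero]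
  simp [smoothGrad, mul_comm, fderiv_ofReal (h.1.differentiable (by simp)),
    PiLp.inner_apply]

theorem isClosed_gradSpace (U : Set E) (d : Fin 2 → E) :
    IsClosed (gradSpace U d : Set (WithLp 2 (L2 U ℂ × L2 U C2))) := by
  have : (gradSpace U d : Set (WithLp 2 (L2 U ℂ × L2 U C2))) =
      {p | IsWeakGrad U d p.fst p.snd} := rfl
  rw [this]
  simp only [isWeakGrad_iff_inner, ofPred_forall]
  refine isClosed_iInter fun φ => isClosed_iInter fun h => isClosed_iInter fun j =>
    isClosed_eq ?_ continuous_const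
  exact ((innerSL ℂ _).continuous.comp (WithLp.fstL 2 ℂ _ _).continuous).add
    ((innerSL ℂ _).continuous.comp (WithLp.sndL 2 ℂ _ _).continuous)

theorem isClosed_divSpace (U : Set E) (d : Fin 2 → E) :
    IsClosed (divSpace U d : Set (WithLp 2 (L2 U C2 × L2 U ℂ))) := by
  have : (divSpace U d : Set (WithLp 2 (L2 U C2 × L2 U ℂ))) =
      {p | IsWeakDiv U d p.fst p.snd} := rfl
  rw [this]
  simp only [isWeakDiv_iff_inner, ofPred_forall]
  refine isClosed_iInter fun φ => isClosed_iInter fun h =>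
    isClosed_eq ?_ continuous_const
  exact ((innerSL ℂ _).continuous.comp (WithLp.fstL 2 ℂ _ _).continuous).add
    ((innerSL ℂ _).continuous.comp (WithLp.sndL 2 ℂ _ _).continuous)

instance (U : Set E) (d : Fin 2 → E) : CompleteSpace (gradSpace U d) :=
  (isClosed_gradSpace U d).completeSpace_coe

instance (U : Set E) (d : Fin 2 → E) : CompleteSpace (divSpace U d) :=
  (isClosed_divSpace U d).completeSpace_coe

/-! ### Uniqueness -/

/-- The fundamental lemma of the calculus of variations on the interior, combined with the
assumption that the boundary carries no mass. -/
theorem ae_eq_zero_of_isTest {F : Type*} [NormedAddCommGroup F] [NormedSpace ℝ F]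
    [CompleteSpace F] {U : Set E} (hU : volume.restrict (interior U) = volume.restrict U)
    {f : E → F} (hf : LocallyIntegrable f (volume.restrict U))
    (h : ∀ φ : E → ℝ, IsTest U φ → ∫ x in U, φ x • f x = 0) : f =ᵐ[volume.restrict U] 0 := by
  have h1 := isOpen_interior.ae_eq_zero_of_integral_contDiff_smul_eq_zero (U := interior U)
    (hf.locallyIntegrableOn _) (fun g hg hg' hg'' => h g ⟨hg, hg', hg''⟩)
  have h2 : ∀ᵐ x ∂(volume.restrict U), x ∈ interior U := by
    rw [← hU]
    exact ae_restrict_mem isOpen_interior.measurableSet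
  filter_upwards [h1, h2] with x hx hx'
  exact hx hx'

theorem weakGrad_unique {U : Set E} (hU : volume.restrict (interior U) = volume.restrict U)
    {d : Fin 2 → E} {V : E → ℂ} {G G' : L2 U C2} (h : IsWeakGrad U d V G)
    (h' : IsWeakGrad U d V G') : G = G' := by
  have key : ∀ j : Fin 2, (fun x => G x j - G' x j) =ᵐ[volume.restrict U] 0 := by
    intro j
    refine ae_eq_zero_of_isTest hU ?_ fun φ hφ => ?_
    · have h1 := ((Lp.memLp G).locallyIntegrable (by norm_num)).sub
        ((Lp.memLp G').locallyIntegrable (by norm_num))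
      intro x
      obtain ⟨s, hs, hi⟩ := h1 x
      exact ⟨s, hs, (EuclideanSpace.proj (𝕜 := ℂ) j : C2 →L[ℂ] ℂ).integrable_comp hi⟩
    · simp only [smul_sub]
      rw [integral_sub (integrable_smul_apply_of_compactSupport _ hφ.1.continuous hφ.2.1 j)
        (integrable_smul_apply_of_compactSupport _ hφ.1.continuous hφ.2.1 j), sub_eq_zero]
      exact neg_injective ((h φ hφ j).symm.trans (h' φ hφ j))
  refine Lp.ext ?_
  filter_upwards [key 0, key 1] with x h0 h1
  ext j
  fin_cases j
  · exact sub_eq_zero.1 h0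
  · exact sub_eq_zero.1 h1

theorem weakDiv_unique {U : Set E} (hU : volume.restrict (interior U) = volume.restrict U)
    {d : Fin 2 → E} {W : E → C2} {D D' : L2 U ℂ} (h : IsWeakDiv U d W D)
    (h' : IsWeakDiv U d W D') : D = D' := by
  have key : (fun x => D x - D' x) =ᵐ[volume.restrict U] 0 := by
    refine ae_eq_zero_of_isTest hU ?_ fun φ hφ => ?_
    · exact ((Lp.memLp D).locallyIntegrable (by norm_num)).sub
        ((Lp.memLp D').locallyIntegrable (by norm_num))
    · simp only [smul_sub]
      rw [integral_sub (integrable_smul_of_compactSupport _ hφ.1.continuous hφ.2.1)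
        (integrable_smul_of_compactSupport _ hφ.1.continuous hφ.2.1), sub_eq_zero]
      exact neg_injective ((h φ hφ).symm.trans (h' φ hφ))
  refine Lp.ext ?_
  filter_upwards [key] with x h0
  exact sub_eq_zero.1 h0

theorem IsWeakGrad.congr {U : Set E} {d : Fin 2 → E} {V V' : E → ℂ} {G G' : E → C2}
    (h : IsWeakGrad U d V G) (hV : V =ᵐ[volume.restrict U] V')
    (hG : G =ᵐ[volume.restrict U] G') : IsWeakGrad U d V' G' := by
  intro φ hφ j
  have h1 := integral_congr_ae (hV.mono fun x hx => congrArg (fun y => fderiv ℝ φ x (d j) • y) hx)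
  have h2 := integral_congr_ae (hG.mono fun x hx => congrArg (fun y : C2 => φ x • y j) hx)
  exact h1.symm.trans ((h φ hφ j).trans (congrArg Neg.neg h2))

theorem IsWeakDiv.congr {U : Set E} {d : Fin 2 → E} {W W' : E → C2} {D D' : E → ℂ}
    (h : IsWeakDiv U d W D) (hW : W =ᵐ[volume.restrict U] W')
    (hD : D =ᵐ[volume.restrict U] D') : IsWeakDiv U d W' D' := by
  intro φ hφ
  have h1 := integral_congr_ae (hW.mono fun x hx => congrArg (fun y : C2 => ∑ j, fderiv ℝ φ x (d j) • y j) hx)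
  have h2 := integral_congr_ae (hD.mono fun x hx => congrArg (fun y => φ x • y) hx)
  exact h1.symm.trans ((h φ hφ).trans (congrArg Neg.neg h2))

/-! ### Classical derivatives are weak derivatives -/

/-- Since `φ` is supported inside `U`, both integrals extend to the whole space, where integration
by parts has no boundary term. Only line derivatives of `v` are required, which is what the lifts
built by Fourier synthesis provide. -/
theorem integral_test_by_parts {U : Set E} {φ : E → ℝ} (hφ : IsTest U φ) {v v' : E → ℂ} {e : E}
    (hv : Continuous v) (hv' : Continuous v') (h : ∀ x, HasLineDerivAt ℝ v (v' x) x e) :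
    ∫ x in U, fderiv ℝ φ x e • v x = - ∫ x in U, φ x • v' x := by
  have h0 : ∀ x ∉ U, φ x = 0 ∧ fderiv ℝ φ x e = 0 := by
    intro x hx
    have hx' : x ∉ tsupport φ := fun h => hx (interior_subset (hφ.2.2 h))
    refine ⟨image_eq_zero_of_notMem_tsupport hx', ?_⟩
    rw [image_eq_zero_of_notMem_tsupport fun h => hx' (tsupport_fderiv_subset ℝ h)]
    rfl
  rw [setIntegral_eq_integral_of_forall_compl_eq_zero (fun x hx => by simp [(h0 x hx).2]),
    setIntegral_eq_integral_of_forall_compl_eq_zero (fun x hx => by simp [(h0 x hx).1])]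
  have i1 : ∀ {ψ : E → ℝ} {g : E → ℂ}, Continuous ψ → HasCompactSupport ψ → Continuous g →
      Integrable (fun x => ψ x • g x) (volume : Measure E) := fun h1 h2 h3 =>
    (h1.smul h3).integrable_of_hasCompactSupport (h2.smul_right)
  have := integral_bilinear_hasLineDerivAt_right_eq_neg_left_of_integrable
    (μ := (volume : Measure E)) (f := φ) (f' := fun x => fderiv ℝ φ x e) (g := v) (g' := v')
    (v := e) (B := ContinuousLinearMap.lsmul ℝ ℝ)
    (i1 (hφ.deriv_continuous e) (hφ.deriv_compact e) hv) (i1 hφ.1.continuous hφ.2.1 hv')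
    (i1 hφ.1.continuous hφ.2.1 hv)
    (fun x _ => ((hφ.1.differentiable (by simp)) x).hasFDerivAt.hasLineDerivAt e)
    (fun x _ => h x)
  simp only [ContinuousLinearMap.lsmul_apply] at this
  rw [this, neg_neg]

theorem isWeakGrad_of_hasLineDerivAt (U : Set E) {d : Fin 2 → E} {v : E → ℂ} {G : E → C2}
    (hv : Continuous v) (hG : Continuous G)
    (h : ∀ j x, HasLineDerivAt ℝ v (G x j) x (d j)) : IsWeakGrad U d v G := fun _ hφ j =>
  integral_test_by_parts hφ hv ((coord j).continuous.comp hG) (h j)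

theorem IsSmoothC.isWeakGrad {f : E → ℂ} (h : IsSmoothC f) (U : Set E) (d : Fin 2 → E) :
    IsWeakGrad U d f (smoothGrad d f) :=
  isWeakGrad_of_hasLineDerivAt U h.continuous (h.grad d).1 fun j x =>
    ((h.1.differentiable (by simp)) x).hasFDerivAt.hasLineDerivAt (d j)

theorem IsSmoothC.isWeakDiv {f : E → C2} (h : IsSmoothC f) (U : Set E) (d : Fin 2 → E) :
    IsWeakDiv U d f (smoothDiv d f) := by
  intro φ hφ
  have i1 : ∀ {ψ : E → ℝ} {g : E → ℂ}, Continuous ψ → HasCompactSupport ψ → Continuous g →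
      Integrable (fun x => ψ x • g x) ((volume : Measure E).restrict U) := fun h1 h2 h3 =>
    ((h1.smul h3).integrable_of_hasCompactSupport (h2.smul_right)).restrict
  rw [integral_finsetSum _ fun j _ => i1 (hφ.deriv_continuous _) (hφ.deriv_compact _)
    (g := fun x => f x j) ((coord j).continuous.comp h.continuous)]
  simp only [smoothDiv, Finset.smul_sum]
  rw [integral_finsetSum _ fun j _ => i1 hφ.1.continuous hφ.2.1
    (g := fun x => fderiv ℝ f x (d j) j)
    ((coord j).continuous.comp (h.fderiv_apply (d j)).continuous), ← Finset.sum_neg_distrib]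
  refine Finset.sum_congr rfl fun j _ => integral_test_by_parts hφ
    ((coord j).continuous.comp h.continuous)
    ((coord j).continuous.comp (h.fderiv_apply (d j)).continuous) fun x => ?_
  have := (coord j).hasFDerivAt.comp x ((h.1.differentiable (by simp)) x).hasFDerivAt
  exact this.hasLineDerivAt (d j)

theorem IsSmoothC.memLp {F : Type*} [NormedAddCommGroup F] [NormedSpace ℝ F] {f : E → F}
    (h : IsSmoothC f) (U : Set E) : MemLp f 2 (volume.restrict U) := memLp_two U h.continuous h.2

theorem IsSmoothC.memLp_grad {f : E → ℂ} (h : IsSmoothC f) (U : Set E) (d : Fin 2 → E) :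
    MemLp (smoothGrad d f) 2 (volume.restrict U) := memLp_two U (h.grad d).1 (h.grad d).2

theorem IsSmoothC.memLp_div {f : E → C2} (h : IsSmoothC f) (U : Set E) (d : Fin 2 → E) :
    MemLp (smoothDiv d f) 2 (volume.restrict U) := memLp_two U (h.div d).1 (h.div d).2

/-- A smooth function with compact support, as an element of `gradSpace`. -/
def gradElem (U : Set E) (d : Fin 2 → E) {f : E → ℂ} (h : IsSmoothC f) : gradSpace U d :=
  ⟨WithLp.toLp 2 ((h.memLp U).toLp, (h.memLp_grad U d).toLp),
    (h.isWeakGrad U d).congr (h.memLp U).coeFn_toLp.symm (h.memLp_grad U d).coeFn_toLp.symm⟩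

/-- A smooth vector field with compact support, as an element of `divSpace`. -/
def divElem (U : Set E) (d : Fin 2 → E) {f : E → C2} (h : IsSmoothC f) : divSpace U d :=
  ⟨WithLp.toLp 2 ((h.memLp U).toLp, (h.memLp_div U d).toLp),
    (h.isWeakDiv U d).congr (h.memLp U).coeFn_toLp.symm (h.memLp_div U d).coeFn_toLp.symm⟩

theorem gradSpace_ext {U : Set E} (hU : volume.restrict (interior U) = volume.restrict U)
    {d : Fin 2 → E} {V V' : gradSpace U d} (h : V.1.fst = V'.1.fst) : V = V' := by
  have h2 := V.2
  have h2' := V'.2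
  change IsWeakGrad U d V.1.fst V.1.snd at h2
  change IsWeakGrad U d V'.1.fst V'.1.snd at h2'
  rw [h] at h2
  exact Subtype.ext (WithLp.ofLp_injective 2 (Prod.ext h (weakGrad_unique hU h2 h2')))

theorem divSpace_ext {U : Set E} (hU : volume.restrict (interior U) = volume.restrict U)
    {d : Fin 2 → E} {V V' : divSpace U d} (h : V.1.fst = V'.1.fst) : V = V' := by
  have h2 := V.2
  have h2' := V'.2
  change IsWeakDiv U d V.1.fst V.1.snd at h2
  change IsWeakDiv U d V'.1.fst V'.1.snd at h2'
  rw [h] at h2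
  exact Subtype.ext (WithLp.ofLp_injective 2 (Prod.ext h (weakDiv_unique hU h2 h2')))

/-- The sesquilinear form `∫ (D conj V + W · conj G)` of `(W, D)` and `(V, G)`. -/
def pairing {U : Set E} (W : WithLp 2 (L2 U C2 × L2 U ℂ)) (V : WithLp 2 (L2 U ℂ × L2 U C2)) : ℂ :=
  inner ℂ V.fst W.snd + inner ℂ V.snd W.fst

theorem pairing_eq_integral {U : Set E} (W : WithLp 2 (L2 U C2 × L2 U ℂ))
    (V : WithLp 2 (L2 U ℂ × L2 U C2)) :
    pairing W V = ∫ x in U, (W.snd x * conj (V.fst x) + ∑ j : Fin 2, W.fst x j * conj (V.snd x j))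
      := by
  rw [pairing, L2.inner_def, L2.inner_def, ← integral_add (L2.integrable_inner _ _)
    (L2.integrable_inner _ _)]
  simp [PiLp.inner_apply]

theorem continuous_pairing_left {U : Set E} (V : WithLp 2 (L2 U ℂ × L2 U C2)) :
    Continuous fun W => pairing W V :=
  ((innerSL ℂ V.fst).continuous.comp (WithLp.sndL 2 ℂ _ _).continuous).add
    ((innerSL ℂ V.snd).continuous.comp (WithLp.fstL 2 ℂ _ _).continuous)

theorem continuous_pairing_right {U : Set E} (W : WithLp 2 (L2 U C2 × L2 U ℂ)) :
    Continuous fun V => pairing W V :=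
  ((WithLp.fstL 2 ℂ (L2 U ℂ) (L2 U C2)).continuous.inner continuous_const).add
    ((WithLp.sndL 2 ℂ (L2 U ℂ) (L2 U C2)).continuous.inner continuous_const)

end WeakTheory

/-! ### Density of smooth functions: a symmetric regularisation argument -/

theorem integrable_affine {F : ℝ × ℝ → ℂ} {α : ℝ} (hα : α ≠ 0) (c : ℝ × ℝ) (h : Integrable F) :
    Integrable fun p => F (α • p + c) :=
  (integrable_comp_smul_iff volume (fun p => F (p + c)) hα).2 (h.comp_add_right c)

theorem IsSmoothC.affine {ρ : ℝ × ℝ → ℝ} (h : IsSmoothC ρ) {α : ℝ} (hα : α ≠ 0) (c : ℝ × ℝ) :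
    IsSmoothC fun p => ρ (α • p + c) := by
  refine ⟨h.1.comp (by fun_prop), ?_⟩
  exact h.2.comp_homeomorph ((Homeomorph.smulOfNeZero α hα).trans (Homeomorph.addRight c))

theorem fderiv_affine {ρ : ℝ × ℝ → ℝ} (h : IsSmoothC ρ) (α : ℝ) (c p v : ℝ × ℝ) :
    fderiv ℝ (fun p => ρ (α • p + c)) p v = α * fderiv ℝ ρ (α • p + c) v := by
  have h1 : HasFDerivAt (fun p : ℝ × ℝ => α • p + c) (α • ContinuousLinearMap.id ℝ (ℝ × ℝ)) p :=
    ((hasFDerivAt_id p).const_smul α).add_const c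
  have h2 := ((h.1.differentiable (by simp)) (α • p + c)).hasFDerivAt.comp p h1
  rw [show (fun p => ρ (α • p + c)) = ρ ∘ (fun p : ℝ × ℝ => α • p + c) from rfl, h2.fderiv]
  simp

/-- For fixed `p`, translation invariance absorbs `α p + b`, so the integral of the kernel in `q`
does not depend on `p`; Tonelli concludes. -/
theorem integrable_kernel_aux {ρ : ℝ × ℝ → ℝ} (h : Continuous ρ) (h' : HasCompactSupport ρ)
    {α β : ℝ} (hβ : β ≠ 0) (b : ℝ × ℝ) {G : ℝ × ℝ → ℂ} (hG : Integrable G) :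
    Integrable (fun z : (ℝ × ℝ) × (ℝ × ℝ) => (ρ (α • z.1 + β • z.2 + b) : ℂ) * G z.1)
      (volume.prod volume) := by
  have hρ : Integrable (fun y => (ρ y : ℂ)) :=
    (Complex.continuous_ofReal.comp h).integrable_of_hasCompactSupport
      (h'.comp_left (g := ((↑) : ℝ → ℂ)) (by simp))
  have e : ∀ p q : ℝ × ℝ, α • p + β • q + b = β • q + (α • p + b) := fun p q => by abel
  refine (integrable_prod_iff ?_).2 ⟨?_, ?_⟩
  · exact (Continuous.aestronglyMeasurable (by fun_prop)).mul hG.1.comp_fst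
  · refine Filter.Eventually.of_forall fun p => ?_
    simp only [e]
    exact (integrable_affine hβ _ hρ).mul_const _
  · have : ∀ p : ℝ × ℝ, ∫ q : ℝ × ℝ, ‖(ρ (α • p + β • q + b) : ℂ) * G p‖ =
        (∫ y : ℝ × ℝ, ‖(ρ (β • y) : ℂ)‖) * ‖G p‖ := by
      intro p
      simp only [norm_mul, integral_mul_const, e]
      congr 1
      have h1 := integral_add_right_eq_self (μ := (volume : Measure (ℝ × ℝ)))
        (fun q => ‖(ρ (β • q) : ℂ)‖) (β⁻¹ • (α • p + b))
      rw [← h1]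
      refine integral_congr_ae (Filter.Eventually.of_forall fun q => ?_)
      simp only [smul_add, smul_smul]
      simp [hβ]
    simp only [this]
    exact hG.norm.const_mul _

/-- The inequality `|f(p) g(q)| ≤ |f(p)|² + |g(q)|²` separates the variables, and each term is
covered by `integrable_kernel_aux`. -/
theorem integrable_kernel {ρ : ℝ × ℝ → ℝ} (h : Continuous ρ) (h' : HasCompactSupport ρ)
    {α β : ℝ} (hα : α ≠ 0) (hβ : β ≠ 0) (b : ℝ × ℝ) {f g : ℝ × ℝ → ℂ}
    (hf : MemLp f 2 volume) (hg : MemLp g 2 volume) :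
    Integrable (fun z : (ℝ × ℝ) × (ℝ × ℝ) =>
      (ρ (α • z.1 + β • z.2 + b) : ℂ) * (f z.1 * conj (g z.2))) (volume.prod volume) := by
  have hf2 : Integrable (fun x => ((‖f x‖ ^ 2 : ℝ) : ℂ)) := ((memLp_two_iff_integrable_sq_norm hf.1).1 hf).ofReal
  have hg2 : Integrable (fun x => ((‖g x‖ ^ 2 : ℝ) : ℂ)) := ((memLp_two_iff_integrable_sq_norm hg.1).1 hg).ofReal
  have h1 := integrable_kernel_aux h h' (α := α) hβ b hf2
  have h2 := (integrable_kernel_aux h h' (α := β) hα b hg2).swap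
  refine (h1.norm.add h2.norm).mono' ?_ (Filter.Eventually.of_forall fun z => ?_)
  · exact (Continuous.aestronglyMeasurable (by fun_prop)).mul
      (hf.1.comp_fst.mul (Complex.continuous_conj.comp_aestronglyMeasurable hg.1.comp_snd))
  · simp only [Function.comp, Prod.fst_swap, Prod.snd_swap, norm_mul, Pi.add_apply,
      RCLike.norm_conj, Complex.norm_real, add_comm (β • z.2)]
    rw [← mul_add]
    refine mul_le_mul_of_nonneg_left ?_ (norm_nonneg _)
    rw [Real.norm_of_nonneg (sq_nonneg _), Real.norm_of_nonneg (sq_nonneg _)]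
    nlinarith [sq_nonneg (‖f z.1‖ - ‖g z.2‖), sq_nonneg (‖f z.1‖), sq_nonneg ‖g z.2‖,
      norm_nonneg (f z.1), norm_nonneg (g z.2)]

/-- The quadratic form with kernel `ρ (α p + β q + b)`. -/
def kernelForm (ρ : ℝ × ℝ → ℝ) (α β : ℝ) (b : ℝ × ℝ) (f g : ℝ × ℝ → ℂ) : ℂ :=
  ∫ q, ∫ p, (ρ (α • p + β • q + b) : ℂ) * (f p * conj (g q))

theorem kernelForm_swap {ρ : ℝ × ℝ → ℝ} (h : Continuous ρ) (h' : HasCompactSupport ρ)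
    {α β : ℝ} (hα : α ≠ 0) (hβ : β ≠ 0) (b : ℝ × ℝ) {f g : ℝ × ℝ → ℂ}
    (hf : MemLp f 2 volume) (hg : MemLp g 2 volume) :
    kernelForm ρ α β b f g =
      ∫ p, ∫ q, (ρ (α • p + β • q + b) : ℂ) * (f p * conj (g q)) :=
  (integral_integral_swap (f := fun p q => (ρ (α • p + β • q + b) : ℂ) * (f p * conj (g q)))
    (integrable_kernel h h' hα hβ b hf hg)).symm

/-- Conjugation exchanges the roles of `p` and `q`, so only kernels with `α = 1` have to be studied
in the limit. -/
theorem conj_kernelForm {ρ : ℝ × ℝ → ℝ} (h : Continuous ρ) (h' : HasCompactSupport ρ)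
    {α β : ℝ} (hα : α ≠ 0) (hβ : β ≠ 0) (b : ℝ × ℝ) {f : ℝ × ℝ → ℂ}
    (hf : MemLp f 2 volume) :
    conj (kernelForm ρ α β b f f) = kernelForm ρ β α b f f := by
  rw [kernelForm_swap h h' hβ hα b hf hf, kernelForm, ← integral_conj]
  refine integral_congr_ae (Filter.Eventually.of_forall fun q => ?_)
  simp only
  rw [← integral_conj]
  refine integral_congr_ae (Filter.Eventually.of_forall fun p => ?_)
  simp only [map_mul, Complex.conj_ofReal, Complex.conj_conj, add_comm (α • p)]
  ring

/-- `-u` is the weak divergence of `w` on the plane, for test functions supported in `S`. -/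
def DivRel (S : Set (ℝ × ℝ)) (u : ℝ × ℝ → ℂ) (w : Fin 2 → ℝ × ℝ → ℂ) : Prop :=
  ∀ φ, IsTest S φ → ∫ x, ∑ j, (fderiv ℝ φ x (planeFrame j)) • w j x = - ∫ x, φ x • u x

/-- `w` is the weak gradient of `u` on the plane, for test functions supported in `S`. -/
def GradRel (S : Set (ℝ × ℝ)) (u : ℝ × ℝ → ℂ) (w : Fin 2 → ℝ × ℝ → ℂ) : Prop :=
  ∀ φ, IsTest S φ → ∀ j, ∫ x, (fderiv ℝ φ x (planeFrame j)) • u x = - ∫ x, φ x • w j x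

/-- The mixed form `∑ⱼ ∬ ∂ⱼρ wⱼ(p) conj u(q)` is evaluated in two ways. For fixed `q` the kernel is
a test function of `p`, and the divergence relation replaces `∑ⱼ ∂ⱼρ wⱼ` by `ρ u`; for fixed `p` the
gradient relation replaces `∂ⱼρ conj u` by `ρ conj wⱼ`. The derivatives in `p` and `q` differ only
by the factors `α` and `β`. Since `u` and `w` vanish off `U`, the frozen variable may be taken in
`U`, and that is where the support conditions are imposed. -/
theorem kernel_identity {U S T : Set (ℝ × ℝ)} {u : ℝ × ℝ → ℂ} {w : Fin 2 → ℝ × ℝ → ℂ}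
    (hu : MemLp u 2 volume) (hw : ∀ j, MemLp (w j) 2 volume) (hu0 : ∀ x ∉ U, u x = 0)
    (hw0 : ∀ j, ∀ x ∉ U, w j x = 0) (h1 : DivRel S u w) (h2 : GradRel T u w)
    {ρ : ℝ × ℝ → ℝ} (hρ : IsSmoothC ρ) {α β : ℝ} (hα : α ≠ 0) (hβ : β ≠ 0) (b : ℝ × ℝ)
    (hS : ∀ q ∈ U, IsTest S fun p => ρ (α • p + β • q + b))
    (hT : ∀ p ∈ U, IsTest T fun q => ρ (α • p + β • q + b)) :
    (β : ℂ) * kernelForm ρ α β b u u = α * ∑ j, kernelForm ρ α β b (w j) (w j) := by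
  have hρc := hρ.continuous
  have hd : ∀ j, IsSmoothC fun x => fderiv ℝ ρ x (planeFrame j) := fun j => hρ.fderiv_apply _
  have e : ∀ p q : ℝ × ℝ, α • p + β • q + b = β • q + (α • p + b) := fun p q => by abel
  have A : (α : ℂ) * ∑ j, kernelForm (fun x => fderiv ℝ ρ x (planeFrame j)) α β b (w j) u =
      - kernelForm ρ α β b u u := by
    simp only [kernelForm]
    rw [← integral_finsetSum _ fun j _ => (integrable_kernel (hd j).continuous (hd j).2 hα hβ b
      (hw j) hu).integral_prod_right, ← integral_const_mul, ← integral_neg]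
    refine integral_congr_ae ?_
    have I1 : ∀ᵐ q : ℝ × ℝ, ∀ j, Integrable (fun p : ℝ × ℝ =>
        ((fderiv ℝ ρ (α • p + β • q + b) (planeFrame j) : ℝ) : ℂ) * (w j p * conj (u q))) :=
      ae_all_iff.2 fun j => (integrable_kernel (hd j).continuous (hd j).2 hα hβ b
        (hw j) hu).prod_left_ae
    filter_upwards [I1] with q I1
    rw [← integral_finsetSum _ fun j _ => I1 j, ← integral_const_mul]
    by_cases hq : q ∈ U
    · have := h1 _ (hS q hq)
      simp only [add_assoc, fderiv_affine hρ] at this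
      simp only [← mul_assoc, integral_mul_const]
      rw [← neg_mul]
      simp only [add_assoc]
      have h3 : ∫ p, (ρ (α • p + (β • q + b)) : ℂ) * u p = ∫ p, ρ (α • p + (β • q + b)) • u p := by
        simp
      rw [h3, ← this, ← integral_mul_const]
      refine integral_congr_ae (Filter.Eventually.of_forall fun p => ?_)
      simp [mul_assoc, add_mul]
      ring
    · simp [hu0 q hq]
  have B : ∀ j, (β : ℂ) * kernelForm (fun x => fderiv ℝ ρ x (planeFrame j)) α β b (w j) u =
      - kernelForm ρ α β b (w j) (w j) := by
    intro j
    rw [kernelForm_swap (hd j).continuous (hd j).2 hα hβ b (hw j) hu,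
      kernelForm_swap hρ.continuous hρ.2 hα hβ b (hw j) (hw j), ← integral_const_mul,
      ← integral_neg]
    refine integral_congr_ae (Filter.Eventually.of_forall fun p => ?_)
    simp only
    by_cases hp : p ∈ U
    · have := congrArg conj (h2 _ (hT p hp) j)
      simp only [e, fderiv_affine hρ, map_neg, ← integral_conj] at this
      rw [← integral_const_mul]
      calc _ = w j p * ∫ q, conj ((β * fderiv ℝ ρ (β • q + (α • p + b)) (planeFrame j)) • u q) := by
            rw [← integral_const_mul]
            refine integral_congr_ae (Filter.Eventually.of_forall fun q => ?_)
            simp [e]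
            ring
        _ = - ∫ q, w j p * conj (ρ (β • q + (α • p + b)) • w j q) := by
            rw [this, integral_const_mul, mul_neg]
        _ = _ := by
            congr 1
            refine integral_congr_ae (Filter.Eventually.of_forall fun q => ?_)
            simp [e]
            ring
    · simp [hw0 j p hp]
  have B' := Finset.sum_congr (s₁ := Finset.univ) rfl fun j _ => B j
  rw [← Finset.mul_sum, Finset.sum_neg_distrib] at B'
  linear_combination (β : ℂ) * A - (α : ℂ) * B'

/-! ### Dilations and translations in `L²` of the plane, and the limit of the kernel forms. -/

theorem norm_integral_mul_conj_le {X : Type*} [MeasurableSpace X] {μ : Measure X} {f g : X → ℂ}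
    (hf : MemLp f 2 μ) (hg : MemLp g 2 μ) :
    ‖∫ x, f x * conj (g x) ∂μ‖ ≤ (eLpNorm f 2 μ).toReal * (eLpNorm g 2 μ).toReal := by
  have h1 := norm_inner_le_norm (𝕜 := ℂ) hg.toLp hf.toLp
  rw [Lp.norm_toLp, Lp.norm_toLp, inner_toLp_left] at h1
  rw [mul_comm]
  refine (le_of_eq ?_).trans h1
  congr 1
  refine integral_congr_ae ?_
  filter_upwards [hf.coeFn_toLp] with x hx
  simp [hx]

theorem map_affine {α : ℝ} (hα : α ≠ 0) (c : ℝ × ℝ) :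
    (volume : Measure (ℝ × ℝ)).map (fun p => α • p + c) =
      ENNReal.ofReal ((α ^ 2)⁻¹) • volume := by
  have h1 : (fun p : ℝ × ℝ => α • p + c) = (fun p => p + c) ∘ fun p => α • p := rfl
  rw [h1, ← Measure.map_map (by fun_prop) (by fun_prop), Measure.map_addHaar_smul _ hα,
    Measure.map_smul, map_add_right_eq_self]
  simp

/-- In dimension two a dilation by `α` multiplies the `L²` norm by `|α|⁻¹`, which is at most `2` for
`α ≥ 1/2`. A bound uniform near `α = 1` is all that the limit argument uses. -/
theorem memLp_affine {f : ℝ × ℝ → ℂ} (hf : MemLp f 2 volume) {α : ℝ} (hα : 1 / 2 ≤ α)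
    (c : ℝ × ℝ) : MemLp (fun p => f (α • p + c)) 2 volume ∧
      (eLpNorm (fun p => f (α • p + c)) 2 volume).toReal ≤ 2 * (eLpNorm f 2 volume).toReal := by
  have h0 : α ≠ 0 := by linarith
  have hm : Measurable fun p : ℝ × ℝ => α • p + c := by fun_prop
  have hfm : AEStronglyMeasurable f ((volume : Measure (ℝ × ℝ)).map fun p => α • p + c) := by
    rw [map_affine h0]
    exact hf.1.smul_measure _
  have h1 : eLpNorm (fun p => f (α • p + c)) 2 volume =
      ENNReal.ofReal ((α ^ 2)⁻¹) ^ (1 / 2 : ℝ) * eLpNorm f 2 volume := by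
    have := eLpNorm_map_measure (p := 2) hfm hm.aemeasurable
    rw [show (fun p => f (α • p + c)) = f ∘ fun p => α • p + c from rfl, ← this, map_affine h0,
      eLpNorm_smul_measure_of_ne_top (by simp)]
    simp
  have h2 : ENNReal.ofReal ((α ^ 2)⁻¹) ^ (1 / 2 : ℝ) ≤ 2 := by
    have : (2 : ℝ≥0∞) = (4 : ℝ≥0∞) ^ (1 / 2 : ℝ) := by
      rw [show (4 : ℝ≥0∞) = 2 ^ (2 : ℝ) by norm_num, ← ENNReal.rpow_mul]
      norm_num
    rw [this]
    refine ENNReal.rpow_le_rpow ?_ (by norm_num)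
    rw [show (4 : ℝ≥0∞) = ENNReal.ofReal 4 by norm_num]
    refine ENNReal.ofReal_le_ofReal ?_
    rw [inv_le_comm₀ (by positivity) (by norm_num)]
    nlinarith
  have h3 : eLpNorm (fun p => f (α • p + c)) 2 volume ≤ 2 * eLpNorm f 2 volume := by
    rw [h1]; gcongr
  refine ⟨⟨hfm.comp_measurable hm, h3.trans_lt (ENNReal.mul_lt_top (by simp) hf.2)⟩, ?_⟩
  have := ENNReal.toReal_mono (ENNReal.mul_lt_top (by simp) hf.2).ne h3
  simpa using this

/-- Dilations and translations act continuously on `L²` of the plane, in the weak sense. -/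
theorem tendsto_integral_dilate {f : ℝ × ℝ → ℂ} (hf : MemLp f 2 volume) (c : ℝ × ℝ) :
    Filter.Tendsto (fun t : ℝ × (ℝ × ℝ) =>
      ∫ q, f (t.1 • q + (t.2 + (1 - t.1) • c)) * conj (f q)) (nhds (1, 0))
      (nhds (∫ q, f q * conj (f q))) := by
  rw [Metric.tendsto_nhds]
  intro δ hδ
  set N := (eLpNorm f 2 volume).toReal with hN
  have hN0 : 0 ≤ N := ENNReal.toReal_nonneg
  -- Replacing `f` by `g` costs `2ηN` in the dilated integral and `ηN` in the other one, together
  -- less than `3δ/4`; the remaining `δ/4` goes to the convergence for `g`.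
  set η : ℝ := δ / (4 * (N + 1)) with hη
  have hη0 : 0 < η := by positivity
  obtain ⟨g, hgc, hgs, hfg⟩ := MemLp.exist_eLpNorm_sub_le (p := 2) (by simp) (by simp) hf hη0
  have hgm : MemLp g 2 volume := hgs.continuous.memLp_of_hasCompactSupport hgc
  have hh : MemLp (f - g) 2 volume := hf.sub hgm
  have hhη : (eLpNorm (f - g) 2 volume).toReal ≤ η :=
    ENNReal.toReal_le_of_le_ofReal hη0.le hfg
  obtain ⟨C, hC⟩ := hgs.continuous.bounded_above_of_compact_support hgc
  obtain ⟨R, hR⟩ := hgc.isCompact.isBounded.exists_norm_le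
  have hball : ∀ᶠ t in nhds ((1 : ℝ), (0 : ℝ × ℝ)), 1 / 2 < t.1 ∧
      ‖t.2 + (1 - t.1) • c‖ < 1 := by
    refine (continuous_fst.tendsto _).eventually (lt_mem_nhds (by norm_num)) |>.and ?_
    have hcont : Continuous fun t : ℝ × (ℝ × ℝ) => ‖t.2 + (1 - t.1) • c‖ := by fun_prop
    exact (hcont.tendsto _).eventually (gt_mem_nhds (by simp))
  have lim : Filter.Tendsto (fun t : ℝ × (ℝ × ℝ) =>
      ∫ q, g (t.1 • q + (t.2 + (1 - t.1) • c)) * conj (f q)) (nhds (1, 0))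
      (nhds (∫ q, g q * conj (f q))) := by
    -- For `t` near `(1, 0)` the shift has norm less than `1` and the dilation exceeds `1/2`, so
    -- every dilated copy of `g` is supported in this fixed ball.
    set B := Metric.closedBall (0 : ℝ × ℝ) (2 * (R + 1))
    refine tendsto_integral_filter_of_dominated_convergence
      (B.indicator fun q => C * ‖f q‖) ?_ ?_ ?_ ?_
    · refine Filter.Eventually.of_forall fun t => ?_
      exact ((hgs.continuous.comp (by fun_prop)).aestronglyMeasurable).mul
        (Complex.continuous_conj.comp_aestronglyMeasurable hf.1)
    · filter_upwards [hball] with t ht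
      refine Filter.Eventually.of_forall fun q => ?_
      rw [norm_mul, RCLike.norm_conj]
      by_cases hq : q ∈ B
      · rw [indicator_of_mem hq]
        exact mul_le_mul_of_nonneg_right (hC _) (norm_nonneg _)
      · rw [indicator_of_notMem hq, image_eq_zero_of_notMem_tsupport (f := g), norm_zero, zero_mul]
        intro hmem
        refine hq (mem_closedBall_zero_iff.2 ?_)
        have h1 := hR _ hmem
        have h2 : ‖t.1 • q‖ ≤ R + 1 := by
          have := norm_sub_le (t.1 • q + (t.2 + (1 - t.1) • c)) (t.2 + (1 - t.1) • c)
          rw [add_sub_cancel_right] at this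
          linarith [ht.2]
        rw [norm_smul, Real.norm_of_nonneg (by linarith [ht.1])] at h2
        nlinarith [ht.1, norm_nonneg q]
    · rw [integrable_indicator_iff measurableSet_closedBall]
      refine Integrable.const_mul ?_ C
      have : IsFiniteMeasure ((volume : Measure (ℝ × ℝ)).restrict B) :=
        ⟨by rw [Measure.restrict_apply_univ]; exact measure_closedBall_lt_top⟩
      exact ((hf.restrict B).integrable (by norm_num)).norm
    · refine Filter.Eventually.of_forall fun q => ?_
      have hcont : Continuous fun t : ℝ × (ℝ × ℝ) =>
          g (t.1 • q + (t.2 + (1 - t.1) • c)) * conj (f q) :=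
        (hgs.continuous.comp (by fun_prop)).mul continuous_const
      simpa using hcont.tendsto ((1 : ℝ), (0 : ℝ × ℝ))
  filter_upwards [hball, (Metric.tendsto_nhds.1 lim) (δ / 4) (by positivity)] with t ht1 ht2
  set c' := t.2 + (1 - t.1) • c
  have hT := fun {k : ℝ × ℝ → ℂ} (hk : MemLp k 2 volume) => memLp_affine hk ht1.1.le c'
  have hfc : MemLp (fun x => conj (f x)) 2 volume := hf.star
  have e1 : ∫ q, f (t.1 • q + c') * conj (f q) = (∫ q, g (t.1 • q + c') * conj (f q)) +
      ∫ q, (f - g) (t.1 • q + c') * conj (f q) := by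
    rw [← integral_add]
    · simp only [Pi.sub_apply, ← add_mul, add_sub_cancel]
    · exact (hT hgm).1.integrable_mul hfc
    · exact (hT hh).1.integrable_mul hfc
  have e2 : ∫ q, f q * conj (f q) = (∫ q, g q * conj (f q)) + ∫ q, (f - g) q * conj (f q) := by
    rw [← integral_add]
    · simp only [Pi.sub_apply, ← add_mul, add_sub_cancel]
    · exact hgm.integrable_mul hfc
    · exact hh.integrable_mul hfc
  have b1 := norm_integral_mul_conj_le (hT hh).1 hf
  have b2 := norm_integral_mul_conj_le hh hf
  have b3 := (hT hh).2
  rw [dist_eq_norm] at ht2 ⊢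
  rw [e1, e2]
  set X := ∫ q, g (t.1 • q + c') * conj (f q)
  set Y := ∫ q, g q * conj (f q)
  set X' := ∫ q, (f - g) (t.1 • q + c') * conj (f q)
  set Y' := ∫ q, (f - g) q * conj (f q)
  have b4 : ‖X' - Y'‖ ≤ 3 * η * N := by
    refine (norm_sub_le _ _).trans ?_
    have := mul_le_mul_of_nonneg_right (b3.trans (mul_le_mul_of_nonneg_left hhη two_pos.le)) hN0
    have := mul_le_mul_of_nonneg_right hhη hN0
    linarith
  have b5 : η * (4 * (N + 1)) = δ := by rw [hη]; field_simp
  calc ‖X + X' - (Y + Y')‖ = ‖(X - Y) + (X' - Y')‖ := by congr 1; ring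
    _ ≤ ‖X - Y‖ + ‖X' - Y'‖ := norm_add_le _ _
    _ < δ := by nlinarith

/-- The substitution `y = p + β q + b`, for fixed `q`, writes the form as the `ρ`-weighted integral
of the correlations of `f` with its dilated translates. -/
theorem kernelForm_eq {ρ : ℝ × ℝ → ℝ} (h : Continuous ρ) (h' : HasCompactSupport ρ)
    {β : ℝ} (hβ : β ≠ 0) (b : ℝ × ℝ) {f : ℝ × ℝ → ℂ} (hf : MemLp f 2 volume) :
    Integrable (fun y => (ρ y : ℂ) * ∫ q, f ((-β) • q + (y - b)) * conj (f q)) ∧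
    kernelForm ρ 1 β b f f = ∫ y, (ρ y : ℂ) * ∫ q, f ((-β) • q + (y - b)) * conj (f q) := by
  have hint := integrable_kernel h h' one_ne_zero hβ b hf hf
  have hmp : MeasurePreserving (fun z : (ℝ × ℝ) × (ℝ × ℝ) => (z.1 - (β • z.2 + b), z.2))
      (volume.prod volume) (volume.prod volume) := by
    have := (MeasurePreserving.id (volume : Measure (ℝ × ℝ))).skew_product
      (g := fun q p => p - (β • q + b)) (μc := (volume : Measure (ℝ × ℝ))) (by fun_prop)
      (Filter.Eventually.of_forall fun q => map_sub_right_eq_self _ _)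
    exact (Measure.measurePreserving_swap.comp this).comp Measure.measurePreserving_swap
  have hint' : Integrable (fun z : (ℝ × ℝ) × (ℝ × ℝ) =>
      (ρ z.1 : ℂ) * (f ((-β) • z.2 + (z.1 - b)) * conj (f z.2))) (volume.prod volume) := by
    convert! hmp.integrable_comp_of_integrable hint using 2 with z
    have e1 : (1 : ℝ) • (z.1 - (β • z.2 + b)) + β • z.2 + b = z.1 := by rw [one_smul]; abel
    have e2 : (-β) • z.2 + (z.1 - b) = z.1 - (β • z.2 + b) := by rw [neg_smul]; abel
    simp only [Function.comp, e1, e2]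
  simp only [← integral_const_mul]
  refine ⟨hint'.integral_prod_left, ?_⟩
  rw [integral_integral_swap hint', kernelForm]
  refine integral_congr_ae (Filter.Eventually.of_forall fun q => ?_)
  simp only
  rw [← integral_sub_right_eq_self _ (β • q + b)]
  refine integral_congr_ae (Filter.Eventually.of_forall fun y => ?_)
  have e1 : (1 : ℝ) • (y - (β • q + b)) + β • q + b = y := by rw [one_smul]; abel
  have e2 : (-β) • q + (y - b) = y - (β • q + b) := by rw [neg_smul]; abel
  simp only [e1, e2]

/-- With `β = -μ`, `kernelForm_eq` makes the form a `ρ`-average of `∫ f(μq + y + (1 - μ)c) conj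
f(q)`. By `tendsto_integral_dilate` each of these is close to `‖f‖²` once `μ` is near `1` and `y`
near `0`. The radius `r` does not depend on the mollifier. -/
theorem kernelForm_close {f : ℝ × ℝ → ℂ} (hf : MemLp f 2 volume) (c : ℝ × ℝ) {δ : ℝ}
    (hδ : 0 < δ) : ∃ r > 0, ∀ μ : ℝ, 0 < μ → |μ - 1| < r → ∀ ρ : ℝ × ℝ → ℝ, IsSmoothC ρ →
      (∀ y, 0 ≤ ρ y) → ∫ y, ρ y = 1 → (∀ y, r ≤ ‖y‖ → ρ y = 0) →
      ‖kernelForm ρ 1 (-μ) (-((1 - μ) • c)) f f - ∫ q, f q * conj (f q)‖ ≤ δ := by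
  obtain ⟨r, hr, h⟩ := Metric.eventually_nhds_iff.1
    ((Metric.tendsto_nhds.1 (tendsto_integral_dilate hf c)) δ hδ)
  refine ⟨r, hr, fun μ hμ hμr ρ hρ h0 h1 hsupp => ?_⟩
  obtain ⟨hi, heq⟩ := kernelForm_eq hρ.continuous hρ.2 (neg_ne_zero.2 hμ.ne') (-((1 - μ) • c)) hf
  rw [heq]
  simp only [neg_neg, sub_neg_eq_add] at hi ⊢
  set L := ∫ q, f q * conj (f q)
  have hρi : Integrable ρ := hρ.continuous.integrable_of_hasCompactSupport hρ.2
  have e : L = ∫ y, (ρ y : ℂ) * L := by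
    rw [integral_mul_const, integral_complex_ofReal, h1]; simp
  have hρL : Integrable fun y => (ρ y : ℂ) * L := Integrable.mul_const hρi.ofReal L
  rw [e, ← integral_sub hi hρL]
  have hb : ∫ y, ρ y * δ = δ := by rw [integral_mul_const, h1, one_mul]
  rw [← hb]
  refine norm_integral_le_of_norm_le (hρi.mul_const δ) (Filter.Eventually.of_forall fun y => ?_)
  rw [← mul_sub, norm_mul, Complex.norm_real, Real.norm_of_nonneg (h0 y)]
  by_cases hy : r ≤ ‖y‖
  · simp [hsupp y hy]
  · refine mul_le_mul_of_nonneg_left ?_ (h0 y)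
    have := @h (μ, y) (by
      rw [Prod.dist_eq, max_lt_iff]
      exact ⟨hμr, by simpa using not_le.1 hy⟩)
    rw [dist_eq_norm] at this
    exact this.le

theorem interior_Q (I : Set ℝ) : interior (Q I) = interior I ×ˢ univ := by
  rw [Q, interior_prod_eq, interior_univ]

theorem measurableSet_Q {I : Set ℝ} (hI : I.OrdConnected) : MeasurableSet (Q I) :=
  hI.measurableSet.prod MeasurableSet.univ

theorem restrict_Q {I : Set ℝ} (h : (frontier I).Finite) :
    (volume : Measure (ℝ × ℝ)).restrict (interior (Q I)) = volume.restrict (Q I) := by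
  rw [interior_Q, volume_Q, Measure.volume_eq_prod, ← Measure.prod_restrict, restrict_interval h,
    Measure.restrict_univ]

/-- Contraction towards `c` leaves room around the image of `Q`: a displacement `y` is absorbed by
moving `c` to `c + y/(1 - μ)`, which stays in `I` for small `y`, and convexity of `I` concludes. -/
theorem exists_ball_dilate {I : Set ℝ} (hI : I.OrdConnected) {c : ℝ} (hc : c ∈ interior I)
    {μ : ℝ} (h0 : 0 < μ) (h1 : μ < 1) :
    ∃ r > 0, ∀ q ∈ Q I, ∀ y : ℝ × ℝ, ‖y‖ < r → y + (μ • q + (1 - μ) • (c, (0 : ℝ))) ∈ Q I := by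
  obtain ⟨s, hs, hb⟩ := Metric.mem_nhds_iff.1 (mem_interior_iff_mem_nhds.1 hc)
  refine ⟨(1 - μ) * s, mul_pos (by linarith) hs, fun q hq y hy => ⟨?_, mem_univ _⟩⟩
  have h2 : c + y.1 / (1 - μ) ∈ I := by
    refine hb ?_
    rw [Metric.mem_ball, dist_self_add_left, norm_div, Real.norm_of_nonneg (by linarith : 0 ≤ 1 - μ),
      div_lt_iff₀ (by linarith), mul_comm]
    exact (norm_fst_le y).trans_lt hy
  have h3 := hI.convex hq.1 h2 h0.le (by linarith : 0 ≤ 1 - μ) (by ring)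
  have e : (y + (μ • q + (1 - μ) • (c, (0 : ℝ)))).1 = μ • q.1 + (1 - μ) • (c + y.1 / (1 - μ)) := by
    have : 1 - μ ≠ 0 := by linarith
    simp only [Prod.fst_add, Prod.smul_fst, smul_eq_mul]
    field_simp
    ring
  rw [e]
  exact h3

theorem isTest_of_dilate {U : Set (ℝ × ℝ)} {ρ : ℝ × ℝ → ℝ} (hρ : IsSmoothC ρ) {r r' : ℝ}
    (hr : r' < r) (hs : ∀ y, r' ≤ ‖y‖ → ρ y = 0) {a : ℝ × ℝ}
    (h : ∀ y : ℝ × ℝ, ‖y‖ < r → y + a ∈ U) : IsTest U fun p => ρ ((1 : ℝ) • p + -a) := by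
  have h1 := hρ.affine one_ne_zero (-a)
  refine ⟨h1.1, h1.2, ?_⟩
  have hball : Metric.ball a r ⊆ U := fun p hp => by
    have := h (p - a) (by rwa [← dist_eq_norm])
    rwa [sub_add_cancel] at this
  refine Subset.trans (closure_minimal ?_ Metric.isClosed_closedBall :
    _ ⊆ Metric.closedBall a r') ((Metric.closedBall_subset_ball hr).trans
      (interior_maximal hball Metric.isOpen_ball))
  intro p hp
  rw [Metric.mem_closedBall, dist_eq_norm]
  by_contra hlt
  refine hp (hs _ ?_)
  rw [one_smul, ← sub_eq_add_neg]
  exact (not_le.1 hlt).le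

theorem isTest_univ {E : Type*} [NormedAddCommGroup E] [NormedSpace ℝ E] {φ : E → ℝ} :
    IsTest univ φ ↔ IsSmoothC φ := by
  simp [IsTest, IsSmoothC]

/-- Formally, `div w = u` is multiplied by `conj u` and integrated by parts, with no boundary term
because one of the two relations holds across the boundary. To justify this, the kernel `ρ(p - μq -
(1 - μ)c)` is used. In the variable `p` it is supported near the contracted point `μq + (1 - μ)c`,
hence inside `Q` when `q ∈ Q`, so `p` serves the relation valid only in `Q`; in `q` it is merely a
compactly supported function on the plane, which suits the other one. `kernel_identity` followed by
`μ → 1` gives the claim. Both terms of the sum are non-negative, so callers obtain that they vanish.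
-/
theorem eq_zero_of_dual {I : Set ℝ} (hI : I.OrdConnected) (hI_int : (interior I).Nonempty)
    {u : ℝ × ℝ → ℂ} {w : Fin 2 → ℝ × ℝ → ℂ}
    (hu : MemLp u 2 volume) (hw : ∀ j, MemLp (w j) 2 volume) (hu0 : ∀ x ∉ Q I, u x = 0)
    (hw0 : ∀ j, ∀ x ∉ Q I, w j x = 0)
    (h : (DivRel (Q I) u w ∧ GradRel univ u w) ∨ (DivRel univ u w ∧ GradRel (Q I) u w)) :
    (∫ q, u q * conj (u q)) + ∑ j, ∫ q, w j q * conj (w j q) = 0 := by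
  obtain ⟨c, hc⟩ := hI_int
  set Lu := ∫ q, u q * conj (u q)
  set Lw := fun j => ∫ q, w j q * conj (w j q)
  -- The mollified forms of `u` and `w` contribute `δ` and `2δ`; the factor `1 - μ = s < min 1 δ`
  -- multiplies one of them and accounts for the rest. The constant `5` is reached in the second
  -- case.
  have key : ∀ δ : ℝ, 0 < δ → ‖Lu + ∑ j, Lw j‖ ≤ δ * (5 + ‖Lu‖ + ‖∑ j, Lw j‖) := by
    intro δ hδ
    obtain ⟨r, hr, H⟩ := kernelForm_close hu (c, 0) hδ
    choose r' hr' H' using fun j => kernelForm_close (hw j) (c, 0) hδ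
    obtain ⟨s, hs, hsr⟩ : ∃ s > 0, s < r ∧ s < r' 0 ∧ s < r' 1 ∧ s < 1 ∧ s < δ := by
      refine ⟨min r (min (r' 0) (min (r' 1) (min 1 δ))) / 2, ?_, ?_⟩
      · have := hr' 0; have := hr' 1
        positivity
      · have h0 : 0 < min r (min (r' 0) (min (r' 1) (min 1 δ))) := by
          have := hr' 0; have := hr' 1
          positivity
        have h1 := half_lt_self h0
        simp only [lt_min_iff] at h1
        tauto
    set μ : ℝ := 1 - s
    have hμ0 : 0 < μ := by simp only [μ]; linarith
    have hμ1 : μ < 1 := by simp only [μ]; linarith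
    have hμs : |μ - 1| = s := by
      simp only [μ]; rw [abs_of_nonpos (by linarith)]; ring
    obtain ⟨t, ht, hb⟩ := exists_ball_dilate hI hc hμ0 hμ1
    have hm : 0 < min s t := by positivity
    -- The outer radius lies below `t`, so that the kernel stays inside `Q`, and below `s`, so that
    -- the mollifier is concentrated enough for `kernelForm_close`.
    let f : ContDiffBump (0 : ℝ × ℝ) := ⟨min s t / 4, min s t / 2, by positivity, by linarith⟩
    have hρ : IsSmoothC (f.normed volume) := ⟨f.contDiff_normed, f.hasCompactSupport_normed⟩
    have hsupp : ∀ y, min s t / 2 ≤ ‖y‖ → f.normed volume y = 0 := by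
      intro y hy
      have := f.support_normed_eq (μ := (volume : Measure (ℝ × ℝ)))
      by_contra h0
      have h1 : y ∈ Function.support (f.normed volume) := h0
      rw [this, mem_ball_zero_iff] at h1
      exact absurd h1 (not_lt.2 hy)
    have h1 := H μ hμ0 (by rw [hμs]; exact hsr.1) _ hρ f.nonneg_normed f.integral_normed
      (fun y hy => hsupp y (by linarith [min_le_left s t]))
    have h2 : ∀ j, ‖kernelForm (f.normed volume) 1 (-μ) (-((1 - μ) • (c, 0))) (w j) (w j) - Lw j‖
        ≤ δ := fun j => H' j μ hμ0 (by rw [hμs]; fin_cases j; exacts [hsr.2.1, hsr.2.2.1]) _ hρ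
      f.nonneg_normed f.integral_normed (fun y hy => hsupp y (by
        have : s < r' j := by fin_cases j; exacts [hsr.2.1, hsr.2.2.1]
        linarith [min_le_left s t]))
    set K := fun g => kernelForm (f.normed volume) 1 (-μ) (-((1 - μ) • (c, (0 : ℝ)))) g g
    have hne : -μ ≠ 0 := by linarith
    have test1 : ∀ q ∈ Q I, IsTest (Q I) fun p =>
        f.normed volume ((1 : ℝ) • p + (-μ) • q + -((1 - μ) • (c, (0 : ℝ)))) := by
      intro q hq
      have := isTest_of_dilate hρ (r := t) (r' := min s t / 2) (by linarith [min_le_right s t])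
        hsupp (hb q hq)
      convert! this using 3 with p
      rw [neg_add, add_assoc, neg_smul]
    have test2 : ∀ q : ℝ × ℝ, IsTest univ fun p =>
        f.normed volume ((-μ) • p + (1 : ℝ) • q + -((1 - μ) • (c, (0 : ℝ)))) := by
      intro q
      have := hρ.affine hne ((1 : ℝ) • q + -((1 - μ) • (c, (0 : ℝ))))
      rw [isTest_univ]
      convert! this using 3 with p
      rw [add_assoc]
    have id1 : (μ : ℂ) * K u + ∑ j, K (w j) = 0 ∨ K u + (μ : ℂ) * ∑ j, K (w j) = 0 := by
      rcases h with ⟨ha, hb⟩ | ⟨ha, hb⟩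
      · left
        have := kernel_identity hu hw hu0 hw0 ha hb hρ one_ne_zero hne
          (-((1 - μ) • (c, (0 : ℝ)))) test1 (fun p _ => by
            convert! test2 p using 4 with q
            abel)
        push_cast at this
        linear_combination -this
      · right
        have := kernel_identity hu hw hu0 hw0 ha hb hρ hne one_ne_zero
          (-((1 - μ) • (c, (0 : ℝ)))) (fun q _ => test2 q) (fun p hp => by
            convert! test1 p hp using 4 with q
            abel)
        -- In this case the factor `-μ` sits on the other variable; conjugation restores the kernel
        -- with `α = 1`.
        have := congrArg conj this
        simp only [map_mul, map_sum, Complex.conj_ofReal] at this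
        rw [conj_kernelForm hρ.continuous hρ.2 hne one_ne_zero _ hu] at this
        simp only [conj_kernelForm hρ.continuous hρ.2 hne one_ne_zero _ (hw _)] at this
        push_cast at this
        linear_combination this
    have hKw : ‖∑ j, K (w j) - ∑ j, Lw j‖ ≤ 2 * δ := by
      rw [← Finset.sum_sub_distrib]
      refine (norm_sum_le _ _).trans ((Finset.sum_le_sum fun j _ => h2 j).trans ?_)
      simp
    have hs1 : ‖(1 - μ : ℂ)‖ = s := by
      have : (1 - μ : ℂ) = (s : ℂ) := by simp [μ]
      rw [this, Complex.norm_real, Real.norm_of_nonneg hs.le]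
    have hns : ∀ {a b : ℂ} {C : ℝ}, ‖a - b‖ ≤ C → ‖a‖ ≤ ‖b‖ + C := fun {a b C} hab => by
      have := norm_add_le b (a - b)
      rw [add_sub_cancel] at this
      linarith
    have h1' : ‖K u - Lu‖ ≤ δ := h1
    obtain ⟨-, -, -, hs1', hsδ⟩ := hsr
    rcases id1 with h0 | h0
    · have e : Lu + ∑ j, Lw j = -(K u - Lu) + ((1 - μ) * K u + -(∑ j, K (w j) - ∑ j, Lw j)) := by
        linear_combination h0
      rw [e]
      refine (norm_add_le _ _).trans ?_
      refine (add_le_add_right (norm_add_le _ _) _).trans ?_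
      rw [norm_neg, norm_neg, norm_mul, hs1]
      have := hns h1'
      have h6 : s * ‖K u‖ ≤ s * (‖Lu‖ + δ) := mul_le_mul_of_nonneg_left this hs.le
      have h7 := mul_le_mul_of_nonneg_right hsδ.le (norm_nonneg Lu)
      have h8 := mul_le_mul_of_nonneg_right hs1'.le hδ.le
      have h9 := mul_nonneg hδ.le (norm_nonneg (∑ j, Lw j))
      nlinarith
    · have e : Lu + ∑ j, Lw j = -(K u - Lu) + ((1 - μ) * (∑ j, K (w j)) +
          -(∑ j, K (w j) - ∑ j, Lw j)) := by
        linear_combination h0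
      rw [e]
      refine (norm_add_le _ _).trans ?_
      refine (add_le_add_right (norm_add_le _ _) _).trans ?_
      rw [norm_neg, norm_neg, norm_mul, hs1]
      have := hns hKw
      have h6 : s * ‖∑ j, K (w j)‖ ≤ s * (‖∑ j, Lw j‖ + 2 * δ) :=
        mul_le_mul_of_nonneg_left this hs.le
      have h7 := mul_le_mul_of_nonneg_right hsδ.le (norm_nonneg (∑ j, Lw j))
      have h8 := mul_le_mul_of_nonneg_right hs1'.le hδ.le
      have h9 := mul_nonneg hδ.le (norm_nonneg Lu)
      nlinarith
  refine norm_le_zero_iff.1 (le_of_forall_pos_le_add fun ε hε => ?_)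
  have := key (ε / (5 + ‖Lu‖ + ‖∑ j, Lw j‖)) (by positivity)
  rw [div_mul_cancel₀ _ (by positivity)] at this
  linarith

theorem integral_indicator_smul {X : Type*} [MeasurableSpace X] {μ : Measure X} {U : Set X}
    (hU : MeasurableSet U) (ψ : X → ℝ) (f : X → ℂ) :
    ∫ x, ψ x • U.indicator f x ∂μ = ∫ x in U, ψ x • f x ∂μ := by
  rw [← integral_indicator hU]
  refine integral_congr_ae (Filter.Eventually.of_forall fun x => ?_)
  by_cases hx : x ∈ U <;> simp [hx]

theorem integral_indicator_sum_smul {X : Type*} [MeasurableSpace X] {μ : Measure X} {U : Set X}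
    (hU : MeasurableSet U) (ψ : Fin 2 → X → ℝ) (f : Fin 2 → X → ℂ) :
    ∫ x, ∑ j, ψ j x • U.indicator (f j) x ∂μ = ∫ x in U, ∑ j, ψ j x • f j x ∂μ := by
  rw [← integral_indicator hU]
  refine integral_congr_ae (Filter.Eventually.of_forall fun x => ?_)
  by_cases hx : x ∈ U <;> simp [hx]

theorem integral_indicator_mul_conj {X : Type*} [MeasurableSpace X] {μ : Measure X} {U : Set X}
    (hU : MeasurableSet U) (f : X → ℂ) :
    ∫ x, U.indicator f x * conj (U.indicator f x) ∂μ = ∫ x in U, f x * conj (f x) ∂μ := by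
  rw [← integral_indicator hU]
  refine integral_congr_ae (Filter.Eventually.of_forall fun x => ?_)
  by_cases hx : x ∈ U <;> simp [hx]

theorem L2_inner_self_C2 {X : Type*} [MeasurableSpace X] {μ : Measure X} (f : Lp C2 2 μ) :
    inner ℂ f f = ∑ j, ∫ x, f x j * conj (f x j) ∂μ := by
  rw [L2.inner_def, ← integral_finsetSum]
  · simp only [PiLp.inner_apply, RCLike.inner_apply]
  · intro j _
    have : MemLp (fun x => f x j) 2 μ :=
      (EuclideanSpace.proj (𝕜 := ℂ) j : C2 →L[ℂ] ℂ).comp_memLp' (Lp.memLp f)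
    exact this.integrable_mul this.star

theorem memLp_indicator_coord {U : Set (ℝ × ℝ)} (hU : MeasurableSet U) (f : L2 U C2) (j : Fin 2) :
    MemLp (U.indicator fun x => f x j) 2 volume :=
  (memLp_indicator_iff_restrict hU).2
    ((EuclideanSpace.proj (𝕜 := ℂ) j : C2 →L[ℂ] ℂ).comp_memLp' (Lp.memLp f))

/-- Smooth functions with compact support in the plane are total in `H¹(Q)`. -/
theorem H1Q_eq_zero {I : Set ℝ} (hI : I.OrdConnected) (hI_int : (interior I).Nonempty)
    (V : H1Q I)
    (h : ∀ (φ : ℝ × ℝ → ℝ) (hφ : IsSmoothC φ), inner ℂ (gradElem (Q I) planeFrame hφ.ofReal) V = 0) :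
    V = 0 := by
  have hQ := measurableSet_Q hI
  -- Orthogonality to all smooth functions, not only to those supported in `Q`, is the divergence
  -- relation across the boundary: a weak Neumann condition.
  have h1 : DivRel univ ((Q I).indicator V.1.fst) fun j => (Q I).indicator fun x => V.1.snd x j := by
    intro φ hφ
    rw [isTest_univ] at hφ
    have := h φ hφ
    rw [Submodule.coe_inner, WithLp.prod_inner_apply] at this
    simp only [gradElem] at this
    rw [inner_toLp_left, inner_toLp_left, add_comm, ← eq_neg_iff_add_eq_zero] at this
    rw [integral_indicator_smul hQ,
      integral_indicator_sum_smul hQ (fun j x => fderiv ℝ φ x (planeFrame j))]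
    simpa [smoothGrad, mul_comm, fderiv_ofReal (hφ.1.differentiable (by simp)),
      PiLp.inner_apply] using this
  have h2 : GradRel (Q I) ((Q I).indicator V.1.fst)
      fun j => (Q I).indicator fun x => V.1.snd x j := by
    intro φ hφ j
    rw [integral_indicator_smul hQ, integral_indicator_smul hQ]
    exact V.2 φ hφ j
  have := eq_zero_of_dual hI hI_int ((memLp_indicator_iff_restrict hQ).2 (Lp.memLp V.1.fst))
    (memLp_indicator_coord hQ V.1.snd) (fun x hx => by simp [hx]) (fun j x hx => by simp [hx])
    (Or.inr ⟨h1, h2⟩)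
  simp only [integral_indicator_mul_conj hQ, ← L2_inner_self_C2] at this
  have e : inner ℂ V V = 0 := by
    rw [Submodule.coe_inner, WithLp.prod_inner_apply, L2.inner_def]
    simp only [RCLike.inner_apply]
    exact this
  exact inner_self_eq_zero.1 e

/-- Smooth vector fields with compact support in the plane are total in `H(div; Q)`. -/
theorem HdivQ_eq_zero {I : Set ℝ} (hI : I.OrdConnected) (hI_int : (interior I).Nonempty)
    (W : HdivQ I)
    (h : ∀ (φ : ℝ × ℝ → ℝ) (hφ : IsSmoothC φ) (j : Fin 2),
      inner ℂ (divElem (Q I) planeFrame (hφ.ofReal.clm_comp (axis j))) W = 0) :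
    W = 0 := by
  have hQ := measurableSet_Q hI
  -- The roles are exchanged: `u` is the divergence and `w` the field. Orthogonality gives the
  -- gradient relation on the whole plane, while the divergence relation is known only inside `Q`.
  have h1 : GradRel univ ((Q I).indicator W.1.snd)
      fun j => (Q I).indicator fun x => W.1.fst x j := by
    intro φ hφ j
    rw [isTest_univ] at hφ
    have := h φ hφ j
    rw [Submodule.coe_inner, WithLp.prod_inner_apply] at this
    simp only [divElem] at this
    rw [inner_toLp_left, inner_toLp_left, add_comm, ← eq_neg_iff_add_eq_zero] at this
    rw [integral_indicator_smul hQ, integral_indicator_smul hQ]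
    have e : ∀ x, smoothDiv planeFrame (fun x => axis j (φ x : ℂ)) x =
        (fderiv ℝ φ x (planeFrame j) : ℂ) := by
      intro x
      have h3 : ∀ v, fderiv ℝ (fun x => axis j (φ x : ℂ)) x v = axis j (fderiv ℝ φ x v : ℂ) := by
        intro v
        have h4 := (axis j).hasFDerivAt.comp x
          ((hφ.ofReal.1.differentiable (by simp)) x).hasFDerivAt
        rw [show (fun x => axis j (φ x : ℂ)) = axis j ∘ fun x => (φ x : ℂ) from rfl, h4.fderiv,
          ContinuousLinearMap.comp_apply, fderiv_ofReal (hφ.1.differentiable (by simp))]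
      simp only [smoothDiv, h3]
      simp [axis_apply]
    simp only [e] at this
    simpa [axis_apply, EuclideanSpace.inner_single_left, mul_comm] using this
  have h2 : DivRel (Q I) ((Q I).indicator W.1.snd)
      fun j => (Q I).indicator fun x => W.1.fst x j := by
    intro φ hφ
    rw [integral_indicator_smul hQ,
      integral_indicator_sum_smul hQ (fun j x => fderiv ℝ φ x (planeFrame j))]
    exact W.2 φ hφ
  have := eq_zero_of_dual hI hI_int ((memLp_indicator_iff_restrict hQ).2 (Lp.memLp W.1.snd))
    (memLp_indicator_coord hQ W.1.fst) (fun x hx => by simp [hx]) (fun j x hx => by simp [hx])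
    (Or.inl ⟨h2, h1⟩)
  simp only [integral_indicator_mul_conj hQ, ← L2_inner_self_C2] at this
  have e : inner ℂ W W = 0 := by
    rw [Submodule.coe_inner, WithLp.prod_inner_apply, add_comm, L2.inner_def]
    simp only [RCLike.inner_apply]
    exact this
  exact inner_self_eq_zero.1 e

open scoped SchwartzMap FourierTransform

/-! ### The space `H^{1/2}(ℝ)` -/

theorem isClosed_Hhalf :
    IsClosed (Hhalf : Set (WithLp 2 (Lp ℂ 2 (volume : Measure ℝ) × Lp ℂ 2 (volume : Measure ℝ)))) :=
  isClosed_eq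
    (((TemperedDistribution.besselPotential ℝ ℂ (1 / 2)).continuous.comp
      (Lp.toTemperedDistributionCLM ℂ volume 2).continuous).comp (WithLp.fstL 2 ℂ _ _).continuous)
    ((Lp.toTemperedDistributionCLM ℂ volume 2).continuous.comp (WithLp.sndL 2 ℂ _ _).continuous)

instance : CompleteSpace Hhalf := isClosed_Hhalf.completeSpace_coe

theorem toTemperedDistribution_injective :
    Function.Injective (Lp.toTemperedDistributionCLM ℂ (volume : Measure ℝ) 2) :=
  LinearMap.ker_eq_bot.1 Lp.ker_toTemperedDistributionCLM_eq_bot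

theorem Hhalf_ext {Φ Ψ : Hhalf} (h : Φ.1.fst = Ψ.1.fst) : Φ = Ψ := by
  have h1 := Φ.2
  have h2 := Ψ.2
  change TemperedDistribution.besselPotential ℝ ℂ (1 / 2)
    (Lp.toTemperedDistributionCLM ℂ volume 2 Φ.1.fst) = Lp.toTemperedDistributionCLM ℂ volume 2 _
    at h1
  change TemperedDistribution.besselPotential ℝ ℂ (1 / 2)
    (Lp.toTemperedDistributionCLM ℂ volume 2 Ψ.1.fst) = Lp.toTemperedDistributionCLM ℂ volume 2 _
    at h2
  rw [h] at h1
  exact Subtype.ext (WithLp.ofLp_injective 2 (Prod.ext h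
    (toTemperedDistribution_injective (h1.symm.trans h2))))

/-- The Bessel potential is invertible, its inverse having order `-1/2`, so the second component
determines the first. -/
theorem Hhalf_ext_snd {Φ Ψ : Hhalf} (h : Φ.1.snd = Ψ.1.snd) : Φ = Ψ := by
  have h1 := Φ.2
  have h2 := Ψ.2
  change TemperedDistribution.besselPotential ℝ ℂ (1 / 2)
    (Lp.toTemperedDistributionCLM ℂ volume 2 Φ.1.fst) = Lp.toTemperedDistributionCLM ℂ volume 2 _
    at h1
  change TemperedDistribution.besselPotential ℝ ℂ (1 / 2)
    (Lp.toTemperedDistributionCLM ℂ volume 2 Ψ.1.fst) = Lp.toTemperedDistributionCLM ℂ volume 2 _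
    at h2
  rw [h, ← h2] at h1
  refine Hhalf_ext (toTemperedDistribution_injective ?_)
  have := congrArg (TemperedDistribution.besselPotential ℝ ℂ (-(1 / 2))) h1
  simpa only [TemperedDistribution.besselPotential_besselPotential_apply, add_neg_cancel,
    TemperedDistribution.besselPotential_zero, ContinuousLinearMap.id_apply] using this

/-- The symbol `(1 + |ξ|²)^{1/4}`. -/
def symb (ξ : ℝ) : ℂ := ((1 + ‖ξ‖ ^ 2) ^ ((1 / 2 : ℝ) / 2) : ℝ)

theorem symb_hasTemperateGrowth : symb.HasTemperateGrowth := by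
  unfold symb
  fun_prop

theorem symb_sq (ξ : ℝ) : ‖symb ξ‖ ^ 2 = (1 + ξ ^ 2) ^ (1 / 2 : ℝ) := by
  rw [symb, Complex.norm_real, Real.norm_of_nonneg (by positivity), ← Real.rpow_natCast,
    ← Real.rpow_mul (by positivity)]
  norm_num

theorem symb_ne_zero (ξ : ℝ) : symb ξ ≠ 0 := by
  rw [symb, Complex.ofReal_ne_zero]
  positivity

theorem one_le_norm_symb (ξ : ℝ) : 1 ≤ ‖symb ξ‖ := by
  rw [symb, Complex.norm_real, Real.norm_of_nonneg (by positivity)]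
  exact Real.one_le_rpow (by nlinarith [sq_nonneg ‖ξ‖]) (by norm_num)

/-- The Bessel potential of order `1/2` on Schwartz functions. -/
def bessel (φ : 𝓢(ℝ, ℂ)) : 𝓢(ℝ, ℂ) := SchwartzMap.fourierMultiplierCLM ℂ symb φ

theorem fourier_bessel (φ : 𝓢(ℝ, ℂ)) (ξ : ℝ) : 𝓕 (bessel φ) ξ = symb ξ * 𝓕 φ ξ := by
  rw [bessel, SchwartzMap.fourierMultiplierCLM_apply, FourierTransform.fourier_fourierInv_eq,
    SchwartzMap.smulLeftCLM_apply_apply symb_hasTemperateGrowth, smul_eq_mul]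

/-- A Schwartz function as an element of `L²(ℝ)`. -/
def schwL2 : 𝓢(ℝ, ℂ) →L[ℂ] Lp ℂ 2 (volume : Measure ℝ) := SchwartzMap.toLpCLM ℂ ℂ 2 volume

theorem schwL2_eq (φ : 𝓢(ℝ, ℂ)) : schwL2 φ = φ.toLp 2 volume := rfl

theorem coeFn_schwL2 (φ : 𝓢(ℝ, ℂ)) : schwL2 φ =ᵐ[volume] φ := φ.coeFn_toLp 2 volume

theorem toTemperedDistribution_schwL2 (φ : 𝓢(ℝ, ℂ)) :
    Lp.toTemperedDistributionCLM ℂ volume 2 (schwL2 φ) =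
      SchwartzMap.toTemperedDistributionCLM ℝ ℂ volume φ :=
  Lp.toTemperedDistribution_toLp_eq φ

theorem besselPotential_schwL2 (φ : 𝓢(ℝ, ℂ)) : TemperedDistribution.besselPotential ℝ ℂ (1 / 2)
    (Lp.toTemperedDistributionCLM ℂ volume 2 (schwL2 φ)) =
      Lp.toTemperedDistributionCLM ℂ volume 2 (schwL2 (bessel φ)) := by
  rw [toTemperedDistribution_schwL2, toTemperedDistribution_schwL2]
  exact TemperedDistribution.fourierMultiplierCLM_toTemperedDistributionCLM_eq
    symb_hasTemperateGrowth φ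

theorem mem_Hhalf (a b : Lp ℂ 2 (volume : Measure ℝ)) : WithLp.toLp 2 (a, b) ∈ Hhalf ↔
    TemperedDistribution.besselPotential ℝ ℂ (1 / 2)
      (Lp.toTemperedDistributionCLM ℂ volume 2 a) = Lp.toTemperedDistributionCLM ℂ volume 2 b :=
  Iff.rfl

/-- A Schwartz function as an element of `H^{1/2}(ℝ)`. -/
def hhalfElem (φ : 𝓢(ℝ, ℂ)) : Hhalf :=
  ⟨WithLp.toLp 2 (schwL2 φ, schwL2 (bessel φ)), (mem_Hhalf _ _).2 (besselPotential_schwL2 φ)⟩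

theorem hhalfElem_fst (φ : 𝓢(ℝ, ℂ)) : (hhalfElem φ).1.fst =ᵐ[volume] φ :=
  coeFn_schwL2 φ

theorem norm_schwL2_sq (φ : 𝓢(ℝ, ℂ)) : ‖schwL2 φ‖ ^ 2 = ∫ ξ, ‖𝓕 φ ξ‖ ^ 2 := by
  rw [SchwartzMap.integral_norm_sq_fourier]
  have h := SchwartzMap.inner_toL2_toL2_eq φ φ (volume : Measure ℝ)
  rw [inner_self_eq_norm_sq_to_K] at h
  have h2 : ∀ x, inner ℂ (φ x) (φ x) = ((‖φ x‖ ^ 2 : ℝ) : ℂ) := fun x => by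
    rw [inner_self_eq_norm_sq_to_K]; simp
  simp only [h2] at h
  rw [integral_complex_ofReal] at h
  exact Complex.ofReal_injective (by rw [← h, Complex.ofReal_pow]; rfl)

/-- Plancherel and `|symb| ≥ 1`. Consequently the second component alone controls the norm of
`Hhalf`. -/
theorem norm_schwL2_le_bessel (φ : 𝓢(ℝ, ℂ)) : ‖schwL2 φ‖ ≤ ‖schwL2 (bessel φ)‖ := by
  rw [← sq_le_sq₀ (norm_nonneg _) (norm_nonneg _), norm_schwL2_sq, norm_schwL2_sq]
  refine integral_mono_of_nonneg (Filter.Eventually.of_forall fun ξ => by positivity) ?_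
    (Filter.Eventually.of_forall fun ξ => ?_)
  · have := (memLp_two_iff_integrable_sq_norm (𝓕 (bessel φ)).continuous.aestronglyMeasurable).1
      ((𝓕 (bessel φ)).memLp 2)
    exact this
  · simp only [fourier_bessel, norm_mul, mul_pow]
    have := one_le_norm_symb ξ
    have h2 : 1 ≤ ‖symb ξ‖ ^ 2 := by nlinarith
    nlinarith [sq_nonneg ‖𝓕 φ ξ‖]

theorem norm_bessel_le_hhalfElem (φ : 𝓢(ℝ, ℂ)) : ‖schwL2 (bessel φ)‖ ≤ ‖hhalfElem φ‖ := by
  rw [← sq_le_sq₀ (norm_nonneg _) (norm_nonneg _), Submodule.coe_norm, WithLp.prod_norm_sq_eq_of_L2]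
  exact le_add_of_nonneg_left (sq_nonneg _)

theorem norm_hhalfElem_le (φ : 𝓢(ℝ, ℂ)) : ‖hhalfElem φ‖ ≤ 2 * ‖schwL2 (bessel φ)‖ := by
  rw [← sq_le_sq₀ (norm_nonneg _) (by positivity), Submodule.coe_norm,
    WithLp.prod_norm_sq_eq_of_L2]
  have h1 := norm_schwL2_le_bessel φ
  have h2 : ‖schwL2 φ‖ ^ 2 ≤ ‖schwL2 (bessel φ)‖ ^ 2 := by gcongr
  change ‖schwL2 φ‖ ^ 2 + ‖schwL2 (bessel φ)‖ ^ 2 ≤ _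
  nlinarith [sq_nonneg ‖schwL2 (bessel φ)‖]

theorem bessel_sub (φ ψ : 𝓢(ℝ, ℂ)) : bessel (φ - ψ) = bessel φ - bessel ψ := map_sub _ _ _

theorem hhalfElem_sub (φ ψ : 𝓢(ℝ, ℂ)) : hhalfElem (φ - ψ) = hhalfElem φ - hhalfElem ψ := by
  refine Hhalf_ext ?_
  exact map_sub schwL2 φ ψ

/-- The Fourier transform of `g` is approximated in `L²` by a smooth function with compact support.
Division by the symbol, which is smooth and never zero, keeps it in this class and gives the Fourier
transform of `φ`. -/
theorem exists_bessel_close (g : Lp ℂ 2 (volume : Measure ℝ)) {ε : ℝ} (hε : 0 < ε) :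
    ∃ φ : 𝓢(ℝ, ℂ), HasCompactSupport ⇑(𝓕 φ : 𝓢(ℝ, ℂ)) ∧ ‖schwL2 (bessel φ) - g‖ ≤ ε := by
  obtain ⟨h, hc, hs, hh⟩ := MemLp.exist_eLpNorm_sub_le (p := 2) (by simp) (by simp)
    (Lp.memLp (𝓕 g)) hε
  have hs' : ContDiff ℝ ∞ fun ξ => (symb ξ)⁻¹ * h ξ :=
    (symb_hasTemperateGrowth.1.inv symb_ne_zero).mul hs
  have hc' : HasCompactSupport fun ξ => (symb ξ)⁻¹ * h ξ := hc.mul_left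
  let k : 𝓢(ℝ, ℂ) := hc'.toSchwartzMap hs'
  have e1 : 𝓕 (𝓕⁻ k) = k := FourierTransform.fourier_fourierInv_eq k
  have e2 : 𝓕 (bessel (𝓕⁻ k)) = hc.toSchwartzMap hs := by
    ext ξ
    rw [fourier_bessel, e1]
    simp [k, symb_ne_zero]
  refine ⟨𝓕⁻ k, by rw [e1]; exact hc', ?_⟩
  have e3 : 𝓕 (schwL2 (bessel (𝓕⁻ k)) - g) =
      schwL2 (hc.toSchwartzMap hs) - 𝓕 g := by
    rw [← e2, schwL2_eq (𝓕 (bessel (𝓕⁻ k))), ← SchwartzMap.toLp_fourier_eq]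
    exact map_sub (Lp.fourierTransformₗᵢ ℝ ℂ) _ _
  rw [← Lp.norm_fourier_eq, e3, norm_sub_rev]
  have e4 : 𝓕 g - schwL2 (hc.toSchwartzMap hs) =
      MemLp.toLp _ ((Lp.memLp (𝓕 g)).sub (hs.continuous.memLp_of_hasCompactSupport hc)) := by
    refine Lp.ext ?_
    filter_upwards [Lp.coeFn_sub (𝓕 g) (schwL2 (hc.toSchwartzMap hs)),
      coeFn_schwL2 (hc.toSchwartzMap hs), MemLp.coeFn_toLp ((Lp.memLp
        (𝓕 g)).sub (hs.continuous.memLp_of_hasCompactSupport hc))] with x h1 h2 h3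
    rw [h1, h3, Pi.sub_apply, Pi.sub_apply, h2]
    rfl
  rw [e4, Lp.norm_toLp]
  exact ENNReal.toReal_le_of_le_ofReal hε.le hh

/-- Only the second component is approximated directly. As it controls the norm on Schwartz
functions, the approximants form a Cauchy sequence in `Hhalf`, and `Hhalf_ext_snd` identifies the
limit. -/
theorem dense_hhalfElem (Φ : Hhalf) {ε : ℝ} (hε : 0 < ε) :
    ∃ φ : 𝓢(ℝ, ℂ), HasCompactSupport ⇑(𝓕 φ : 𝓢(ℝ, ℂ)) ∧ ‖hhalfElem φ - Φ‖ ≤ ε := by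
  choose φ hφ hφ' using fun n : ℕ => exists_bessel_close Φ.1.snd
    (Nat.one_div_pos_of_nat (α := ℝ) (n := n))
  have hlim : Filter.Tendsto (fun n => schwL2 (bessel (φ n))) Filter.atTop (nhds Φ.1.snd) := by
    rw [tendsto_iff_norm_sub_tendsto_zero]
    exact squeeze_zero (fun n => norm_nonneg _) hφ' tendsto_one_div_add_atTop_nhds_zero_nat
  have hcauchy : CauchySeq fun n => hhalfElem (φ n) := by
    have h1 := hlim.cauchySeq
    rw [Metric.cauchySeq_iff] at h1 ⊢
    intro δ hδ
    obtain ⟨N, hN⟩ := h1 (δ / 2) (by positivity)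
    refine ⟨N, fun m hm n hn => ?_⟩
    have := hN m hm n hn
    rw [dist_eq_norm] at this ⊢
    rw [← hhalfElem_sub]
    refine (norm_hhalfElem_le _).trans_lt ?_
    have e : schwL2 (bessel (φ m - φ n)) =
        schwL2 (bessel (φ m)) - schwL2 (bessel (φ n)) := by
      rw [bessel_sub, map_sub]
    rw [e]
    linarith
  obtain ⟨Ψ, hΨ⟩ := cauchySeq_tendsto_of_complete hcauchy
  have e : Ψ = Φ := by
    refine Hhalf_ext_snd (tendsto_nhds_unique ?_ hlim)
    exact (((WithLp.sndL 2 ℂ (Lp ℂ 2 (volume : Measure ℝ)) (Lp ℂ 2 (volume : Measure ℝ))).continuous.comp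
      continuous_subtype_val).tendsto Ψ).comp hΨ
  rw [e] at hΨ
  obtain ⟨N, hN⟩ := Metric.tendsto_atTop.1 hΨ ε hε
  refine ⟨φ N, hφ N, ?_⟩
  have := hN N le_rfl
  rw [dist_eq_norm] at this
  exact this.le

/-! ### Integrals depending on a parameter, with compact supports -/

theorem continuous_param {X : Type*} [TopologicalSpace X] [FirstCountableTopology X]
    [LocallyCompactSpace X] {F : X → ℝ → ℂ}
    (hF : Continuous (Function.uncurry F)) {S : Set ℝ} (hS : IsCompact S)
    (h0 : ∀ x, ∀ y ∉ S, F x y = 0) : Continuous fun x => ∫ y, F x y := by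
  have := continuous_parametric_integral_of_continuous (μ := (volume : Measure ℝ)) hF hS
  refine this.congr fun x => ?_
  exact setIntegral_eq_integral_of_forall_compl_eq_zero (h0 x)

/-- Differentiation under the integral, dominated by the maximum of `F'` on the product of a ball
around `x` and the compact set `S`. -/
theorem hasDerivAt_param {F F' : ℝ → ℝ → ℂ} (hF : Continuous (Function.uncurry F))
    (hF' : Continuous (Function.uncurry F')) {S : Set ℝ} (hS : IsCompact S)
    (h0 : ∀ x, ∀ y ∉ S, F x y = 0) (h0' : ∀ x, ∀ y ∉ S, F' x y = 0)
    (hd : ∀ x y, HasDerivAt (fun x => F x y) (F' x y) x) (x : ℝ) :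
    HasDerivAt (fun x => ∫ y, F x y) (∫ y, F' x y) x := by
  obtain ⟨C, hC⟩ := ((isCompact_closedBall x 1).prod hS).exists_bound_of_continuousOn
    hF'.continuousOn
  have hc : ∀ x, Continuous (F x) := fun x => hF.comp (by fun_prop : Continuous fun y => (x, y))
  have hc' : ∀ x, Continuous (F' x) := fun x => hF'.comp (by fun_prop : Continuous fun y => (x, y))
  have hi : Integrable (F x) := (hc x).integrable_of_hasCompactSupport
    (HasCompactSupport.intro hS (h0 x))
  refine (hasDerivAt_integral_of_dominated_loc_of_deriv_le (F := F) (F' := F')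
    (bound := S.indicator fun _ => C) (Metric.closedBall_mem_nhds x one_pos)
    (Filter.Eventually.of_forall fun x => (hc x).aestronglyMeasurable) hi
    (hc' x).aestronglyMeasurable (Filter.Eventually.of_forall fun y t ht => ?_) ?_
    (Filter.Eventually.of_forall fun y t _ => hd t y)).2
  · by_cases hy : y ∈ S
    · rw [indicator_of_mem hy]
      exact hC (t, y) ⟨ht, hy⟩
    · rw [indicator_of_notMem hy, h0' t y hy, norm_zero]
  · rw [integrable_indicator_iff hS.measurableSet]
    exact integrableOn_const hS.measure_lt_top.ne

/-! ### Fourier transforms of slices -/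

theorem IsSmoothC.slice {F : Type*} [NormedAddCommGroup F] [NormedSpace ℝ F] {f : ℝ × ℝ → F}
    (h : IsSmoothC f) (x : ℝ) : IsSmoothC fun z => f (x, z) := by
  refine ⟨h.1.comp (by fun_prop), HasCompactSupport.intro (h.2.isCompact.image continuous_snd) ?_⟩
  intro z hz
  refine image_eq_zero_of_notMem_tsupport fun hmem => hz ⟨(x, z), hmem, rfl⟩

/-- The slice `z ↦ f (x, z)` as a Schwartz function. -/
def sliceS {f : ℝ × ℝ → ℂ} (h : IsSmoothC f) (x : ℝ) : 𝓢(ℝ, ℂ) :=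
  (h.slice x).2.toSchwartzMap (h.slice x).1

@[simp] theorem sliceS_apply {f : ℝ × ℝ → ℂ} (h : IsSmoothC f) (x z : ℝ) :
    sliceS h x z = f (x, z) := rfl

theorem fourier_sliceS {f : ℝ × ℝ → ℂ} (h : IsSmoothC f) (x ξ : ℝ) :
    𝓕 (sliceS h x) ξ = ∫ z, Complex.exp ((-2 * Real.pi * z * ξ : ℝ) * Complex.I) * f (x, z) := by
  rw [SchwartzMap.fourier_coe, Real.fourier_real_eq_integral_exp_smul]
  rfl

theorem continuous_fourier_sliceS {f : ℝ × ℝ → ℂ} (h : IsSmoothC f) :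
    Continuous fun p : ℝ × ℝ => 𝓕 (sliceS h p.1) p.2 := by
  simp only [fourier_sliceS]
  refine continuous_param (S := Prod.snd '' tsupport f) ?_ (h.2.isCompact.image continuous_snd) ?_
  · have := h.continuous
    unfold Function.uncurry
    fun_prop
  · intro p z hz
    rw [image_eq_zero_of_notMem_tsupport (f := f) fun hmem => hz ⟨_, hmem, rfl⟩, mul_zero]

theorem IsSmoothC.hasDerivAt_fst {F : Type*} [NormedAddCommGroup F] [NormedSpace ℝ F]
    {f : ℝ × ℝ → F} (h : IsSmoothC f) (x z : ℝ) :
    HasDerivAt (fun x => f (x, z)) (fderiv ℝ f (x, z) (planeFrame 0)) x := by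
  have h1 := ((h.1.differentiable (by simp)) (x, z)).hasFDerivAt
  exact h1.comp_hasDerivAt x ((hasDerivAt_id x).prodMk (hasDerivAt_const x z))

theorem IsSmoothC.hasDerivAt_snd {F : Type*} [NormedAddCommGroup F] [NormedSpace ℝ F]
    {f : ℝ × ℝ → F} (h : IsSmoothC f) (x z : ℝ) :
    HasDerivAt (fun z => f (x, z)) (fderiv ℝ f (x, z) (planeFrame 1)) z := by
  have h1 := ((h.1.differentiable (by simp)) (x, z)).hasFDerivAt
  exact h1.comp_hasDerivAt z ((hasDerivAt_const z x).prodMk (hasDerivAt_id z))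

theorem hasDerivAt_fourier_sliceS {f : ℝ × ℝ → ℂ} (h : IsSmoothC f) (x ξ : ℝ) :
    HasDerivAt (fun x => 𝓕 (sliceS h x) ξ) (𝓕 (sliceS (h.fderiv_apply (planeFrame 0)) x) ξ) x := by
  simp only [fourier_sliceS]
  have hc := h.continuous
  have hc' := (h.fderiv_apply (planeFrame 0)).continuous
  refine hasDerivAt_param (S := Prod.snd '' tsupport f)
    (F := fun x z => Complex.exp ((-2 * Real.pi * z * ξ : ℝ) * Complex.I) * f (x, z))
    (F' := fun x z => Complex.exp ((-2 * Real.pi * z * ξ : ℝ) * Complex.I) *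
      fderiv ℝ f (x, z) (planeFrame 0)) ?_ ?_
    (h.2.isCompact.image continuous_snd) ?_ ?_ ?_ x
  · unfold Function.uncurry
    fun_prop
  · unfold Function.uncurry
    fun_prop
  · intro p z hz
    rw [image_eq_zero_of_notMem_tsupport (f := f) fun hmem => hz ⟨_, hmem, rfl⟩, mul_zero]
  · intro p z hz
    rw [image_eq_zero_of_notMem_tsupport (f := fderiv ℝ f)
      fun hmem => hz ⟨_, tsupport_fderiv_subset ℝ hmem, rfl⟩]
    simp
  · intro x z
    exact (h.hasDerivAt_fst x z).const_mul _

theorem fourier_sliceS_snd {f : ℝ × ℝ → ℂ} (h : IsSmoothC f) (x ξ : ℝ) :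
    𝓕 (sliceS (h.fderiv_apply (planeFrame 1)) x) ξ =
      (2 * Real.pi * Complex.I * ξ) * 𝓕 (sliceS h x) ξ := by
  have e : (sliceS (h.fderiv_apply (planeFrame 1)) x : ℝ → ℂ) = deriv (sliceS h x) :=
    funext fun z => (h.hasDerivAt_snd x z).deriv.symm
  rw [SchwartzMap.fourier_coe, e, Real.fourier_deriv (sliceS h x).integrable
    (sliceS h x).differentiable, SchwartzMap.fourier_coe]
  · rfl
  · rw [← e]
    exact (sliceS (h.fderiv_apply (planeFrame 1)) x).integrable

theorem lintegral_fourier_sq (φ : 𝓢(ℝ, ℂ)) :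
    ∫⁻ ξ, ENNReal.ofReal (‖𝓕 φ ξ‖ ^ 2) = ∫⁻ z, ENNReal.ofReal (‖φ z‖ ^ 2) := by
  have hi : ∀ ψ : 𝓢(ℝ, ℂ), Integrable fun z => ‖ψ z‖ ^ 2 := fun ψ =>
    (memLp_two_iff_integrable_sq_norm ψ.continuous.aestronglyMeasurable).1 (ψ.memLp 2)
  rw [← ofReal_integral_eq_lintegral_ofReal (hi _) (Filter.Eventually.of_forall fun _ => by positivity),
    ← ofReal_integral_eq_lintegral_ofReal (hi _) (Filter.Eventually.of_forall fun _ => by positivity),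
    SchwartzMap.integral_norm_sq_fourier]

theorem lintegral_slices {I : Set ℝ} {K : ℝ → ℝ → ℂ} (hK : Continuous (Function.uncurry K)) :
    ∫⁻ p in Q I, ENNReal.ofReal (‖K p.1 p.2‖ ^ 2) =
      ∫⁻ x in I, ∫⁻ z, ENNReal.ofReal (‖K x z‖ ^ 2) := by
  rw [volume_Q]
  refine lintegral_prod _ ?_
  have : Continuous fun p : ℝ × ℝ => ENNReal.ofReal (‖K p.1 p.2‖ ^ 2) :=
    ENNReal.continuous_ofReal.comp (by unfold Function.uncurry at hK; fun_prop)
  exact this.measurable.aemeasurable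

/-- Plancherel in `z` on each slice, then Tonelli. Lower integrals avoid all questions of
integrability. -/
theorem lintegral_fourier_slices {I : Set ℝ} {f : ℝ × ℝ → ℂ} (h : IsSmoothC f) :
    ∫⁻ ξ, ∫⁻ x in I, ENNReal.ofReal (‖𝓕 (sliceS h x) ξ‖ ^ 2) =
      ∫⁻ p in Q I, ENNReal.ofReal (‖f p‖ ^ 2) := by
  rw [lintegral_lintegral_swap]
  · simp only [lintegral_fourier_sq, sliceS_apply]
    exact (lintegral_slices (K := fun x z => f (x, z)) (by
      have := h.continuous; unfold Function.uncurry; fun_prop)).symm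
  · have h1 := continuous_fourier_sliceS h
    have : Continuous fun p : ℝ × ℝ => ENNReal.ofReal (‖𝓕 (sliceS h p.2) p.1‖ ^ 2) :=
      ENNReal.continuous_ofReal.comp ((h1.comp continuous_swap).norm.pow 2)
    exact this.measurable.aemeasurable

/-! ### Squared `L²` norms as lower integrals. -/

theorem norm_Lp_two_sq {X F : Type*} [MeasurableSpace X] {μ : Measure X} [NormedAddCommGroup F]
    (f : Lp F 2 μ) : ENNReal.ofReal (‖f‖ ^ 2) = ∫⁻ x, ENNReal.ofReal (‖f x‖ ^ 2) ∂μ := by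
  rw [Lp.norm_def, ← ENNReal.toReal_pow, ENNReal.ofReal_toReal
    (ENNReal.pow_ne_top (Lp.eLpNorm_ne_top f)), ← ENNReal.rpow_natCast]
  have := eLpNorm_nnreal_pow_eq_lintegral (p := 2) (μ := μ) (f := f) (by norm_num)
  simp only [NNReal.coe_ofNat, ENNReal.coe_ofNat] at this
  rw [show ((2 : ℕ) : ℝ) = 2 by norm_num, this]
  refine lintegral_congr fun x => ?_
  rw [ENNReal.ofReal_pow (norm_nonneg _), ofReal_norm, ← ENNReal.rpow_natCast]
  norm_num

theorem norm_toLp_two_sq {X F : Type*} [MeasurableSpace X] {μ : Measure X} [NormedAddCommGroup F]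
    {f : X → F} (hf : MemLp f 2 μ) :
    ENNReal.ofReal (‖hf.toLp‖ ^ 2) = ∫⁻ x, ENNReal.ofReal (‖f x‖ ^ 2) ∂μ := by
  rw [norm_Lp_two_sq]
  refine lintegral_congr_ae ?_
  filter_upwards [hf.coeFn_toLp] with x hx
  rw [hx]

theorem ofReal_norm_schwL2_bessel (φ : 𝓢(ℝ, ℂ)) :
    ENNReal.ofReal (‖schwL2 (bessel φ)‖ ^ 2) =
      ∫⁻ ξ, ENNReal.ofReal (‖symb ξ‖ ^ 2 * ‖𝓕 φ ξ‖ ^ 2) := by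
  rw [norm_Lp_two_sq, lintegral_congr_ae (g := fun z => ENNReal.ofReal (‖bessel φ z‖ ^ 2))
    (by filter_upwards [coeFn_schwL2 (bessel φ)] with z hz; rw [hz]), ← lintegral_fourier_sq]
  simp only [fourier_bessel, norm_mul, mul_pow]

theorem ofReal_norm_prod_sq {A B : Type*} [SeminormedAddCommGroup A] [SeminormedAddCommGroup B]
    (p : WithLp 2 (A × B)) : ENNReal.ofReal (‖p‖ ^ 2) =
      ENNReal.ofReal (‖p.fst‖ ^ 2) + ENNReal.ofReal (‖p.snd‖ ^ 2) := by
  rw [WithLp.prod_norm_sq_eq_of_L2, ENNReal.ofReal_add (by positivity) (by positivity)]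

theorem ofReal_norm_gradElem_sq {U : Set (ℝ × ℝ)} {f : ℝ × ℝ → ℂ} (h : IsSmoothC f) :
    ENNReal.ofReal (‖gradElem U planeFrame h‖ ^ 2) = (∫⁻ p in U, ENNReal.ofReal (‖f p‖ ^ 2)) +
      ((∫⁻ p in U, ENNReal.ofReal (‖fderiv ℝ f p (planeFrame 0)‖ ^ 2)) +
      ∫⁻ p in U, ENNReal.ofReal (‖fderiv ℝ f p (planeFrame 1)‖ ^ 2)) := by
  change ENNReal.ofReal (‖(gradElem U planeFrame h).1‖ ^ 2) = _
  rw [ofReal_norm_prod_sq]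
  change ENNReal.ofReal (‖(h.memLp U).toLp‖ ^ 2) +
    ENNReal.ofReal (‖(h.memLp_grad U planeFrame).toLp‖ ^ 2) = _
  rw [norm_toLp_two_sq, norm_toLp_two_sq, ← lintegral_add_left (μ := volume.restrict U)
    (f := fun p => ENNReal.ofReal (‖fderiv ℝ f p (planeFrame 0)‖ ^ 2))]
  · congr 1
    refine lintegral_congr fun p => ?_
    rw [EuclideanSpace.norm_sq_eq, Fin.sum_univ_two,
      ENNReal.ofReal_add (by positivity) (by positivity)]
    rfl
  · exact (ENNReal.continuous_ofReal.comp
      ((h.fderiv_apply (planeFrame 0)).continuous.norm.pow 2)).measurable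

/-! ### The trace inequality on `Q`. -/

theorem fourier_sliceS_eq_zero {f : ℝ × ℝ → ℂ} (h : IsSmoothC f) (ξ : ℝ) {x : ℝ}
    (hx : x ∉ Prod.fst '' tsupport f) : 𝓕 (sliceS h x) ξ = 0 := by
  rw [fourier_sliceS]
  refine integral_eq_zero_of_ae (Filter.Eventually.of_forall fun z => ?_)
  simp only [Pi.zero_apply]
  rw [image_eq_zero_of_notMem_tsupport (f := f) fun hm => hx ⟨_, hm, rfl⟩, mul_zero]

/-- The pointwise bound behind the trace theorem, on the Fourier side. -/
theorem norm_sq_trace_le {I : Set ℝ} (hI : I.OrdConnected)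
    (hI_int : (interior I).Nonempty) (hI_ne : I ≠ univ) {τ : frontier I} {χ : ℝ → ℝ}
    (hχ : IsCutoff I τ χ) {A : ℝ} (hA : ∀ x, |χ x| ≤ A) (hA' : ∀ x, |deriv χ x| ≤ A)
    {a a' : ℝ → ℂ} (ha : ∀ x, HasDerivAt a (a' x) x) (ha' : Continuous a')
    (hc : HasCompactSupport a) (hc' : HasCompactSupport a') {M : ℝ} (hM : 1 ≤ M) :
    M * ‖a τ‖ ^ 2 ≤ ∫ x in I, 2 * A * (M ^ 2 * ‖a x‖ ^ 2 + ‖a' x‖ ^ 2) := by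
  have hac : Continuous a := continuous_iff_continuousAt.2 fun x => (ha x).continuousAt
  have hA0 : 0 ≤ A := (abs_nonneg _).trans (hA 0)
  -- The fundamental theorem of calculus for `|a|²`, localised at `τ` by the cutoff.
  have h1 := integral_cutoff_interval hI hI_int hI_ne hχ (f := fun x => a x * conj (a x))
    (f' := fun x => a' x * conj (a x) + a x * conj (a' x))
    (fun x => (ha x).mul ((ha x).star)) (by fun_prop)
  have h2 : ‖a τ‖ ^ 2 = ‖(outward I τ : ℂ) * (a τ * conj (a τ))‖ := by
    have h3 : |outward I τ| = 1 := by
      have := outward_sq I τ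
      nlinarith [abs_mul_abs_self (outward I τ), abs_nonneg (outward I τ)]
    simp [h3, sq]
  have hi : Integrable (fun x => 2 * A * (M ^ 2 * ‖a x‖ ^ 2 + ‖a' x‖ ^ 2)) := by
    refine Continuous.integrable_of_hasCompactSupport (by fun_prop) ?_
    have e1 : HasCompactSupport fun x => M ^ 2 * ‖a x‖ ^ 2 :=
      hc.comp_left (g := fun z : ℂ => M ^ 2 * ‖z‖ ^ 2) (by simp)
    have e2 : HasCompactSupport fun x => ‖a' x‖ ^ 2 :=
      hc'.comp_left (g := fun z : ℂ => ‖z‖ ^ 2) (by simp)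
    exact (e1.add e2).mul_left
  have hMn : ‖(M : ℂ)‖ = M := by rw [Complex.norm_real, Real.norm_of_nonneg (by linarith)]
  have h7 : M * ‖a τ‖ ^ 2 = ‖∫ x in I, (M : ℂ) * (((deriv χ x : ℝ) : ℂ) * (a x * conj (a x)) +
      χ x * (a' x * conj (a x) + a x * conj (a' x)))‖ := by
    rw [integral_const_mul, norm_mul, hMn, h1, h2]
  rw [h7]
  refine norm_integral_le_of_norm_le hi.integrableOn (Filter.Eventually.of_forall fun x => ?_)
  rw [norm_mul, hMn]
  have h4 : ‖((deriv χ x : ℝ) : ℂ) * (a x * conj (a x)) +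
      χ x * (a' x * conj (a x) + a x * conj (a' x))‖ ≤ A * ‖a x‖ ^ 2 + A * (2 * ‖a x‖ * ‖a' x‖) := by
    refine (norm_add_le _ _).trans (add_le_add ?_ ?_)
    · rw [norm_mul, norm_mul, RCLike.norm_conj, Complex.norm_real, ← sq]
      exact mul_le_mul_of_nonneg_right (hA' x) (by positivity)
    · rw [norm_mul, Complex.norm_real]
      refine mul_le_mul (hA x) ((norm_add_le _ _).trans ?_) (norm_nonneg _) hA0
      simp only [norm_mul, RCLike.norm_conj]
      linarith
  -- The weight `M` is distributed by Young's inequality on the product `M |a| |a'|`, and by `M ≥ 1`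
  -- on the term produced by the derivative of the cutoff.
  have h5 : M * ‖a x‖ ^ 2 ≤ M ^ 2 * ‖a x‖ ^ 2 := by gcongr; nlinarith
  have h6 : M * (2 * ‖a x‖ * ‖a' x‖) ≤ M ^ 2 * ‖a x‖ ^ 2 + ‖a' x‖ ^ 2 := by
    nlinarith [sq_nonneg (M * ‖a x‖ - ‖a' x‖)]
  calc _ ≤ M * (A * ‖a x‖ ^ 2 + A * (2 * ‖a x‖ * ‖a' x‖)) := by gcongr
    _ = A * (M * ‖a x‖ ^ 2 + M * (2 * ‖a x‖ * ‖a' x‖)) := by ring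
    _ ≤ A * (M ^ 2 * ‖a x‖ ^ 2 + (M ^ 2 * ‖a x‖ ^ 2 + ‖a' x‖ ^ 2)) := by gcongr
    _ ≤ _ := by nlinarith [mul_nonneg hA0 (sq_nonneg ‖a' x‖)]

theorem exists_cutoff_bound {I : Set ℝ} {τ : frontier I} {χ : ℝ → ℝ} (hχ : IsCutoff I τ χ) :
    ∃ A, 0 ≤ A ∧ (∀ x, |χ x| ≤ A) ∧ ∀ x, |deriv χ x| ≤ A := by
  obtain ⟨A, hA⟩ := hχ.compact.exists_bound_of_continuous hχ.contDiff.continuous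
  obtain ⟨B, hB⟩ := hχ.compact.deriv.exists_bound_of_continuous
    (hχ.contDiff.continuous_deriv (by simp))
  exact ⟨max A B, ((abs_nonneg _).trans (hA 0)).trans (le_max_left _ _),
    fun x => (hA x).trans (le_max_left _ _), fun x => (hB x).trans (le_max_right _ _)⟩

theorem symb_four (ξ : ℝ) : (‖symb ξ‖ ^ 2) ^ 2 = 1 + ξ ^ 2 := by
  rw [symb_sq, ← Real.rpow_natCast, ← Real.rpow_mul (by positivity)]
  norm_num

theorem lintegral_lintegral_add {X Y : Type*} [MeasurableSpace X] [MeasurableSpace Y]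
    {μ : Measure X} {ν : Measure Y} [SFinite ν] {f g : X → Y → ℝ≥0∞}
    (hf : Measurable (Function.uncurry f)) :
    (∫⁻ x, ∫⁻ y, f x y ∂ν ∂μ) + (∫⁻ x, ∫⁻ y, g x y ∂ν ∂μ) =
      ∫⁻ x, ∫⁻ y, f x y + g x y ∂ν ∂μ := by
  rw [← lintegral_add_left hf.lintegral_prod_right]
  refine lintegral_congr fun x => ?_
  exact (lintegral_add_left (hf.comp measurable_prodMk_left) _).symm

/-- The trace theorem for smooth functions on `Q`. -/
theorem exists_trace_bound {I : Set ℝ} (hI : I.OrdConnected)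
    (hI_int : (interior I).Nonempty) (hI_ne : I ≠ univ) (τ : frontier I) :
    ∃ C : ℝ, 0 ≤ C ∧ ∀ (f : ℝ × ℝ → ℂ) (h : IsSmoothC f),
      ‖hhalfElem (sliceS h τ)‖ ≤ C * ‖gradElem (Q I) planeFrame h‖ := by
  obtain ⟨χ, hχ⟩ := exists_cutoff (finite_frontier hI hI_int hI_ne) τ
  obtain ⟨A, hA0, hA, hA'⟩ := exists_cutoff_bound hχ
  -- The factor `2` compares the norm of `Hhalf` with that of its second component; `2 * A` is the
  -- constant of `norm_sq_trace_le`.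
  refine ⟨2 * Real.sqrt (2 * A), by positivity, fun f h => ?_⟩
  have h0 : ‖schwL2 (bessel (sliceS h τ))‖ ^ 2 ≤ 2 * A * ‖gradElem (Q I) planeFrame h‖ ^ 2 := by
    rw [← ENNReal.ofReal_le_ofReal_iff (by positivity), ofReal_norm_schwL2_bessel,
      ENNReal.ofReal_mul (by positivity), ofReal_norm_gradElem_sq,
      ← lintegral_fourier_slices h, ← lintegral_fourier_slices (h.fderiv_apply (planeFrame 0)),
      ← lintegral_fourier_slices (h.fderiv_apply (planeFrame 1))]
    have hm : ∀ {g : ℝ × ℝ → ℂ} (h : IsSmoothC g), Measurable (Function.uncurry fun ξ x : ℝ =>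
        ENNReal.ofReal (‖𝓕 (sliceS h x) ξ‖ ^ 2)) := fun h =>
      (ENNReal.continuous_ofReal.comp
        (((continuous_fourier_sliceS h).comp continuous_swap).norm.pow 2)).measurable
    rw [lintegral_lintegral_add (hm (h.fderiv_apply _)), lintegral_lintegral_add (hm h),
      ← lintegral_const_mul' _ _ ENNReal.ofReal_ne_top]
    refine lintegral_mono fun ξ => ?_
    simp only
    rw [← lintegral_const_mul' _ _ ENNReal.ofReal_ne_top]
    have hs : ∀ {g : ℝ × ℝ → ℂ} (h : IsSmoothC g), HasCompactSupport fun x =>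
        𝓕 (sliceS h x) ξ := fun h => HasCompactSupport.intro
      (h.2.isCompact.image continuous_fst) fun x hx => fourier_sliceS_eq_zero h ξ hx
    have hcc : ∀ {g : ℝ × ℝ → ℂ} (h : IsSmoothC g), Continuous fun x =>
        𝓕 (sliceS h x) ξ := fun h => (continuous_fourier_sliceS h).comp (by fun_prop :
          Continuous fun x : ℝ => (x, ξ))
    -- With `M = |symb ξ|² = (1 + ξ²)^{1/2}`, the left side is the density of the `H^{1/2}` norm at
    -- frequency `ξ`, and `M² = 1 + ξ²` is the weight of the `H¹` norm.
    have h1 := norm_sq_trace_le hI hI_int hI_ne hχ hA hA'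
      (fun x => hasDerivAt_fourier_sliceS h x ξ) (hcc (h.fderiv_apply (planeFrame 0)))
      (hs h) (hs (h.fderiv_apply (planeFrame 0)))
      (M := ‖symb ξ‖ ^ 2) (one_le_pow₀ (one_le_norm_symb ξ))
    refine (ENNReal.ofReal_le_ofReal h1).trans ((ENNReal.ofReal_le_ofReal
      (le_abs_self _)).trans ?_)
    rw [← Real.norm_eq_abs, ofReal_norm]
    refine (enorm_integral_le_lintegral_enorm _).trans (lintegral_mono fun x => ?_)
    simp only
    rw [Real.enorm_of_nonneg (by positivity), fourier_sliceS_snd, symb_four,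
      ← ENNReal.ofReal_add (by positivity) (by positivity),
      ← ENNReal.ofReal_add (by positivity) (by positivity), ← ENNReal.ofReal_mul (by positivity)]
    refine ENNReal.ofReal_le_ofReal ?_
    refine mul_le_mul_of_nonneg_left ?_ (by positivity)
    have h2 : ‖(2 * Real.pi * Complex.I * ξ : ℂ)‖ ^ 2 = 4 * Real.pi ^ 2 * ξ ^ 2 := by
      simp [mul_pow, abs_of_pos Real.pi_pos]
      norm_num
    rw [norm_mul, mul_pow, h2]
    -- The Fourier normalisation turns `∂_z` into multiplication by `2πiξ`, so the derivative term
    -- carries `4π²ξ²`, which dominates the `ξ²` of the weight.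
    have h3 : 1 ≤ 4 * Real.pi ^ 2 := by nlinarith [Real.pi_gt_three]
    have h4 : ∀ r t s : ℝ, 0 ≤ s → 0 ≤ t → (1 + t) * s + r ≤ s + (r + 4 * Real.pi ^ 2 * t * s) := by
      intro r t s hs ht
      nlinarith [mul_nonneg hs ht]
    exact h4 _ _ _ (sq_nonneg _) (sq_nonneg _)
  refine (norm_hhalfElem_le _).trans ?_
  rw [mul_assoc]
  gcongr
  refine abs_le_of_sq_le_sq' ?_ (by positivity) |>.2
  rw [mul_pow, Real.sq_sqrt (by positivity)]
  exact h0

/-! ### Lifting band limited functions by Fourier synthesis. -/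

/-- The inverse Fourier transform, in the second variable, of `k x ξ * η ξ`. -/
def synth (k : ℝ → ℝ → ℂ) (η : 𝓢(ℝ, ℂ)) (p : ℝ × ℝ) : ℂ :=
  ∫ ξ, Complex.exp ((2 * Real.pi * p.2 * ξ : ℝ) * Complex.I) * (k p.1 ξ * η ξ)

theorem synth_support {η : 𝓢(ℝ, ℂ)} {ξ : ℝ} (h : ξ ∉ tsupport η) (c d : ℂ) :
    c * (d * η ξ) = 0 := by
  rw [image_eq_zero_of_notMem_tsupport h, mul_zero, mul_zero]

theorem continuous_synth {k : ℝ → ℝ → ℂ} (hk : Continuous (Function.uncurry k)) {η : 𝓢(ℝ, ℂ)}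
    (hη : HasCompactSupport η) : Continuous (synth k η) := by
  refine continuous_param (S := tsupport η) ?_ hη.isCompact (fun p ξ h => synth_support h _ _)
  have h1 := η.continuous
  have h2 : Continuous fun q : (ℝ × ℝ) × ℝ => k q.1.1 q.2 :=
    hk.comp (by fun_prop : Continuous fun q : (ℝ × ℝ) × ℝ => (q.1.1, q.2))
  unfold Function.uncurry
  fun_prop

theorem hasDerivAt_synth_fst {k k' : ℝ → ℝ → ℂ} (hk : Continuous (Function.uncurry k))
    (hk' : Continuous (Function.uncurry k')) (hd : ∀ x ξ, HasDerivAt (fun x => k x ξ) (k' x ξ) x)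
    {η : 𝓢(ℝ, ℂ)} (hη : HasCompactSupport η) (x z : ℝ) :
    HasDerivAt (fun x => synth k η (x, z)) (synth k' η (x, z)) x := by
  have h1 := η.continuous
  refine hasDerivAt_param (S := tsupport η)
    (F := fun x ξ => Complex.exp ((2 * Real.pi * z * ξ : ℝ) * Complex.I) * (k x ξ * η ξ))
    (F' := fun x ξ => Complex.exp ((2 * Real.pi * z * ξ : ℝ) * Complex.I) * (k' x ξ * η ξ))
    ?_ ?_ hη.isCompact (fun p ξ h => synth_support h _ _) (fun p ξ h => synth_support h _ _)
    (fun x ξ => ((hd x ξ).mul_const _).const_mul _) x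
  · unfold Function.uncurry at *
    fun_prop
  · unfold Function.uncurry at *
    fun_prop

theorem hasDerivAt_synth_snd {k : ℝ → ℝ → ℂ} (hk : Continuous (Function.uncurry k))
    {η : 𝓢(ℝ, ℂ)} (hη : HasCompactSupport η) (x z : ℝ) :
    HasDerivAt (fun z => synth k η (x, z))
      (synth (fun x ξ => (2 * Real.pi * Complex.I * ξ) * k x ξ) η (x, z)) z := by
  have h1 := η.continuous
  have h2 : Continuous (k x) := hk.comp (by fun_prop : Continuous fun ξ => (x, ξ))
  refine hasDerivAt_param (S := tsupport η)
    (F := fun z ξ => Complex.exp ((2 * Real.pi * z * ξ : ℝ) * Complex.I) * (k x ξ * η ξ))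
    (F' := fun z ξ => Complex.exp ((2 * Real.pi * z * ξ : ℝ) * Complex.I) *
      ((2 * Real.pi * Complex.I * ξ) * k x ξ * η ξ))
    ?_ ?_ hη.isCompact (fun p ξ h => synth_support h _ _) (fun p ξ h => synth_support h _ _)
    (fun z ξ => ?_) z
  · unfold Function.uncurry at *
    fun_prop
  · unfold Function.uncurry at *
    fun_prop
  · have h3 : HasDerivAt (fun z : ℝ => ((2 * Real.pi * z * ξ : ℝ) : ℂ) * Complex.I)
        (((2 * Real.pi * 1 * ξ : ℝ) : ℂ) * Complex.I) z :=
      ((((hasDerivAt_id z).const_mul (2 * Real.pi)).mul_const ξ).ofReal_comp).mul_const _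
    refine (h3.cexp.mul_const (k x ξ * η ξ)).congr_deriv ?_
    push_cast
    ring

/-- For fixed `x` the product of `k x` and `η` is smooth with compact support, hence Schwartz, and
Plancherel applies to its inverse Fourier transform. -/
theorem lintegral_synth {k : ℝ → ℝ → ℂ} (hk : ∀ x, ContDiff ℝ ∞ (k x)) {η : 𝓢(ℝ, ℂ)}
    (hη : HasCompactSupport η) (x : ℝ) :
    ∫⁻ z, ENNReal.ofReal (‖synth k η (x, z)‖ ^ 2) = ∫⁻ ξ, ENNReal.ofReal (‖k x ξ * η ξ‖ ^ 2) := by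
  have h1 : HasCompactSupport fun ξ => k x ξ * η ξ := hη.mul_left
  have h2 : ContDiff ℝ ∞ fun ξ => k x ξ * η ξ := (hk x).mul (η.smooth ⊤)
  let κ : 𝓢(ℝ, ℂ) := h1.toSchwartzMap h2
  have e : ∀ z, synth k η (x, z) = (𝓕⁻ κ : 𝓢(ℝ, ℂ)) z := by
    intro z
    rw [SchwartzMap.fourierInv_coe, Real.fourierInv_eq']
    simp only [synth, smul_eq_mul]
    refine integral_congr_ae (Filter.Eventually.of_forall fun ξ => ?_)
    simp only [RCLike.inner_apply, conj_trivial]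
    rw [show 2 * Real.pi * z * ξ = 2 * Real.pi * (z * ξ) by ring]
    rfl
  simp only [e]
  rw [← lintegral_fourier_sq, FourierTransform.fourier_fourierInv_eq]
  rfl

theorem memLp_two_of_lintegral {X F : Type*} [MeasurableSpace X] {μ : Measure X}
    [NormedAddCommGroup F] {f : X → F} (hf : AEStronglyMeasurable f μ)
    (h : ∫⁻ x, ENNReal.ofReal (‖f x‖ ^ 2) ∂μ ≠ ⊤) : MemLp f 2 μ := by
  rw [memLp_two_iff_integrable_sq_norm hf]
  refine ⟨(hf.norm.pow 2), ?_⟩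
  rw [hasFiniteIntegral_iff_ofReal (Filter.Eventually.of_forall fun _ => by positivity)]
  exact h.lt_top

theorem lintegral_gaussian {b : ℝ} (hb : 0 < b) (τ : ℝ) :
    ∫⁻ x, ENNReal.ofReal (Real.exp (-b * (x - τ) ^ 2)) = ENNReal.ofReal (Real.sqrt (Real.pi / b)) := by
  rw [lintegral_sub_right_eq_self (μ := volume) (fun x => ENNReal.ofReal (Real.exp (-b * x ^ 2))) τ,
    ← ofReal_integral_eq_lintegral_ofReal (integrable_exp_neg_mul_sq hb)
    (Filter.Eventually.of_forall fun _ => (Real.exp_pos _).le), integral_gaussian]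

/-- A Gaussian bound on the kernel gives an `H^{1/2}` bound on the synthesis. -/
theorem lintegral_synth_le {I : Set ℝ} {k : ℝ → ℝ → ℂ} (hk : Continuous (Function.uncurry k))
    (hk' : ∀ x, ContDiff ℝ ∞ (k x)) {τ B : ℝ} (hB : 0 ≤ B)
    (hb : ∀ x ξ, ‖k x ξ‖ ^ 2 ≤ B * ((1 + ξ ^ 2) * Real.exp (-(1 + ξ ^ 2) * (x - τ) ^ 2)))
    (φ : 𝓢(ℝ, ℂ)) (hφ : HasCompactSupport (𝓕 φ : 𝓢(ℝ, ℂ))) :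
    ∫⁻ p in Q I, ENNReal.ofReal (‖synth k (𝓕 φ) p‖ ^ 2) ≤
      ENNReal.ofReal (B * Real.sqrt Real.pi * ‖schwL2 (bessel φ)‖ ^ 2) := by
  have h0 := (𝓕 φ : 𝓢(ℝ, ℂ)).continuous
  have h1 := lintegral_slices (I := I) (K := fun x z => synth k (𝓕 φ) (x, z))
    (continuous_synth hk hφ)
  simp only [Prod.mk.eta] at h1
  rw [h1]
  simp only [lintegral_synth hk' hφ]
  calc ∫⁻ x in I, ∫⁻ ξ, ENNReal.ofReal (‖k x ξ * (𝓕 φ : 𝓢(ℝ, ℂ)) ξ‖ ^ 2)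
      ≤ ∫⁻ x, ∫⁻ ξ, ENNReal.ofReal (B * ((1 + ξ ^ 2) * Real.exp (-(1 + ξ ^ 2) * (x - τ) ^ 2)) *
          ‖𝓕 φ ξ‖ ^ 2) := by
        refine (setLIntegral_le_lintegral _ _).trans (lintegral_mono fun x => lintegral_mono
          fun ξ => ENNReal.ofReal_le_ofReal ?_)
        rw [norm_mul, mul_pow]
        exact mul_le_mul_of_nonneg_right (hb x ξ) (by positivity)
    _ = ∫⁻ ξ, ∫⁻ x, ENNReal.ofReal (B * ((1 + ξ ^ 2) * Real.exp (-(1 + ξ ^ 2) * (x - τ) ^ 2)) *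
          ‖𝓕 φ ξ‖ ^ 2) := by
        refine lintegral_lintegral_swap (Continuous.aemeasurable ?_)
        refine ENNReal.continuous_ofReal.comp ?_
        fun_prop
    _ = ∫⁻ ξ, ENNReal.ofReal (B * Real.sqrt Real.pi) *
          ENNReal.ofReal (‖symb ξ‖ ^ 2 * ‖𝓕 φ ξ‖ ^ 2) := by
        refine lintegral_congr fun ξ => ?_
        have hp : 0 < 1 + ξ ^ 2 := by positivity
        have e : ∀ x, ENNReal.ofReal (B * ((1 + ξ ^ 2) * Real.exp (-(1 + ξ ^ 2) * (x - τ) ^ 2)) *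
          ‖𝓕 φ ξ‖ ^ 2) = ENNReal.ofReal (B * (1 + ξ ^ 2) * ‖𝓕 φ ξ‖ ^ 2) *
            ENNReal.ofReal (Real.exp (-(1 + ξ ^ 2) * (x - τ) ^ 2)) := by
          intro x
          rw [← ENNReal.ofReal_mul (by positivity)]
          congr 1
          ring
        simp only [e]
        -- The Gaussian integrates in `x` to `√π (1 + ξ²)^{-1/2}`, so one factor `1 + ξ²` becomes
        -- `(1 + ξ²)^{1/2} = |symb ξ|²`.
        rw [lintegral_const_mul' _ _ ENNReal.ofReal_ne_top, lintegral_gaussian hp,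
          ← ENNReal.ofReal_mul (by positivity), ← ENNReal.ofReal_mul (by positivity), symb_sq,
          ← Real.sqrt_eq_rpow, Real.sqrt_div Real.pi_pos.le]
        congr 1
        have h2 := Real.sq_sqrt hp.le
        have h3 := (Real.sqrt_pos.2 hp).ne'
        field_simp
        rw [h2]
        ring
    _ = _ := by
        rw [lintegral_const_mul' _ _ ENNReal.ofReal_ne_top, ← ofReal_norm_schwL2_bessel,
          ← ENNReal.ofReal_mul (by positivity)]

section Lift

variable (χ : ℝ → ℝ) (τ : ℝ)

/-- The Fourier multiplier of the lift. -/
def liftKernel (x ξ : ℝ) : ℂ := ((χ x * Real.exp (-(1 + ξ ^ 2) * (x - τ) ^ 2) : ℝ) : ℂ)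

/-- The derivative of `liftKernel` with respect to the first variable. -/
def liftKernelFst (x ξ : ℝ) : ℂ :=
  ((deriv χ x * Real.exp (-(1 + ξ ^ 2) * (x - τ) ^ 2) +
    χ x * (Real.exp (-(1 + ξ ^ 2) * (x - τ) ^ 2) * (-(1 + ξ ^ 2) * (2 * (x - τ)))) : ℝ) : ℂ)

/-- The multiplier of the derivative of the lift with respect to the second variable. -/
def liftKernelSnd (x ξ : ℝ) : ℂ := (2 * Real.pi * Complex.I * ξ) * liftKernel χ τ x ξ

variable {χ τ}

theorem hasDerivAt_liftKernel (hχ : Differentiable ℝ χ) (x ξ : ℝ) :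
    HasDerivAt (fun x => liftKernel χ τ x ξ) (liftKernelFst χ τ x ξ) x := by
  have h1 : HasDerivAt (fun x => -(1 + ξ ^ 2) * (x - τ) ^ 2) (-(1 + ξ ^ 2) * (2 * (x - τ))) x := by
    have := (((hasDerivAt_id x).sub_const τ).pow 2).const_mul (-(1 + ξ ^ 2))
    simpa using this
  exact (((hχ x).hasDerivAt).mul h1.exp).ofReal_comp

/-- Squaring produces two Gaussian factors. One absorbs the polynomial, since `b s² exp(-b s²) ≤ 1`;
the other is kept for the integration in `x`. -/
theorem exp_half_le {b s : ℝ} (hb : 1 ≤ b) :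
    Real.exp (-b * s ^ 2) ^ 2 ≤ b * Real.exp (-b * s ^ 2) ∧
      (b * s) ^ 2 * Real.exp (-b * s ^ 2) ^ 2 ≤ b * Real.exp (-b * s ^ 2) := by
  have h1 : Real.exp (-b * s ^ 2) ≤ 1 := Real.exp_le_one_iff.2 (by nlinarith [sq_nonneg s])
  have h0 := Real.exp_pos (-b * s ^ 2)
  constructor
  · nlinarith
  · have h2 : b * s ^ 2 * Real.exp (-b * s ^ 2) ≤ 1 := by
      have h3 : b * s ^ 2 ≤ Real.exp (b * s ^ 2) := by linarith [Real.add_one_le_exp (b * s ^ 2)]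
      calc _ ≤ Real.exp (b * s ^ 2) * Real.exp (-b * s ^ 2) := by gcongr
        _ = 1 := by rw [← Real.exp_add]; simp
    calc _ = b * Real.exp (-b * s ^ 2) * (b * s ^ 2 * Real.exp (-b * s ^ 2)) := by ring
      _ ≤ b * Real.exp (-b * s ^ 2) * 1 := by gcongr
      _ = _ := mul_one _

/-- One constant serves the lift and its two derivatives: `64` dominates `4π²` because `π ≤ 4`, and
the other two cases need less. -/
theorem liftKernel_bound {A : ℝ} (hA : ∀ x, |χ x| ≤ A) (hA' : ∀ x, |deriv χ x| ≤ A) (x ξ : ℝ) :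
    ‖liftKernel χ τ x ξ‖ ^ 2 ≤
        64 * A ^ 2 * ((1 + ξ ^ 2) * Real.exp (-(1 + ξ ^ 2) * (x - τ) ^ 2)) ∧
      ‖liftKernelFst χ τ x ξ‖ ^ 2 ≤
        64 * A ^ 2 * ((1 + ξ ^ 2) * Real.exp (-(1 + ξ ^ 2) * (x - τ) ^ 2)) ∧
      ‖liftKernelSnd χ τ x ξ‖ ^ 2 ≤
        64 * A ^ 2 * ((1 + ξ ^ 2) * Real.exp (-(1 + ξ ^ 2) * (x - τ) ^ 2)) := by
  have hb : 1 ≤ 1 + ξ ^ 2 := by nlinarith [sq_nonneg ξ]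
  obtain ⟨h1, h2⟩ := exp_half_le (s := x - τ) hb
  have hc : (χ x) ^ 2 ≤ A ^ 2 := sq_le_sq' (abs_le.1 (hA x)).1 (abs_le.1 (hA x)).2
  have hc' : (deriv χ x) ^ 2 ≤ A ^ 2 := sq_le_sq' (abs_le.1 (hA' x)).1 (abs_le.1 (hA' x)).2
  set e := Real.exp (-(1 + ξ ^ 2) * (x - τ) ^ 2) with he
  have he0 : 0 < e := Real.exp_pos _
  have h3 : (χ x * e) ^ 2 ≤ A ^ 2 * e ^ 2 := by rw [mul_pow]; gcongr
  have hAA := sq_nonneg A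
  have hbe : 0 ≤ A ^ 2 * ((1 + ξ ^ 2) * e) := by positivity
  refine ⟨?_, ?_, ?_⟩
  · rw [liftKernel, Complex.norm_real, Real.norm_eq_abs, sq_abs, ← he]
    refine h3.trans ?_
    calc A ^ 2 * e ^ 2 ≤ A ^ 2 * ((1 + ξ ^ 2) * e) := by gcongr
      _ ≤ _ := by linarith
  · rw [liftKernelFst, Complex.norm_real, Real.norm_eq_abs, sq_abs, ← he]
    have h4 : (deriv χ x * e) ^ 2 ≤ A ^ 2 * ((1 + ξ ^ 2) * e) := by
      rw [mul_pow]
      gcongr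
    have h5 : (χ x * (e * (-(1 + ξ ^ 2) * (2 * (x - τ))))) ^ 2 ≤
        4 * (A ^ 2 * ((1 + ξ ^ 2) * e)) := by
      calc _ = 4 * (χ x ^ 2 * (((1 + ξ ^ 2) * (x - τ)) ^ 2 * e ^ 2)) := by ring
        _ ≤ 4 * (A ^ 2 * ((1 + ξ ^ 2) * e)) := by gcongr
    nlinarith [sq_nonneg (deriv χ x * e - χ x * (e * (-(1 + ξ ^ 2) * (2 * (x - τ)))))]
  · rw [liftKernelSnd, liftKernel, norm_mul, Complex.norm_real, Real.norm_eq_abs, mul_pow, sq_abs,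
      ← he]
    have h4 : ‖(2 * Real.pi * Complex.I * ξ : ℂ)‖ ^ 2 = 4 * Real.pi ^ 2 * ξ ^ 2 := by
      simp [mul_pow, abs_of_pos Real.pi_pos]
      norm_num
    have h5 : 4 * Real.pi ^ 2 * ξ ^ 2 ≤ 64 * (1 + ξ ^ 2) := by
      nlinarith [Real.pi_le_four, Real.pi_pos, mul_nonneg (sq_nonneg ξ) Real.pi_pos.le,
        mul_le_mul_of_nonneg_left (show Real.pi ^ 2 ≤ 16 by nlinarith [Real.pi_le_four, Real.pi_pos])
          (sq_nonneg ξ)]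
    have h6 : e ^ 2 ≤ e := by
      have : e ≤ 1 := Real.exp_le_one_iff.2 (by nlinarith [sq_nonneg (x - τ)])
      nlinarith
    rw [h4]
    calc 4 * Real.pi ^ 2 * ξ ^ 2 * (χ x * e) ^ 2 ≤ 64 * (1 + ξ ^ 2) * (A ^ 2 * e) := by
          refine mul_le_mul h5 (h3.trans ?_) (by positivity) (by positivity)
          gcongr
      _ = _ := by ring

theorem liftKernel_regular (hχ : ContDiff ℝ ∞ χ) :
    (Continuous (Function.uncurry (liftKernel χ τ)) ∧ ∀ x, ContDiff ℝ ∞ (liftKernel χ τ x)) ∧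
    (Continuous (Function.uncurry (liftKernelFst χ τ)) ∧
      ∀ x, ContDiff ℝ ∞ (liftKernelFst χ τ x)) ∧
    (Continuous (Function.uncurry (liftKernelSnd χ τ)) ∧
      ∀ x, ContDiff ℝ ∞ (liftKernelSnd χ τ x)) := by
  have h1 := hχ.continuous
  have h2 : Continuous (deriv χ) := hχ.continuous_deriv (by simp)
  have hr : ContDiff ℝ ∞ ((↑) : ℝ → ℂ) := Complex.ofRealCLM.contDiff
  have hc : Continuous (Function.uncurry (liftKernel χ τ)) := by
    unfold Function.uncurry liftKernel
    fun_prop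
  have hc' : ∀ x, ContDiff ℝ ∞ (liftKernel χ τ x) := fun x =>
    hr.comp (f := fun ξ : ℝ => χ x * Real.exp (-(1 + ξ ^ 2) * (x - τ) ^ 2)) (by fun_prop)
  refine ⟨⟨hc, hc'⟩, ⟨?_, fun x => ?_⟩, ?_, fun x => ?_⟩
  · unfold Function.uncurry liftKernelFst
    fun_prop
  · exact hr.comp (f := fun ξ : ℝ => deriv χ x * Real.exp (-(1 + ξ ^ 2) * (x - τ) ^ 2) +
      χ x * (Real.exp (-(1 + ξ ^ 2) * (x - τ) ^ 2) * (-(1 + ξ ^ 2) * (2 * (x - τ)))))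
      (by fun_prop)
  · unfold Function.uncurry at *
    unfold liftKernelSnd
    fun_prop
  · exact (contDiff_const.mul hr).mul (hc' x)

end Lift

theorem hasLineDerivAt_plane {v : ℝ × ℝ → ℂ} {G : ℝ × ℝ → C2}
    (h1 : ∀ x z, HasDerivAt (fun x => v (x, z)) (G (x, z) 0) x)
    (h2 : ∀ x z, HasDerivAt (fun z => v (x, z)) (G (x, z) 1) z) (j : Fin 2) (p : ℝ × ℝ) :
    HasLineDerivAt ℝ v (G p j) p (planeFrame j) := by
  obtain ⟨x, z⟩ := p
  fin_cases j
  · have := (h1 (x + 0) z).comp_const_add x 0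
    simpa [HasLineDerivAt, planeFrame] using this
  · have := (h2 x (z + 0)).comp_const_add z 0
    simpa [HasLineDerivAt, planeFrame] using this

/-- `V ∈ H¹(Q)` is given by the continuously differentiable function `v` with gradient `G`. -/
structure IsC1Rep {I : Set ℝ} (V : H1Q I) (v : ℝ × ℝ → ℂ) (G : ℝ × ℝ → C2) : Prop where
  continuous : Continuous v
  continuous_grad : Continuous G
  hasLineDerivAt : ∀ j p, HasLineDerivAt ℝ v (G p j) p (planeFrame j)
  fst : V.1.fst =ᵐ[volume.restrict (Q I)] v
  snd : V.1.snd =ᵐ[volume.restrict (Q I)] G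

/-- At `x = τ` the multiplier is identically `1`, so the synthesis is Fourier inversion. -/
theorem synth_lift_self {I : Set ℝ} {τ : frontier I} {χ : ℝ → ℝ} (hχ : IsCutoff I τ χ)
    (φ : 𝓢(ℝ, ℂ)) (z : ℝ) : synth (liftKernel χ τ) (𝓕 φ) (τ, z) = φ z := by
  have e : (𝓕⁻ (𝓕 φ : 𝓢(ℝ, ℂ)) : 𝓢(ℝ, ℂ)) z = φ z := by
    rw [FourierTransform.fourierInv_fourier_eq]
  rw [← e, SchwartzMap.fourierInv_coe, Real.fourierInv_eq']
  simp only [synth, smul_eq_mul, liftKernel, sub_self, hχ.self]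
  refine integral_congr_ae (Filter.Eventually.of_forall fun ξ => ?_)
  simp only [RCLike.inner_apply, conj_trivial]
  norm_num
  left
  congr 1
  ring

theorem synth_lift_other {I : Set ℝ} {τ : frontier I} {χ : ℝ → ℝ} (hχ : IsCutoff I τ χ)
    (η : 𝓢(ℝ, ℂ)) {τ' : frontier I} (h : τ' ≠ τ) (z : ℝ) :
    synth (liftKernel χ τ) η (τ', z) = 0 := by
  simp [synth, liftKernel, hχ.other τ' h]

theorem synth_add {k : ℝ → ℝ → ℂ} (hk : Continuous (Function.uncurry k)) {η ζ : 𝓢(ℝ, ℂ)}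
    (hη : HasCompactSupport η) (hζ : HasCompactSupport ζ) (p : ℝ × ℝ) :
    synth k (η + ζ) p = synth k η p + synth k ζ p := by
  have h2 : Continuous (k p.1) := hk.comp (by fun_prop : Continuous fun ξ => (p.1, ξ))
  have key : ∀ {θ : 𝓢(ℝ, ℂ)}, HasCompactSupport θ → Integrable fun ξ =>
      Complex.exp ((2 * Real.pi * p.2 * ξ : ℝ) * Complex.I) * (k p.1 ξ * θ ξ) := fun {θ} h =>
    Continuous.integrable_of_hasCompactSupport (by have := θ.continuous; fun_prop)
      h.mul_left.mul_left
  rw [synth, synth, synth, ← integral_add (key hη) (key hζ)]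
  refine integral_congr_ae (Filter.Eventually.of_forall fun ξ => ?_)
  simp only [add_apply]
  ring

theorem synth_smul (k : ℝ → ℝ → ℂ) (c : ℂ) (η : 𝓢(ℝ, ℂ)) (p : ℝ × ℝ) :
    synth k (c • η) p = c * synth k η p := by
  rw [synth, synth, ← integral_const_mul]
  refine integral_congr_ae (Filter.Eventually.of_forall fun ξ => ?_)
  simp only [smul_apply, smul_eq_mul]
  ring

/-- Every Schwartz function with band limited Fourier transform is the trace on `x = τ` of
a function of `H¹(Q)`, which vanishes on the other end point. -/
theorem exists_lift {I : Set ℝ} (hf : (frontier I).Finite) (τ : frontier I) :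
    ∃ χ, IsCutoff I τ χ ∧ ∃ C : ℝ, ∀ φ : 𝓢(ℝ, ℂ), HasCompactSupport (𝓕 φ : 𝓢(ℝ, ℂ)) →
      ∃ (V : H1Q I) (G : ℝ × ℝ → C2), IsC1Rep V (synth (liftKernel χ τ) (𝓕 φ)) G ∧
        ‖V‖ ≤ C * ‖hhalfElem φ‖ := by
  obtain ⟨χ, hχ⟩ := exists_cutoff hf τ
  obtain ⟨A, hA0, hA, hA'⟩ := exists_cutoff_bound hχ
  set D : ℝ := 64 * A ^ 2 * Real.sqrt Real.pi with hD
  -- The squared norm is the sum of three terms, for the function and its two derivatives, each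
  -- bounded by `D` times the squared `L²` norm of `bessel φ`.
  refine ⟨χ, hχ, Real.sqrt (3 * D), fun φ hφ => ?_⟩
  obtain ⟨⟨c1, s1⟩, ⟨c2, s2⟩, c3, s3⟩ := liftKernel_regular (τ := (τ : ℝ)) hχ.contDiff
  have hb := liftKernel_bound (τ := (τ : ℝ)) hA hA'
  have l1 := lintegral_synth_le (I := I) c1 s1 (B := 64 * A ^ 2) (by positivity)
    (fun x ξ => (hb x ξ).1) φ hφ
  have l2 := lintegral_synth_le (I := I) c2 s2 (B := 64 * A ^ 2) (by positivity)
    (fun x ξ => (hb x ξ).2.1) φ hφ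
  have l3 := lintegral_synth_le (I := I) c3 s3 (B := 64 * A ^ 2) (by positivity)
    (fun x ξ => (hb x ξ).2.2) φ hφ
  set v := synth (liftKernel χ τ) (𝓕 φ) with hv
  set v1 := synth (liftKernelFst χ τ) (𝓕 φ) with hv1
  set v2 := synth (liftKernelSnd χ τ) (𝓕 φ) with hv2
  have cv : Continuous v := continuous_synth c1 hφ
  have cv1 : Continuous v1 := continuous_synth c2 hφ
  have cv2 : Continuous v2 := continuous_synth c3 hφ
  let G : ℝ × ℝ → C2 := fun p => WithLp.toLp 2 ![v1 p, v2 p]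
  have cG : Continuous G := (PiLp.continuous_toLp 2 _).comp (continuous_pi fun j => by
    fin_cases j
    exacts [cv1, cv2])
  have nG : ∫⁻ p in Q I, ENNReal.ofReal (‖G p‖ ^ 2) =
      (∫⁻ p in Q I, ENNReal.ofReal (‖v1 p‖ ^ 2)) + ∫⁻ p in Q I, ENNReal.ofReal (‖v2 p‖ ^ 2) := by
    have hm : Measurable fun p => ENNReal.ofReal (‖v1 p‖ ^ 2) :=
      (ENNReal.continuous_ofReal.comp (cv1.norm.pow 2)).measurable
    rw [← lintegral_add_left hm]
    refine lintegral_congr fun p => ?_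
    rw [EuclideanSpace.norm_sq_eq, Fin.sum_univ_two,
      ENNReal.ofReal_add (by positivity) (by positivity)]
    rfl
  have m1 : MemLp v 2 (volume.restrict (Q I)) := memLp_two_of_lintegral cv.aestronglyMeasurable
    (ne_top_of_le_ne_top ENNReal.ofReal_ne_top l1)
  have m2 : MemLp G 2 (volume.restrict (Q I)) := memLp_two_of_lintegral cG.aestronglyMeasurable
    (by
      rw [nG]
      exact ne_top_of_le_ne_top (ENNReal.add_ne_top.2 ⟨ENNReal.ofReal_ne_top,
        ENNReal.ofReal_ne_top⟩) (add_le_add l2 l3))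
  have hl := hasLineDerivAt_plane (v := v) (G := G)
    (fun x z => hasDerivAt_synth_fst c1 c2
      (hasDerivAt_liftKernel (hχ.contDiff.differentiable (by simp))) hφ x z)
    (fun x z => hasDerivAt_synth_snd c1 hφ x z)
  refine ⟨⟨WithLp.toLp 2 (m1.toLp, m2.toLp),
    (isWeakGrad_of_hasLineDerivAt (Q I) cv cG hl).congr m1.coeFn_toLp.symm m2.coeFn_toLp.symm⟩,
    G, ⟨cv, cG, hl, m1.coeFn_toLp, m2.coeFn_toLp⟩, ?_⟩
  · refine le_trans ?_ (mul_le_mul_of_nonneg_left (norm_bessel_le_hhalfElem φ)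
      (Real.sqrt_nonneg _))
    refine (abs_le_of_sq_le_sq' ?_ (by positivity)).2
    rw [mul_pow, Real.sq_sqrt (by positivity), ← ENNReal.ofReal_le_ofReal_iff (by positivity)]
    change ENNReal.ofReal (‖(WithLp.toLp 2 (m1.toLp, m2.toLp) :
      WithLp 2 (L2 (Q I) ℂ × L2 (Q I) C2))‖ ^ 2) ≤ _
    rw [ofReal_norm_prod_sq]
    change ENNReal.ofReal (‖m1.toLp‖ ^ 2) + ENNReal.ofReal (‖m2.toLp‖ ^ 2) ≤ _
    rw [norm_toLp_two_sq, norm_toLp_two_sq, nG]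
    refine (add_le_add l1 (add_le_add l2 l3)).trans (le_of_eq ?_)
    rw [← ENNReal.ofReal_add (by positivity) (by positivity),
      ← ENNReal.ofReal_add (by positivity) (by positivity)]
    congr 1
    rw [hD]
    ring

/-! ### The Green formula on `Q` for regular functions -/

theorem IsC1Rep.hasDerivAt_fst {I : Set ℝ} {V : H1Q I} {v : ℝ × ℝ → ℂ} {G : ℝ × ℝ → C2}
    (h : IsC1Rep V v G) (x z : ℝ) : HasDerivAt (fun x => v (x, z)) (G (x, z) 0) x := by
  have h1 := h.hasLineDerivAt 0 (x, z)
  unfold HasLineDerivAt at h1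
  rw [← sub_self x] at h1
  have := h1.comp_sub_const x x
  simpa [planeFrame] using this

theorem IsC1Rep.hasDerivAt_snd {I : Set ℝ} {V : H1Q I} {v : ℝ × ℝ → ℂ} {G : ℝ × ℝ → C2}
    (h : IsC1Rep V v G) (x z : ℝ) : HasDerivAt (fun z => v (x, z)) (G (x, z) 1) z := by
  have h1 := h.hasLineDerivAt 1 (x, z)
  unfold HasLineDerivAt at h1
  rw [← sub_self z] at h1
  have := h1.comp_sub_const z z
  simpa [planeFrame] using this

theorem hasDerivAt_mul_conj {f g : ℝ → ℂ} {f' g' : ℂ} {x : ℝ} (hf : HasDerivAt f f' x)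
    (hg : HasDerivAt g g' x) :
    HasDerivAt (fun x => f x * conj (g x)) (f' * conj (g x) + f x * conj g') x := hf.mul hg.star

theorem hasDerivAt_coord {f : ℝ → C2} {f' : C2} {x : ℝ} (hf : HasDerivAt f f' x) (j : Fin 2) :
    HasDerivAt (fun x => f x j) (f' j) x := (coord j).hasFDerivAt.comp_hasDerivAt x hf

/-- On each vertical line the `z`-derivative integrates to zero, by the compact support of `f`. The
`x`-derivative is that of `x ↦ ∫ f₀ conj v dz`, to which the fundamental theorem of calculus on `I`
applies. Only `f` needs compact support, so `v` may be a lift. -/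
theorem green_C1 {I : Set ℝ} (hI : I.OrdConnected) (hI_int : (interior I).Nonempty)
    (hI_ne : I ≠ univ) [Fintype (frontier I)] {V : H1Q I} {v : ℝ × ℝ → ℂ} {G : ℝ × ℝ → C2}
    (hV : IsC1Rep V v G) {f : ℝ × ℝ → C2} (hf : IsSmoothC f) :
    pairing (divElem (Q I) planeFrame hf).1 V.1 =
      ∑ τ : frontier I, (outward I τ : ℂ) * ∫ z, f (τ, z) 0 * conj (v (τ, z)) := by
  have cv := hV.continuous
  have cG : ∀ j, Continuous fun p => G p j := fun j =>
    (coord j).continuous.comp hV.continuous_grad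
  have cf : ∀ j, Continuous fun p => f p j := fun j => (coord j).continuous.comp hf.continuous
  have cf' : ∀ i j, Continuous fun p => fderiv ℝ f p (planeFrame i) j := fun i j =>
    (coord j).continuous.comp (hf.fderiv_apply (planeFrame i)).continuous
  let D : Fin 2 → ℝ × ℝ → ℂ := fun j p =>
    fderiv ℝ f p (planeFrame j) j * conj (v p) + f p j * conj (G p j)
  have cD : ∀ j, Continuous (D j) := fun j =>
    ((cf' j j).mul (Complex.continuous_conj.comp cv)).add
      ((cf j).mul (Complex.continuous_conj.comp (cG j)))
  have f0 : ∀ {p} j, p ∉ tsupport f → f p j = 0 := fun {p} j hp => by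
    rw [image_eq_zero_of_notMem_tsupport hp, PiLp.zero_apply]
  have f0' : ∀ {p} i j, p ∉ tsupport f → fderiv ℝ f p (planeFrame i) j = 0 := fun {p} i j hp => by
    rw [image_eq_zero_of_notMem_tsupport (f := fderiv ℝ f)
      fun hm => hp (tsupport_fderiv_subset ℝ hm)]
    simp
  have D0 : ∀ {p} j, p ∉ tsupport f → D j p = 0 := fun {p} j hp => by
    simp [D, f0 j hp, f0' j j hp]
  have cfv : ∀ j, Continuous fun p => f p j * conj (v p) := fun j =>
    (cf j).mul (Complex.continuous_conj.comp cv)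
  have iD : ∀ j, Integrable (D j) := fun j => (cD j).integrable_of_hasCompactSupport
    (HasCompactSupport.intro hf.2.isCompact fun p hp => D0 j hp)
  have e1 : pairing (divElem (Q I) planeFrame hf).1 V.1 = ∫ p in Q I, (D 0 p + D 1 p) := by
    rw [pairing_eq_integral]
    refine integral_congr_ae ?_
    filter_upwards [hV.fst, hV.snd, (hf.memLp (Q I)).coeFn_toLp,
      (hf.memLp_div (Q I) planeFrame).coeFn_toLp] with p h1 h2 h3 h4
    rw [h1, h2]
    change (hf.memLp_div (Q I) planeFrame).toLp _ p * _ +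
      ∑ j, (hf.memLp (Q I)).toLp _ p j * _ = _
    rw [h3, h4]
    simp only [smoothDiv, Fin.sum_univ_two, D]
    ring
  have hd : ∀ j, Integrable (D j) ((volume.restrict I).prod volume) := fun j => by
    rw [← volume_Q]
    exact (iD j).integrableOn
  have c0 : ∀ x, Continuous fun z => D 0 (x, z) := fun x => (cD 0).comp (by fun_prop)
  have c1 : ∀ x, Continuous fun z => D 1 (x, z) := fun x => (cD 1).comp (by fun_prop)
  have z0 : ∀ x, ∀ z ∉ Prod.snd '' tsupport f, (x, z) ∉ tsupport f := fun x z hz hm =>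
    hz ⟨_, hm, rfl⟩
  have hK : IsCompact (Prod.snd '' tsupport f) := hf.2.isCompact.image continuous_snd
  have e2 : ∫ p in Q I, D 1 p = 0 := by
    rw [volume_Q, integral_prod _ (hd 1)]
    refine integral_eq_zero_of_ae (Filter.Eventually.of_forall fun x => ?_)
    refine integral_eq_zero_of_hasDerivAt_of_integrable (f := fun z => f (x, z) 1 * conj (v (x, z)))
      (fun z => ?_) ?_ ?_
    · exact hasDerivAt_mul_conj (hasDerivAt_coord (hf.hasDerivAt_snd x z) 1)
        (hV.hasDerivAt_snd x z)
    · exact (c1 x).integrable_of_hasCompactSupport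
        (HasCompactSupport.intro hK fun z hz => D0 1 (z0 x z hz))
    · exact ((cfv 1).comp (by fun_prop : Continuous fun z : ℝ => (x, z)))
        |>.integrable_of_hasCompactSupport
        (HasCompactSupport.intro hK fun z hz => by simp [f0 1 (z0 x z hz)])
  have e3 : ∫ p in Q I, D 0 p =
      ∑ τ : frontier I, (outward I τ : ℂ) * ∫ z, f (τ, z) 0 * conj (v (τ, z)) := by
    rw [volume_Q, integral_prod _ (hd 0)]
    have cF : Continuous (Function.uncurry fun x z => f (x, z) 0 * conj (v (x, z))) := cfv 0
    have cF' : Continuous (Function.uncurry fun x z => D 0 (x, z)) := cD 0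
    refine integral_deriv_interval hI hI_int hI_ne
      (f := fun x => ∫ z, f (x, z) 0 * conj (v (x, z))) (fun x => ?_) ?_ ?_
    · refine hasDerivAt_param (F' := fun x z => D 0 (x, z)) cF cF' hK
        (fun x z hz => by simp [f0 0 (z0 x z hz)]) (fun x z hz => D0 0 (z0 x z hz))
        (fun x z => ?_) x
      exact hasDerivAt_mul_conj (hasDerivAt_coord (hf.hasDerivAt_fst x z) 0)
        (hV.hasDerivAt_fst x z)
    · exact continuous_param cF' hK fun x z hz => D0 0 (z0 x z hz)
    · refine HasCompactSupport.intro (hf.2.isCompact.image continuous_fst) fun x hx => ?_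
      refine integral_eq_zero_of_ae (Filter.Eventually.of_forall fun z => ?_)
      simp only [Pi.zero_apply]
      rw [f0 0 fun hm => hx ⟨_, hm, rfl⟩, zero_mul]
  rw [e1, integral_add (iD 0).integrableOn (iD 1).integrableOn, e2, e3, add_zero]

theorem IsSmoothC.isC1Rep {I : Set ℝ} {f : ℝ × ℝ → ℂ} (h : IsSmoothC f) :
    IsC1Rep (gradElem (Q I) planeFrame h) f (smoothGrad planeFrame f) where
  continuous := h.continuous
  continuous_grad := (h.grad planeFrame).1
  hasLineDerivAt j p := ((h.1.differentiable (by simp)) p).hasFDerivAt.hasLineDerivAt _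
  fst := (h.memLp (Q I)).coeFn_toLp
  snd := (h.memLp_grad (Q I) planeFrame).coeFn_toLp

/-! ### The trace on `Q` -/

/-- The smooth functions with compact support in the plane. -/
def smoothC : Submodule ℂ (ℝ × ℝ → ℂ) where
  carrier := {f | IsSmoothC f}
  zero_mem' := ⟨contDiff_const, HasCompactSupport.zero⟩
  add_mem' h h' := ⟨h.1.add h'.1, h.2.add h'.2⟩
  smul_mem' c _ h := ⟨contDiff_const.smul h.1, h.2.smul_left (f := fun _ => c)⟩

theorem Hhalf_ext_ae {Φ Ψ : Hhalf} {f : ℝ → ℂ} (h : Φ.1.fst =ᵐ[volume] f)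
    (h' : Ψ.1.fst =ᵐ[volume] f) : Φ = Ψ := Hhalf_ext (Lp.ext (h.trans h'.symm))

theorem gradSpace_ext_ae {E : Type*} [NormedAddCommGroup E] [NormedSpace ℝ E] [MeasureSpace E]
    [BorelSpace E] [FiniteDimensional ℝ E] [(volume : Measure E).IsAddHaarMeasure]
    {U : Set E} (hU : volume.restrict (interior U) = volume.restrict U)
    {d : Fin 2 → E} {V V' : gradSpace U d} {f : E → ℂ} (h : V.1.fst =ᵐ[volume.restrict U] f)
    (h' : V'.1.fst =ᵐ[volume.restrict U] f) : V = V' :=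
  gradSpace_ext hU (Lp.ext (h.trans h'.symm))

theorem coeFn_fst_add {U : Set (ℝ × ℝ)} {d : Fin 2 → ℝ × ℝ} {V V' : gradSpace U d}
    {f f' : ℝ × ℝ → ℂ} (h : V.1.fst =ᵐ[volume.restrict U] f)
    (h' : V'.1.fst =ᵐ[volume.restrict U] f') :
    (V + V').1.fst =ᵐ[volume.restrict U] f + f' :=
  (Lp.coeFn_add _ _).trans (h.add h')

theorem coeFn_fst_smul {U : Set (ℝ × ℝ)} {d : Fin 2 → ℝ × ℝ} (c : ℂ) {V : gradSpace U d}
    {f : ℝ × ℝ → ℂ} (h : V.1.fst =ᵐ[volume.restrict U] f) :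
    (c • V).1.fst =ᵐ[volume.restrict U] c • f :=
  (Lp.coeFn_smul _ _).trans (h.const_smul c)

/-- Smooth functions with compact support as elements of `H¹(Q)`. -/
def smoothH1 {I : Set ℝ} (hI : (frontier I).Finite) : smoothC →ₗ[ℂ] H1Q I where
  toFun f := gradElem (Q I) planeFrame f.2
  map_add' f g := gradSpace_ext_ae (restrict_Q hI) (IsSmoothC.isC1Rep (f + g).2).fst
    (coeFn_fst_add (IsSmoothC.isC1Rep f.2).fst (IsSmoothC.isC1Rep g.2).fst)
  map_smul' c f := gradSpace_ext_ae (restrict_Q hI) (IsSmoothC.isC1Rep (c • f).2).fst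
    (coeFn_fst_smul c (IsSmoothC.isC1Rep f.2).fst)

/-- The slices at `x = τ` of smooth functions with compact support. -/
def smoothTrace (τ : ℝ) : smoothC →ₗ[ℂ] Hhalf where
  toFun f := hhalfElem (sliceS f.2 τ)
  map_add' _ _ := Hhalf_ext_ae (hhalfElem_fst _) ((Lp.coeFn_add _ _).trans
    ((hhalfElem_fst _).add (hhalfElem_fst _)))
  map_smul' c _ := Hhalf_ext_ae (hhalfElem_fst _) ((Lp.coeFn_smul _ _).trans
    ((hhalfElem_fst _).const_smul c))

theorem denseRange_of_inner {E H : Type*} [AddCommGroup E] [Module ℂ E] [NormedAddCommGroup H]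
    [InnerProductSpace ℂ H] [CompleteSpace H] (e : E →ₗ[ℂ] H)
    (h : ∀ V : H, (∀ f, inner ℂ (e f) V = 0) → V = 0) : DenseRange e := by
  have : (LinearMap.range e).topologicalClosure = ⊤ := by
    rw [Submodule.topologicalClosure_eq_top_iff, Submodule.eq_bot_iff]
    exact fun V hV => h V fun f => (Submodule.mem_orthogonal _ _).1 hV _ (LinearMap.mem_range_self e f)
  rw [DenseRange, dense_iff_closure_eq]
  have h2 := congrArg (fun s : Submodule ℂ H => (s : Set H)) this
  simpa only [Submodule.topologicalClosure_coe, LinearMap.coe_range, Submodule.top_coe] using h2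

theorem denseRange_smoothH1 {I : Set ℝ} (hI : I.OrdConnected) (hI_int : (interior I).Nonempty)
    (hf : (frontier I).Finite) : DenseRange (smoothH1 hf) :=
  denseRange_of_inner _ fun V h => H1Q_eq_zero hI hI_int V fun _ hφ => h ⟨_, hφ.ofReal⟩

/-- The trace `H¹(Q) → H^{1/2}(ℝ)` on `x = τ`. -/
def traceQ {I : Set ℝ} (hf : (frontier I).Finite) (τ : ℝ) : H1Q I →L[ℂ] Hhalf :=
  (smoothTrace τ).extendOfNorm (smoothH1 hf)

theorem traceQ_smooth {I : Set ℝ} (hI : I.OrdConnected) (hI_int : (interior I).Nonempty)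
    (hI_ne : I ≠ univ) (hf : (frontier I).Finite) (τ : frontier I) {f : ℝ × ℝ → ℂ}
    (h : IsSmoothC f) :
    traceQ hf τ (gradElem (Q I) planeFrame h) = hhalfElem (sliceS h τ) := by
  obtain ⟨C, -, hC⟩ := exists_trace_bound hI hI_int hI_ne τ
  exact LinearMap.extendOfNorm_eq (denseRange_smoothH1 hI hI_int hf)
    ⟨C, fun f => hC f.1 f.2⟩ (⟨f, h⟩ : smoothC)

theorem integral_mul_conj_eq_inner {f : ℝ → ℂ} (hf : MemLp f 2 volume)
    (g : Lp ℂ 2 (volume : Measure ℝ)) : ∫ z, f z * conj (g z) = inner ℂ g hf.toLp := by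
  rw [inner_toLp_right]
  rfl

/-- The Green formula on `Q` for a smooth vector field. -/
theorem green_smooth {I : Set ℝ} (hI : I.OrdConnected) (hI_int : (interior I).Nonempty)
    (hI_ne : I ≠ univ) (hfr : (frontier I).Finite) [Fintype (frontier I)] (V : H1Q I)
    {f : ℝ × ℝ → C2} (hf : IsSmoothC f) :
    pairing (divElem (Q I) planeFrame hf).1 V.1 =
      ∑ τ : frontier I, (outward I τ : ℂ) * ∫ z, f (τ, z) 0 * conj ((traceQ hfr τ V).1.fst z) := by
  have hm : ∀ τ : ℝ, MemLp (fun z => f (τ, z) 0) 2 volume := fun τ =>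
    ((hf.clm_comp (coord 0)).slice τ).continuous.memLp_of_hasCompactSupport
      ((hf.clm_comp (coord 0)).slice τ).2
  simp only [fun τ => integral_mul_conj_eq_inner (hm τ)]
  refine (denseRange_smoothH1 hI hI_int hfr).induction_on (p := fun V : H1Q I =>
    pairing (divElem (Q I) planeFrame hf).1 V.1 = ∑ τ : frontier I, (outward I τ : ℂ) *
      inner ℂ (traceQ hfr τ V).1.fst ((hm τ).toLp)) V ?_ ?_
  · refine isClosed_eq ((continuous_pairing_right _).comp continuous_subtype_val) ?_
    refine continuous_finsetSum _ fun τ _ => continuous_const.mul ?_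
    refine Continuous.inner ?_ continuous_const
    exact (WithLp.fstL 2 ℂ _ _).continuous.comp
      (continuous_subtype_val.comp (traceQ hfr τ).continuous)
  · intro g
    rw [show smoothH1 hfr g = gradElem (Q I) planeFrame g.2 from rfl,
      green_C1 hI hI_int hI_ne (IsSmoothC.isC1Rep g.2) hf]
    refine Finset.sum_congr rfl fun τ _ => ?_
    rw [traceQ_smooth hI hI_int hI_ne hfr τ g.2, ← integral_mul_conj_eq_inner]
    congr 1
    refine integral_congr_ae ?_
    filter_upwards [hhalfElem_fst (sliceS g.2 τ)] with z hz
    rw [hz]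
    rfl

/-- A pairing with all smooth vector fields determines the traces. -/
theorem traceQ_of_C1 {I : Set ℝ} (hI : I.OrdConnected) (hI_int : (interior I).Nonempty)
    (hI_ne : I ≠ univ) (hfr : (frontier I).Finite) {V : H1Q I} {v : ℝ × ℝ → ℂ} {G : ℝ × ℝ → C2}
    (hV : IsC1Rep V v G) (τ : frontier I) :
    (traceQ hfr τ V).1.fst =ᵐ[volume] fun z => v (τ, z) := by
  classical
  have := hfr.fintype
  obtain ⟨χ, hχ⟩ := exists_cutoff hfr τ
  have cv : Continuous fun z => v (τ, z) := hV.continuous.comp (by fun_prop)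
  have hl : LocallyIntegrable (traceQ hfr τ V).1.fst volume :=
    (Lp.memLp (traceQ hfr τ V).1.fst).locallyIntegrable (by norm_num)
  have h0 : (fun z => (traceQ hfr τ V).1.fst z - v (τ, z)) =ᵐ[volume.restrict univ] 0 := by
    refine ae_eq_zero_of_isTest (by simp) ?_ fun g hg => ?_
    · rw [Measure.restrict_univ]
      exact hl.sub cv.locallyIntegrable
    have hgs := hg.isSmoothC
    have hp : IsSmoothC fun p : ℝ × ℝ => χ p.1 * g p.2 := by
      refine ⟨(hχ.contDiff.comp contDiff_fst).mul (hgs.1.comp contDiff_snd), ?_⟩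
      refine HasCompactSupport.intro (hχ.compact.isCompact.prod hgs.2.isCompact) fun p hp => ?_
      by_contra hne
      refine hp ⟨subset_tsupport _ fun h => hne ?_, subset_tsupport _ fun h => hne ?_⟩
      · rw [h, zero_mul]
      · rw [h, mul_zero]
    -- A lift is not compactly supported, so its trace is not given by the definition of `traceQ`.
    -- The general and the classical Green formulas are compared for the field `χ(x) g(z) e_x`,
    -- which sees only the endpoint `τ`.
    have h1 := green_smooth hI hI_int hI_ne hfr V (hp.ofReal.clm_comp (axis 0))
    rw [green_C1 hI hI_int hI_ne hV (hp.ofReal.clm_comp (axis 0)),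
      Finset.sum_eq_single τ (fun τ' _ h => by simp [hχ.other τ' h]) (by simp),
      Finset.sum_eq_single τ (fun τ' _ h => by simp [hχ.other τ' h]) (by simp)] at h1
    have hne : (outward I τ : ℂ) ≠ 0 := by
      intro h
      have := outward_sq I τ
      rw [Complex.ofReal_eq_zero.1 h] at this
      norm_num at this
    have h2 := mul_left_cancel₀ hne h1
    simp only [axis_apply, hχ.self, one_mul, PiLp.single_apply, if_true] at h2
    rw [Measure.restrict_univ]
    have h3 := congrArg conj h2
    rw [← integral_conj, ← integral_conj] at h3
    simp only [map_mul, Complex.conj_conj, Complex.conj_ofReal] at h3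
    simp only [smul_sub]
    rw [integral_sub]
    · simp only [Complex.real_smul]
      rw [← h3, sub_self]
    · exact hl.integrable_smul_left_of_hasCompactSupport hgs.continuous hgs.2
    · exact cv.locallyIntegrable.integrable_smul_left_of_hasCompactSupport hgs.continuous hgs.2
  rw [Measure.restrict_univ] at h0
  filter_upwards [h0] with z hz
  exact sub_eq_zero.1 hz

/-- The fields that pair to zero with `V` form a closed subspace. Green's formula puts all smooth
fields in it, and these are total by `HdivQ_eq_zero`. -/
theorem pairing_eq_zero_of_traceQ {I : Set ℝ} (hI : I.OrdConnected)
    (hI_int : (interior I).Nonempty) (hI_ne : I ≠ univ) (hfr : (frontier I).Finite) {V : H1Q I}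
    (hV : ∀ τ : frontier I, traceQ hfr τ V = 0) (W : HdivQ I) : pairing W.1 V.1 = 0 := by
  have := hfr.fintype
  let S : Submodule ℂ (HdivQ I) :=
    { carrier := {W | pairing W.1 V.1 = 0}
      zero_mem' := by simp [pairing]
      add_mem' := fun {a b} ha hb => by
        simp only [mem_ofPred_eq, pairing, Submodule.coe_add, WithLp.add_fst, WithLp.add_snd,
          inner_add_right] at *
        linear_combination ha + hb
      smul_mem' := fun c a ha => by
        simp only [mem_ofPred_eq, pairing, Submodule.coe_smul, WithLp.smul_fst, WithLp.smul_snd,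
          inner_smul_right] at *
        linear_combination c * ha }
  have hS : IsClosed (S : Set (HdivQ I)) :=
    isClosed_eq ((continuous_pairing_left _).comp continuous_subtype_val) continuous_const
  have hc : CompleteSpace S := hS.completeSpace_coe
  have : S = ⊤ := by
    rw [← Submodule.orthogonal_eq_bot_iff, Submodule.eq_bot_iff]
    intro W hW
    refine HdivQ_eq_zero hI hI_int W fun φ hφ j => (Submodule.mem_orthogonal _ _).1 hW _ ?_
    change pairing _ _ = 0
    rw [green_smooth hI hI_int hI_ne hfr]
    refine Finset.sum_eq_zero fun τ _ => ?_
    rw [hV τ, integral_eq_zero_of_ae, mul_zero]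
    filter_upwards [Lp.coeFn_zero ℂ 2 (volume : Measure ℝ)] with z hz
    change _ * conj ((0 : Lp ℂ 2 (volume : Measure ℝ)) z) = 0
    rw [hz]
    simp
  have hW : W ∈ S := this ▸ Submodule.mem_top
  exact hW

/-! ### The right inverse of the trace -/

/-- Schwartz functions with compactly supported Fourier transform. -/
def bandLimited : Submodule ℂ 𝓢(ℝ, ℂ) where
  carrier := {φ | HasCompactSupport (𝓕 φ : 𝓢(ℝ, ℂ))}
  zero_mem' := by
    simp only [mem_ofPred_eq, FourierTransform.fourier_zero]
    exact HasCompactSupport.zero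
  add_mem' {φ ψ} h h' := by
    simp only [mem_ofPred_eq, FourierTransform.fourier_add] at *
    exact h.add h'
  smul_mem' c φ h := by
    simp only [mem_ofPred_eq, FourierTransform.fourier_smul] at *
    exact h.smul_left (f := fun _ => c)

/-- Band limited functions as elements of `H^{1/2}(ℝ)`. -/
def bandHhalf : bandLimited →ₗ[ℂ] Hhalf where
  toFun φ := hhalfElem φ.1
  map_add' _ _ := Hhalf_ext_ae (hhalfElem_fst _) ((Lp.coeFn_add _ _).trans
    ((hhalfElem_fst _).add (hhalfElem_fst _)))
  map_smul' c _ := Hhalf_ext_ae (hhalfElem_fst _) ((Lp.coeFn_smul _ _).trans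
    ((hhalfElem_fst _).const_smul c))

theorem denseRange_bandHhalf : DenseRange bandHhalf := by
  intro Φ
  rw [Metric.mem_closure_iff]
  intro ε hε
  obtain ⟨φ, hφ, h⟩ := dense_hhalfElem Φ (half_pos hε)
  refine ⟨_, ⟨⟨φ, hφ⟩, rfl⟩, ?_⟩
  rw [dist_comm, dist_eq_norm]
  exact lt_of_le_of_lt h (half_lt_self hε)

/-- The lift of band limited functions is linear and bounded, and extends by density. On the dense
part `traceQ_of_C1` reads the traces off the explicit synthesis, whose multiplier is `1` at `τ` and
`0` at the other endpoint; both identities are closed conditions. -/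
theorem exists_lift_clm {I : Set ℝ} (hI : I.OrdConnected) (hI_int : (interior I).Nonempty)
    (hI_ne : I ≠ univ) (hfr : (frontier I).Finite) (τ : frontier I) :
    ∃ L : Hhalf →L[ℂ] H1Q I, (∀ Φ, traceQ hfr τ (L Φ) = Φ) ∧
      ∀ τ' : frontier I, τ' ≠ τ → ∀ Φ, traceQ hfr τ' (L Φ) = 0 := by
  obtain ⟨χ, hχ, C, h⟩ := exists_lift hfr τ
  have hk := (liftKernel_regular (τ := (τ : ℝ)) hχ.contDiff).1.1
  -- Linearity survives the choice because an element of `H¹(Q)` is determined by its function, and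
  -- the synthesis is linear in the transform.
  choose V G hV hn using h
  let l : bandLimited →ₗ[ℂ] H1Q I :=
    { toFun := fun φ => V φ.1 φ.2
      map_add' := fun φ ψ => gradSpace_ext_ae (restrict_Q hfr) (hV _ _).fst
        ((coeFn_fst_add (hV _ _).fst (hV _ _).fst).trans (Filter.Eventually.of_forall fun p => by
          simp only [Submodule.coe_add, FourierTransform.fourier_add, Pi.add_apply]
          exact (synth_add hk φ.2 ψ.2 p).symm))
      map_smul' := fun c φ => gradSpace_ext_ae (restrict_Q hfr) (hV _ _).fst
        ((coeFn_fst_smul c (hV _ _).fst).trans (Filter.Eventually.of_forall fun p => by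
          simp only [Submodule.coe_smul, FourierTransform.fourier_smul, Pi.smul_apply]
          exact (synth_smul _ c _ p).symm)) }
  have hL : ∀ φ : bandLimited, l.extendOfNorm bandHhalf (bandHhalf φ) = V φ.1 φ.2 := fun φ =>
    LinearMap.extendOfNorm_eq denseRange_bandHhalf ⟨C, fun φ => hn φ.1 φ.2⟩ φ
  refine ⟨l.extendOfNorm bandHhalf, fun Φ => ?_, fun τ' hτ Φ => ?_⟩
  · refine denseRange_bandHhalf.induction_on (p := fun Φ =>
      traceQ hfr τ (l.extendOfNorm bandHhalf Φ) = Φ) Φ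
      (isClosed_eq (by fun_prop) continuous_id) fun φ => ?_
    rw [hL]
    refine Hhalf_ext_ae (traceQ_of_C1 hI hI_int hI_ne hfr (hV _ _) τ)
      ((hhalfElem_fst φ.1).trans (Filter.Eventually.of_forall fun z => ?_))
    exact (synth_lift_self hχ φ.1 z).symm
  · refine denseRange_bandHhalf.induction_on (p := fun Φ =>
      traceQ hfr τ' (l.extendOfNorm bandHhalf Φ) = 0) Φ
      (isClosed_eq (by fun_prop) continuous_const) fun φ => ?_
    rw [hL]
    refine Hhalf_ext_ae (traceQ_of_C1 hI hI_int hI_ne hfr (hV _ _) τ')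
      ((Lp.coeFn_zero _ _ _).trans (Filter.Eventually.of_forall fun z => ?_))
    exact (synth_lift_other hχ _ hτ z).symm

/-- The pairing of a smooth vector field with a lift. -/
theorem pairing_smooth_lift {I : Set ℝ} (hI : I.OrdConnected) (hI_int : (interior I).Nonempty)
    (hI_ne : I ≠ univ) (hfr : (frontier I).Finite) {τ : frontier I} {L : Hhalf →L[ℂ] H1Q I}
    (hL : ∀ Φ, traceQ hfr τ (L Φ) = Φ)
    (hL' : ∀ τ' : frontier I, τ' ≠ τ → ∀ Φ, traceQ hfr τ' (L Φ) = 0)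
    {f : ℝ × ℝ → C2} (hf : IsSmoothC f) (Φ : Hhalf) :
    pairing (divElem (Q I) planeFrame hf).1 (L Φ).1 =
      (outward I τ : ℂ) * ∫ z, f (τ, z) 0 * conj (Φ.1.fst z) := by
  classical
  have := hfr.fintype
  rw [green_smooth hI hI_int hI_ne hfr, Finset.sum_eq_single τ _ (by simp), hL]
  intro τ' _ h
  rw [hL' τ' h, integral_eq_zero_of_ae, mul_zero]
  filter_upwards [Lp.coeFn_zero ℂ 2 (volume : Measure ℝ)] with z hz
  change _ * conj ((0 : Lp ℂ 2 (volume : Measure ℝ)) z) = 0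
  rw [hz]
  simp

/-! ### Functions on a sheared product as square integrable families of functions -/

theorem ofReal_norm_sub_sq_le {E : Type*} [NormedAddCommGroup E] (a b d : E) :
    ENNReal.ofReal (‖a - d‖ ^ 2) ≤
      2 * (ENNReal.ofReal (‖a - b‖ ^ 2) + ENNReal.ofReal (‖b - d‖ ^ 2)) := by
  rw [← ENNReal.ofReal_add (by positivity) (by positivity), ← ENNReal.ofReal_ofNat,
    ← ENNReal.ofReal_mul (by norm_num)]
  refine ENNReal.ofReal_le_ofReal ?_
  calc ‖a - d‖ ^ 2 ≤ (‖a - b‖ + ‖b - d‖) ^ 2 := by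
        gcongr
        exact norm_sub_le_norm_sub_add_norm_sub a b d
    _ ≤ _ := by nlinarith [sq_nonneg (‖a - b‖ - ‖b - d‖)]

section Shear

variable {S X Y : Type*} [MeasurableSpace S] [MeasurableSpace X] [MeasurableSpace Y]
  {σ : Measure S} {μ : Measure X} {ν : Measure Y} {Sh : S × X → Y} {c : ℝ}

/-- `Sh` identifies the product of `σ` and `μ` with `ν`, up to the factor `c`. -/
structure IsShear (σ : Measure S) (μ : Measure X) (ν : Measure Y) (Sh : S × X → Y) (c : ℝ) :
    Prop where
  measurable : Measurable Sh
  exists_inverse : ∃ Sh' : Y → S × X, Measurable Sh' ∧ ∀ᵐ q ∂(σ.prod μ), Sh' (Sh q) = q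
  pos : 0 < c
  map_eq : (σ.prod μ).map Sh = ENNReal.ofReal c • ν

/-- `v` corresponds to the family `f` of functions on the fibres. -/
def Fib {E : Type*} [NormedAddCommGroup E] (Sh : S × X → Y) (f : Lp (Lp E 2 μ) 2 σ)
    (v : Lp E 2 ν) : Prop :=
  ∀ᵐ s ∂σ, f s =ᵐ[μ] fun x => v (Sh (s, x))

theorem isShear_id (σ : Measure S) (μ : Measure X) : IsShear σ μ (σ.prod μ) id 1 where
  measurable := measurable_id
  exists_inverse := ⟨id, measurable_id, Filter.Eventually.of_forall fun _ => rfl⟩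
  pos := one_pos
  map_eq := by simp

theorem IsShear.qmp (h : IsShear σ μ ν Sh c) :
    Measure.QuasiMeasurePreserving Sh (σ.prod μ) ν :=
  ⟨h.measurable, h.map_eq ▸ Measure.smul_absolutelyContinuous⟩

set_option linter.unusedSectionVars false

variable [IsFiniteMeasure σ] [SFinite μ]

theorem IsShear.ae (h : IsShear σ μ ν Sh c) {P : Y → Prop} (hP : ∀ᵐ y ∂ν, P y) :
    ∀ᵐ s ∂σ, ∀ᵐ x ∂μ, P (Sh (s, x)) := Measure.ae_ae_of_ae_prod (h.qmp.ae hP)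

theorem IsShear.lintegral (h : IsShear σ μ ν Sh c) {g : Y → ℝ≥0∞} (hg : AEMeasurable g ν) :
    ∫⁻ s, ∫⁻ x, g (Sh (s, x)) ∂μ ∂σ = ENNReal.ofReal c * ∫⁻ y, g y ∂ν := by
  rw [← lintegral_prod (fun q => g (Sh q)) (hg.comp_quasiMeasurePreserving h.qmp),
    ← lintegral_map' (f := g) _ h.measurable.aemeasurable, h.map_eq, lintegral_smul_measure]
  · rfl
  · rw [h.map_eq]
    exact hg.smul_measure _

theorem IsShear.integrable {E : Type*} [NormedAddCommGroup E]
    (h : IsShear σ μ ν Sh c) {g : Y → E} (hg : Integrable g ν) :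
    Integrable (fun q => g (Sh q)) (σ.prod μ) := by
  refine (integrable_map_measure (f := Sh) ?_ h.measurable.aemeasurable).1 ?_
  · rw [h.map_eq]
    exact hg.aestronglyMeasurable.smul_measure _
  · rw [h.map_eq]
    exact hg.smul_measure ENNReal.ofReal_ne_top

theorem IsShear.integral {E : Type*} [NormedAddCommGroup E] [NormedSpace ℝ E]
    (h : IsShear σ μ ν Sh c) {g : Y → E} (hg : Integrable g ν) :
    ∫ s, ∫ x, g (Sh (s, x)) ∂μ ∂σ = c • ∫ y, g y ∂ν := by
  rw [← integral_prod (fun q => g (Sh q)) (h.integrable hg),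
    ← integral_map (f := g) h.measurable.aemeasurable, h.map_eq, integral_smul_measure,
    ENNReal.toReal_ofReal h.pos.le]
  rw [h.map_eq]
  exact hg.aestronglyMeasurable.smul_measure _

/-- Tonelli for the norm of the difference; the measurability assumptions on `Y` are what makes
slicewise equality sufficient. -/
theorem IsShear.ae_eq_of_slices {E : Type*} [NormedAddCommGroup E]
    (h : IsShear σ μ ν Sh c) {v w : Y → E} (hv : AEStronglyMeasurable v ν)
    (hw : AEStronglyMeasurable w ν)
    (hvw : ∀ᵐ s ∂σ, (fun x => v (Sh (s, x))) =ᵐ[μ] fun x => w (Sh (s, x))) : v =ᵐ[ν] w := by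
  have hz : ∫⁻ y, ‖v y - w y‖ₑ ∂ν = 0 := by
    have h1 := h.lintegral (hv.sub hw).enorm
    simp only [Pi.sub_apply] at h1
    rw [lintegral_eq_zero_of_ae_eq_zero] at h1
    · exact (mul_eq_zero.1 h1.symm).resolve_left (by simpa using h.pos)
    · filter_upwards [hvw] with s hs
      refine lintegral_eq_zero_of_ae_eq_zero ?_
      filter_upwards [hs] with x hx
      simp [hx]
  have hm : AEMeasurable (fun y => ‖v y - w y‖ₑ) ν := (hv.sub hw).enorm
  rw [lintegral_eq_zero_iff' hm] at hz
  filter_upwards [hz] with y hy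
  simpa [sub_eq_zero] using hy

section Fib

variable {E : Type*} [NormedAddCommGroup E]

theorem Fib.norm_sq (h : IsShear σ μ ν Sh c) {f : Lp (Lp E 2 μ) 2 σ} {v : Lp E 2 ν}
    (hf : Fib Sh f v) : ‖f‖ ^ 2 = c * ‖v‖ ^ 2 := by
  have h1 : ENNReal.ofReal (‖f‖ ^ 2) = ENNReal.ofReal (c * ‖v‖ ^ 2) := by
    rw [ENNReal.ofReal_mul h.pos.le, norm_Lp_two_sq, norm_Lp_two_sq v, ← h.lintegral]
    · refine lintegral_congr_ae ?_
      filter_upwards [hf] with s hs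
      rw [norm_Lp_two_sq]
      refine lintegral_congr_ae ?_
      filter_upwards [hs] with x hx
      rw [hx]
    · exact ((Lp.aestronglyMeasurable v).norm.aemeasurable.pow_const 2).ennreal_ofReal
  rwa [ENNReal.ofReal_eq_ofReal_iff (by positivity) (by have := h.pos; positivity)] at h1

theorem Fib.add (h : IsShear σ μ ν Sh c) {f f' : Lp (Lp E 2 μ) 2 σ} {v v' : Lp E 2 ν}
    (hf : Fib Sh f v) (hf' : Fib Sh f' v') : Fib Sh (f + f') (v + v') := by
  filter_upwards [hf, hf', Lp.coeFn_add f f', h.ae (Lp.coeFn_add v v')] with s h1 h2 h3 h4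
  rw [h3, Pi.add_apply]
  filter_upwards [h1, h2, h4, Lp.coeFn_add (f s) (f' s)] with x h1 h2 h4 h5
  rw [h5, h4, Pi.add_apply, Pi.add_apply, h1, h2]

theorem Fib.sub (h : IsShear σ μ ν Sh c) {f f' : Lp (Lp E 2 μ) 2 σ} {v v' : Lp E 2 ν}
    (hf : Fib Sh f v) (hf' : Fib Sh f' v') : Fib Sh (f - f') (v - v') := by
  filter_upwards [hf, hf', Lp.coeFn_sub f f', h.ae (Lp.coeFn_sub v v')] with s h1 h2 h3 h4
  rw [h3, Pi.sub_apply]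
  filter_upwards [h1, h2, h4, Lp.coeFn_sub (f s) (f' s)] with x h1 h2 h4 h5
  rw [h5, h4, Pi.sub_apply, Pi.sub_apply, h1, h2]

theorem Fib.smul [NormedSpace ℂ E] (h : IsShear σ μ ν Sh c) (a : ℂ) {f : Lp (Lp E 2 μ) 2 σ}
    {v : Lp E 2 ν} (hf : Fib Sh f v) : Fib Sh (a • f) (a • v) := by
  filter_upwards [hf, Lp.coeFn_smul a f, h.ae (Lp.coeFn_smul a v)] with s h1 h3 h4
  rw [h3, Pi.smul_apply]
  filter_upwards [h1, h4, Lp.coeFn_smul a (f s)] with x h1 h4 h5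
  rw [h5, h4, Pi.smul_apply, Pi.smul_apply, h1]

theorem Fib.right_unique (h : IsShear σ μ ν Sh c) {f : Lp (Lp E 2 μ) 2 σ} {v v' : Lp E 2 ν}
    (hf : Fib Sh f v) (hf' : Fib Sh f v') : v = v' := by
  have h1 := (hf.sub h hf').norm_sq h
  rw [sub_self, norm_zero] at h1
  have h2 : ‖v - v'‖ ^ 2 = 0 := by
    have := h.pos
    rcases mul_eq_zero.1 (h1.symm.trans (by norm_num)) with h3 | h3
    · linarith
    · exact h3
  exact sub_eq_zero.1 (norm_eq_zero.1 (pow_eq_zero_iff (by norm_num) |>.1 h2))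

/-- For almost every `s`, the squared distance from `F s` to the slice of `V` is at most `h n s` for
every `n`, hence at most the infimum over `n`. The integral of this infimum is bounded by integrals
tending to `0`, so no subsequence has to be extracted. -/
theorem Fib.of_tendsto {f : ℕ → Lp (Lp E 2 μ) 2 σ} {v : ℕ → Lp E 2 (σ.prod μ)}
    (hf : ∀ n, Fib id (f n) (v n)) {F : Lp (Lp E 2 μ) 2 σ} {V : Lp E 2 (σ.prod μ)}
    (hF : Filter.Tendsto f Filter.atTop (nhds F)) (hV : Filter.Tendsto v Filter.atTop (nhds V)) :
    Fib id F V := by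
  let h : ℕ → S → ℝ≥0∞ := fun n s => 2 * (ENNReal.ofReal (‖(F - f n) s‖ ^ 2) +
    ∫⁻ x, ENNReal.ofReal (‖(v n - V) (s, x)‖ ^ 2) ∂μ)
  have mV : ∀ n, AEMeasurable (fun q => ENNReal.ofReal (‖(v n - V) q‖ ^ 2)) (σ.prod μ) := fun n =>
    ((Lp.aestronglyMeasurable (v n - V)).norm.aemeasurable.pow_const 2).ennreal_ofReal
  have m1 : ∀ n, AEMeasurable (fun s => ENNReal.ofReal (‖(F - f n) s‖ ^ 2)) σ := fun n =>
    ((Lp.aestronglyMeasurable (F - f n)).norm.aemeasurable.pow_const 2).ennreal_ofReal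
  have mh : ∀ n, AEMeasurable (h n) σ := fun n =>
    ((m1 n).add (mV n).lintegral_prod_right').const_mul 2
  have ih : ∀ n, ∫⁻ s, h n s ∂σ = ENNReal.ofReal (2 * (‖F - f n‖ ^ 2 + ‖v n - V‖ ^ 2)) := by
    intro n
    rw [ENNReal.ofReal_mul (by norm_num), ENNReal.ofReal_add (by positivity) (by positivity),
      norm_Lp_two_sq, norm_Lp_two_sq, lintegral_prod _ (mV n), ← lintegral_add_left' (m1 n),
      ENNReal.ofReal_ofNat, ← lintegral_const_mul' _ _ (by norm_num)]
  have hlim : Filter.Tendsto (fun n => ∫⁻ s, h n s ∂σ) Filter.atTop (nhds 0) := by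
    simp only [ih]
    rw [← ENNReal.ofReal_zero]
    refine ENNReal.tendsto_ofReal ?_
    have a1 : Filter.Tendsto (fun n => ‖F - f n‖) Filter.atTop (nhds 0) := by
      have := (tendsto_const_nhds (x := F)).sub hF
      rw [sub_self] at this
      simpa using this.norm
    have a2 : Filter.Tendsto (fun n => ‖v n - V‖) Filter.atTop (nhds 0) := by
      have := hV.sub (tendsto_const_nhds (x := V))
      rw [sub_self] at this
      simpa using this.norm
    simpa using ((a1.pow 2).add (a2.pow 2)).const_mul 2
  have h0 : ∫⁻ s, ⨅ n, h n s ∂σ = 0 :=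
    le_antisymm (ge_of_tendsto' hlim fun n => lintegral_mono fun s => iInf_le _ n) zero_le
  rw [lintegral_eq_zero_iff' (AEMeasurable.iInf mh)] at h0
  have hs1 : ∀ᵐ s ∂σ, ∀ n, f n s =ᵐ[μ] fun x => v n (s, x) := ae_all_iff.2 hf
  have hs2 : ∀ᵐ s ∂σ, ∀ n, (F - f n) s = F s - f n s := ae_all_iff.2 fun n =>
    Lp.coeFn_sub F (f n)
  have hs3 : ∀ᵐ s ∂σ, ∀ n, ∀ᵐ x ∂μ, (v n - V) (s, x) = v n (s, x) - V (s, x) :=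
    ae_all_iff.2 fun n => Measure.ae_ae_of_ae_prod (Lp.coeFn_sub (v n) V)
  have hs4 := (Lp.aestronglyMeasurable V).prodMk_left
  filter_upwards [h0, hs1, hs2, hs3, hs4] with s h0 h1 h2 h3 h4
  have key : ∀ n, ∫⁻ x, ENNReal.ofReal (‖F s x - V (s, x)‖ ^ 2) ∂μ ≤ h n s := by
    intro n
    have m2 : AEMeasurable (fun x => ENNReal.ofReal (‖(F s - f n s) x‖ ^ 2)) μ :=
      ((Lp.aestronglyMeasurable (F s - f n s)).norm.aemeasurable.pow_const 2).ennreal_ofReal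
    simp only [h]
    rw [h2 n, norm_Lp_two_sq, ← lintegral_add_left' m2, ← lintegral_const_mul' _ _ (by norm_num)]
    refine lintegral_mono_ae ?_
    filter_upwards [h1 n, h3 n, Lp.coeFn_sub (F s) (f n s)] with x h1 h3 h5
    rw [h5, h3, Pi.sub_apply, h1]
    exact ofReal_norm_sub_sq_le _ _ _
  have hle : ∫⁻ x, ENNReal.ofReal (‖F s x - V (s, x)‖ ^ 2) ∂μ = 0 := by
    exact le_antisymm ((le_iInf key).trans h0.le) zero_le
  have m3 : AEMeasurable (fun x => ENNReal.ofReal (‖F s x - V (s, x)‖ ^ 2)) μ :=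
    (((Lp.aestronglyMeasurable (F s)).sub h4).norm.aemeasurable.pow_const 2).ennreal_ofReal
  rw [lintegral_eq_zero_iff' m3] at hle
  filter_upwards [hle] with x hx
  simpa [sub_eq_zero] using hx

/-- Induction on `L²` functions: an indicator with value `a` corresponds to `(s, x) ↦ 1_A(s) a(x)`,
and sums are clear. Limits are handled by `Fib.norm_sq`, which makes the correspondence isometric
here and carries Cauchy sequences over. -/
theorem exists_fib_prod [CompleteSpace E] (f : Lp (Lp E 2 μ) 2 σ) : ∃ v : Lp E 2 (σ.prod μ), Fib id f v := by
  have hs := isShear_id σ μ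
  refine Lp.induction (by norm_num) (fun f => ∃ v : Lp E 2 (σ.prod μ), Fib id f v) ?_ ?_ ?_ f
  · intro a A hA hμ
    have h1 : MemLp ((Prod.fst ⁻¹' A).indicator fun q : S × X => a q.2) 2 (σ.prod μ) :=
      ((Lp.memLp a).comp_snd σ).indicator (measurable_fst hA)
    refine ⟨h1.toLp, ?_⟩
    rw [Lp.simpleFunc.coe_indicatorConst]
    filter_upwards [indicatorConstLp_coeFn (p := 2) (hs := hA) (hμs := hμ.ne) (c := a),
      Measure.ae_ae_of_ae_prod h1.coeFn_toLp] with s h2 h3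
    rw [h2]
    by_cases hs : s ∈ A
    · rw [indicator_of_mem hs]
      filter_upwards [h3] with x hx
      rw [id, hx, indicator_of_mem (by exact hs)]
    · rw [indicator_of_notMem hs]
      filter_upwards [h3, Lp.coeFn_zero E 2 μ] with x hx h0
      rw [id, hx, indicator_of_notMem (by exact hs), h0, Pi.zero_apply]
  · rintro f g hf hg - ⟨v, hv⟩ ⟨w, hw⟩
    exact ⟨v + w, hv.add hs hw⟩
  · refine isClosed_of_closure_subset fun F hF => ?_
    obtain ⟨f, hf, hlim⟩ := mem_closure_iff_seq_limit.1 hF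
    choose v hv using hf
    have hc : CauchySeq v := by
      have h1 : ∀ m n, dist (v m) (v n) = dist (f m) (f n) := by
        intro m n
        have h2 := ((hv m).sub hs (hv n)).norm_sq hs
        rw [one_mul] at h2
        rw [dist_eq_norm, dist_eq_norm]
        exact ((sq_eq_sq₀ (norm_nonneg _) (norm_nonneg _)).1 h2).symm
      have h3 := hlim.cauchySeq
      rw [Metric.cauchySeq_iff] at h3 ⊢
      simpa only [h1] using h3
    obtain ⟨V, hV⟩ := cauchySeq_tendsto_of_complete hc
    exact ⟨V, Fib.of_tendsto hv hlim hV⟩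

/-- The function on the product is composed with the measurable inverse of the shear, which maps
null sets correctly because its image measure is a multiple of the product measure. -/
theorem exists_fib [CompleteSpace E] (h : IsShear σ μ ν Sh c) (f : Lp (Lp E 2 μ) 2 σ) : ∃ v : Lp E 2 ν, Fib Sh f v := by
  obtain ⟨g, hg⟩ := exists_fib_prod f
  obtain ⟨Sh', hm, hinv⟩ := h.exists_inverse
  have h1 : ENNReal.ofReal c • ν.map Sh' = σ.prod μ := by
    rw [← Measure.map_smul, ← h.map_eq, Measure.map_map hm h.measurable]
    exact (Measure.map_congr (g := id) hinv).trans Measure.map_id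
  have hc : ENNReal.ofReal c ≠ 0 := by simpa using h.pos
  have h2 : ν.map Sh' ≪ σ.prod μ := by
    rw [← h1]
    exact Measure.absolutelyContinuous_smul hc
  have h3 : MemLp g 2 (ν.map Sh') := by
    have h4 : ν.map Sh' = (ENNReal.ofReal c)⁻¹ • σ.prod μ := by
      rw [← h1, smul_smul, ENNReal.inv_mul_cancel hc ENNReal.ofReal_ne_top, one_smul]
    rw [h4]
    exact (Lp.memLp g).smul_measure (ENNReal.inv_ne_top.2 hc)
  have h5 : MemLp (fun y => g (Sh' y)) 2 ν := h3.comp_of_map hm.aemeasurable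
  refine ⟨h5.toLp, ?_⟩
  filter_upwards [hg, h.ae h5.coeFn_toLp, Measure.ae_ae_of_ae_prod hinv] with s h6 h7 h8
  filter_upwards [h6, h7, h8] with x h6 h7 h8
  rw [h6, h7, h8]
  rfl

variable [NormedSpace ℂ E] [CompleteSpace E]

/-- The function on the sheared product given by a square integrable family on the fibres. -/
def unshear (h : IsShear σ μ ν Sh c) : Lp (Lp E 2 μ) 2 σ →L[ℂ] Lp E 2 ν :=
  LinearMap.mkContinuous
    { toFun := fun f => (exists_fib h f).choose
      map_add' := fun f f' => Fib.right_unique h (exists_fib h (f + f')).choose_spec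
        ((exists_fib h f).choose_spec.add h (exists_fib h f').choose_spec)
      map_smul' := fun a f => Fib.right_unique h (exists_fib h (a • f)).choose_spec
        ((exists_fib h f).choose_spec.smul h a) }
    (Real.sqrt c)⁻¹ fun f => by
      have h1 := (exists_fib h f).choose_spec.norm_sq h
      have h2 := Real.sqrt_pos.2 h.pos
      change ‖(exists_fib h f).choose‖ ≤ _
      rw [inv_mul_eq_div, le_div_iff₀ h2]
      refine (abs_le_of_sq_le_sq' (le_of_eq ?_) (norm_nonneg _)).2
      rw [mul_pow, Real.sq_sqrt h.pos.le, h1, mul_comm]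

theorem fib_unshear (h : IsShear σ μ ν Sh c) (f : Lp (Lp E 2 μ) 2 σ) : Fib Sh f (unshear h f) :=
  (exists_fib h f).choose_spec

end Fib

theorem Fib.inner {E : Type*} [NormedAddCommGroup E] [InnerProductSpace ℂ E]
    (h : IsShear σ μ ν Sh c) {f f' : Lp (Lp E 2 μ) 2 σ} {v v' : Lp E 2 ν}
    (hf : Fib Sh f v) (hf' : Fib Sh f' v') : inner ℂ f f' = (c : ℂ) * inner ℂ v v' := by
  rw [L2.inner_def, L2.inner_def (𝕜 := ℂ) v v']
  have := h.integral (L2.integrable_inner (𝕜 := ℂ) v v')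
  rw [← Complex.real_smul, ← this]
  refine integral_congr_ae ?_
  filter_upwards [hf, hf'] with s h1 h2
  rw [L2.inner_def]
  refine integral_congr_ae ?_
  filter_upwards [h1, h2] with x h1 h2
  rw [h1, h2]

end Shear

/-! ### The geometric shear -/

theorem unitMeasure_eq : unitMeasure = volume.restrict (Ioc (0 : ℝ) 1) :=
  Measure.restrict_congr_set Ioo_ae_eq_Ioc

/-- The intervals `(a, a + 1]` and `(0, 1]` are both fundamental domains for integer translations,
and a function of the fractional part is periodic. Half-open and open unit intervals differ by a
null set. -/
theorem measurePreserving_fract_add (a : ℝ) :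
    MeasurePreserving (fun s : ℝ => Int.fract (a + s)) unitMeasure unitMeasure := by
  refine ⟨by fun_prop, Measure.ext fun A hA => ?_⟩
  have hm : Measurable fun t : ℝ => A.indicator (1 : ℝ → ℝ≥0∞) (Int.fract t) :=
    (measurable_one.indicator hA).comp measurable_fract
  have h1 : (Measure.map (fun s : ℝ => Int.fract (a + s)) unitMeasure) A =
      ∫⁻ s in Ioc (0 : ℝ) 1, A.indicator (1 : ℝ → ℝ≥0∞) (Int.fract (a + s)) := by
    rw [Measure.map_apply (by fun_prop) hA, unitMeasure_eq,
      ← lintegral_indicator_one (measurableSet_preimage (by fun_prop) hA)]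
    rfl
  have h2 : ∫⁻ s in Ioc (0 : ℝ) 1, A.indicator (1 : ℝ → ℝ≥0∞) (Int.fract (a + s)) =
      ∫⁻ t in Ioc a (a + 1), A.indicator (1 : ℝ → ℝ≥0∞) (Int.fract t) := by
    have := (measurePreserving_add_left (volume : Measure ℝ) a).setLIntegral_comp_preimage
      (measurableSet_Ioc (a := a) (b := a + 1)) hm
    rw [← this, preimage_const_add_Ioc, sub_self, add_sub_cancel_left]
  have h3 : ∫⁻ t in Ioc a (a + 1), A.indicator (1 : ℝ → ℝ≥0∞) (Int.fract t) =
      ∫⁻ t in Ioc (0 : ℝ) (0 + 1), A.indicator (1 : ℝ → ℝ≥0∞) (Int.fract t) := by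
    refine (isAddFundamentalDomain_Ioc one_pos a).setLIntegral_eq
      (isAddFundamentalDomain_Ioc one_pos 0) _ fun g t => ?_
    obtain ⟨_, n, rfl⟩ := g
    congr 1
    change Int.fract ((n • (1 : ℝ)) + t) = _
    simp
  rw [h1, h2, h3, zero_add, ← restrict_Ioo_eq_restrict_Ioc, ← lintegral_indicator_one hA]
  refine setLIntegral_congr_fun measurableSet_Ioo fun t ht => ?_
  rw [Int.fract_eq_self.2 ⟨ht.1.le, ht.2⟩]

/-- The shear on the face. -/
def faceMap (θ₁ θ₂ : ℝ) (q : ℝ × ℝ) : ℝ × ℝ := (θ₁ * q.2, Int.fract (θ₂ * q.2 + q.1))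

/-- The shear in the volume. -/
def cutMap (θ₁ θ₂ : ℝ) (q : ℝ × (ℝ × ℝ)) : ℝ × ℝ × ℝ :=
  (q.2.1, θ₁ * q.2.2, Int.fract (θ₂ * q.2.2 + q.1))

/-- For fixed `z` the map in `s` is a rotation of the circle and preserves length; only the dilation
`z ↦ θ₁ z` changes the measure. -/
theorem map_faceMap {θ₁ θ₂ : ℝ} (hθ : θ₁ ≠ 0) :
    (unitMeasure.prod (volume : Measure ℝ)).map (faceMap θ₁ θ₂) =
      ENNReal.ofReal |θ₁⁻¹| • (volume : Measure ℝ).prod unitMeasure := by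
  have h1 : MeasurePreserving (fun p : ℝ × ℝ => (p.1, Int.fract (θ₂ * p.1 + p.2)))
      ((volume : Measure ℝ).prod unitMeasure) ((volume : Measure ℝ).prod unitMeasure) :=
    (MeasurePreserving.id _).skew_product (g := fun z s => Int.fract (θ₂ * z + s)) (by fun_prop)
      (Filter.Eventually.of_forall fun z => (measurePreserving_fract_add (θ₂ * z)).map_eq)
  have h2 := h1.comp (Measure.measurePreserving_swap (μ := unitMeasure) (ν := (volume : Measure ℝ)))
  have h3 : faceMap θ₁ θ₂ = Prod.map (fun z => θ₁ * z) id ∘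
      ((fun p : ℝ × ℝ => (p.1, Int.fract (θ₂ * p.1 + p.2))) ∘ Prod.swap) := rfl
  rw [h3, ← Measure.map_map (by fun_prop) h2.measurable, h2.map_eq,
    ← Measure.map_prod_map _ _ (by fun_prop) measurable_id, Measure.map_id,
    Real.map_volume_mul_left hθ, Measure.prod_smul_left]

theorem fract_shear (a : ℝ) {s : ℝ} (hs : s ∈ Ioo (0 : ℝ) 1) :
    Int.fract (Int.fract (a + s) - a) = s := by
  rw [← Int.self_sub_floor (a + s), show a + s - (⌊a + s⌋ : ℝ) - a = s - (⌊a + s⌋ : ℝ) by ring,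
    Int.fract_sub_intCast, Int.fract_eq_self.2 ⟨hs.1.le, hs.2⟩]

theorem ae_unit_prod {X : Type*} [MeasurableSpace X] (μ : Measure X) [SFinite μ] :
    ∀ᵐ q ∂(unitMeasure.prod μ), q.1 ∈ Ioo (0 : ℝ) 1 :=
  Measure.quasiMeasurePreserving_fst.ae (ae_restrict_mem measurableSet_Ioo)

theorem isShear_faceMap {θ₁ θ₂ : ℝ} (hθ : θ₁ ≠ 0) :
    IsShear unitMeasure (volume : Measure ℝ) (volume.restrict SigmaPer) (faceMap θ₁ θ₂) |θ₁⁻¹| where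
  measurable := by unfold faceMap; fun_prop
  exists_inverse := by
    -- Here `z` is recovered as `y₁ / θ₁` and `s` as the fractional part of `y₂ - θ₂ z`.
    refine ⟨fun y => (Int.fract (y.2 - θ₂ * (y.1 / θ₁)), y.1 / θ₁), by fun_prop, ?_⟩
    filter_upwards [ae_unit_prod (volume : Measure ℝ)] with q hq
    simp only [faceMap, mul_div_cancel_left₀ _ hθ]
    rw [fract_shear _ hq]
  pos := by positivity
  map_eq := by rw [map_faceMap hθ, volume_face]

theorem isShear_cutMap {I : Set ℝ} {θ₁ θ₂ : ℝ} (hθ : θ₁ ≠ 0) :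
    IsShear unitMeasure ((volume : Measure (ℝ × ℝ)).restrict (Q I))
      (volume.restrict (OmegaPer I)) (cutMap θ₁ θ₂) |θ₁⁻¹| where
  measurable := by unfold cutMap; fun_prop
  exists_inverse := by
    refine ⟨fun y => (Int.fract (y.2.2 - θ₂ * (y.2.1 / θ₁)), (y.1, y.2.1 / θ₁)), by fun_prop, ?_⟩
    filter_upwards [ae_unit_prod ((volume : Measure (ℝ × ℝ)).restrict (Q I))] with q hq
    simp only [cutMap, mul_div_cancel_left₀ _ hθ]
    rw [fract_shear _ hq]
  pos := by positivity
  map_eq := by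
    have h1 : MeasurePreserving (fun q : ℝ × (ℝ × ℝ) => (q.2.1, (q.1, q.2.2)))
        (unitMeasure.prod ((volume.restrict I).prod (volume : Measure ℝ)))
        ((volume.restrict I).prod (unitMeasure.prod (volume : Measure ℝ))) :=
      (measurePreserving_prodAssoc (volume.restrict I) unitMeasure volume).comp
        ((Measure.measurePreserving_swap.prod (MeasurePreserving.id volume)).comp
          (measurePreserving_prodAssoc unitMeasure (volume.restrict I) volume).symm)
    have h2 : cutMap θ₁ θ₂ = Prod.map id (faceMap θ₁ θ₂) ∘
      fun q : ℝ × (ℝ × ℝ) => (q.2.1, (q.1, q.2.2)) := rfl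
    have h3 : Measurable (faceMap θ₁ θ₂) := by unfold faceMap; fun_prop
    rw [volume_Q, volume_Omega, h2, ← Measure.map_map (measurable_id.prodMap h3) h1.measurable,
      h1.map_eq, ← Measure.map_prod_map _ _ measurable_id h3, Measure.map_id, map_faceMap hθ,
      Measure.prod_smul_right]

theorem interior_Omega (I : Set ℝ) :
    interior (OmegaPer I) = interior I ×ˢ univ ×ˢ Ioo (0 : ℝ) 1 := by
  simp [OmegaPer, interior_prod_eq]

theorem restrict_Omega {I : Set ℝ} (h : (frontier I).Finite) :
    volume.restrict (interior (OmegaPer I)) = volume.restrict (OmegaPer I) := by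
  rw [interior_Omega, show interior I ×ˢ univ ×ˢ Ioo (0 : ℝ) 1 = OmegaPer (interior I) from rfl,
    volume_Omega, volume_Omega, restrict_interval h]

/-! ### Periodic extensions -/

section Periodize

set_option linter.unusedSectionVars false

variable {E F : Type*} [NormedAddCommGroup E] [NormedSpace ℝ E] [NormedAddCommGroup F]
  [NormedSpace ℝ F]

/-- The extension of `f`, periodic in the direction `w`, where `ℓ w = 1`. -/
def periodize (ℓ : E →L[ℝ] ℝ) (w : E) (f : E → F) (y : E) : F := f (y - (⌊ℓ y⌋ : ℝ) • w)

/-- Around a given point at most two translates matter, and both may be added everywhere nearby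
because `f` vanishes outside the open unit strip. This removes the jumps of the floor function, so
the periodisation inherits the smoothness of `f`. -/
theorem periodize_eq {ℓ : E →L[ℝ] ℝ} {w : E} (hw : ℓ w = 1) {f : E → F}
    (hf : ∀ y, ℓ y ∉ Ioo (0 : ℝ) 1 → f y = 0) {y y₀ : E}
    (hy : ℓ y ∈ Ioo ((⌊ℓ y₀⌋ : ℝ) - 1) (⌊ℓ y₀⌋ + 1)) :
    periodize ℓ w f y = f (y - (⌊ℓ y₀⌋ : ℝ) • w) + f (y - ((⌊ℓ y₀⌋ : ℝ) - 1) • w) := by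
  set n := ⌊ℓ y₀⌋ with hn
  have e : ∀ r : ℝ, ℓ (y - r • w) = ℓ y - r := fun r => by simp [hw]
  rcases le_or_gt (n : ℝ) (ℓ y) with h | h
  · have h1 : ⌊ℓ y⌋ = n := Int.floor_eq_iff.2 ⟨h, hy.2⟩
    rw [periodize, h1, hf (y - ((n : ℝ) - 1) • w), add_zero]
    rw [e]
    exact fun h' => by linarith [h'.2]
  · have h1 : ⌊ℓ y⌋ = n - 1 := Int.floor_eq_iff.2 ⟨by push_cast; linarith [hy.1], by
      push_cast; linarith⟩
    rw [periodize, h1, hf (y - (n : ℝ) • w), zero_add]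
    · push_cast
      rfl
    · rw [e]
      exact fun h' => by linarith [h'.1]

theorem eventually_periodize {ℓ : E →L[ℝ] ℝ} {w : E} (hw : ℓ w = 1) {f : E → F}
    (hf : ∀ y, ℓ y ∉ Ioo (0 : ℝ) 1 → f y = 0) (y₀ : E) :
    periodize ℓ w f =ᶠ[nhds y₀]
      fun y => f (y - (⌊ℓ y₀⌋ : ℝ) • w) + f (y - ((⌊ℓ y₀⌋ : ℝ) - 1) • w) := by
  have h1 : ∀ᶠ y in nhds y₀, ℓ y ∈ Ioo ((⌊ℓ y₀⌋ : ℝ) - 1) (⌊ℓ y₀⌋ + 1) :=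
    ℓ.continuous.continuousAt.eventually_mem (Ioo_mem_nhds
      (by linarith [Int.floor_le (ℓ y₀)]) (Int.lt_floor_add_one _))
  filter_upwards [h1] with y hy
  exact periodize_eq hw hf hy

theorem contDiff_periodize {ℓ : E →L[ℝ] ℝ} {w : E} (hw : ℓ w = 1) {f : E → F}
    (hf : ∀ y, ℓ y ∉ Ioo (0 : ℝ) 1 → f y = 0) (h : ContDiff ℝ ∞ f) :
    ContDiff ℝ ∞ (periodize ℓ w f) := by
  rw [contDiff_iff_contDiffAt]
  intro y₀
  refine ContDiffAt.congr_of_eventuallyEq ?_ (eventually_periodize hw hf y₀)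
  exact (h.comp (contDiff_id.sub contDiff_const)).contDiffAt.add
    (h.comp (contDiff_id.sub contDiff_const)).contDiffAt

theorem fderiv_periodize {ℓ : E →L[ℝ] ℝ} {w : E} (hw : ℓ w = 1) {f : E → F}
    (hf : ∀ y ∈ tsupport f, ℓ y ∈ Ioo (0 : ℝ) 1) (h : ContDiff ℝ ∞ f) (y : E) :
    fderiv ℝ (periodize ℓ w f) y = periodize ℓ w (fderiv ℝ f) y := by
  have hf0 : ∀ y, ℓ y ∉ Ioo (0 : ℝ) 1 → f y = 0 := fun y hy =>
    image_eq_zero_of_notMem_tsupport fun hm => hy (hf y hm)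
  have hf1 : ∀ y, ℓ y ∉ Ioo (0 : ℝ) 1 → fderiv ℝ f y = 0 := fun y hy =>
    image_eq_zero_of_notMem_tsupport fun hm => hy (hf y (tsupport_fderiv_subset ℝ hm))
  rw [(eventually_periodize hw hf0 y).fderiv_eq, (eventually_periodize hw hf1 y).eq_of_nhds]
  have hd := h.differentiable (by simp)
  rw [fderiv_fun_add (by fun_prop) (by fun_prop), fderiv_comp_sub, fderiv_comp_sub]

theorem periodize_periodic {ℓ : E →L[ℝ] ℝ} {w : E} (hw : ℓ w = 1) (f : E → F) (y : E) :
    periodize ℓ w f (y + w) = periodize ℓ w f y := by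
  rw [periodize, periodize, map_add, hw, Int.floor_add_one]
  congr 1
  push_cast
  module

end Periodize

/-- The third coordinate. -/
def third : ℝ × ℝ × ℝ →L[ℝ] ℝ :=
  (ContinuousLinearMap.snd ℝ ℝ ℝ).comp (ContinuousLinearMap.snd ℝ ℝ (ℝ × ℝ))

@[simp] theorem third_apply (y : ℝ × ℝ × ℝ) : third y = y.2.2 := rfl

theorem periodize_third {F : Type*} [NormedAddCommGroup F] [NormedSpace ℝ F]
    (f : ℝ × ℝ × ℝ → F) (a b t : ℝ) :
    periodize third (0, 0, 1) f (a, b, t) = f (a, b, Int.fract t) := by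
  simp [periodize, ← Int.self_sub_floor]

/-- The affine immersion of the plane on a leaf. -/
def leaf (θ₁ θ₂ s : ℝ) (p : ℝ × ℝ) : ℝ × ℝ × ℝ := (p.1, θ₁ * p.2, θ₂ * p.2 + s)

theorem cutMap_eq (θ₁ θ₂ s : ℝ) (p : ℝ × ℝ) {F : Type*} [NormedAddCommGroup F] [NormedSpace ℝ F]
    (f : ℝ × ℝ × ℝ → F) :
    f (cutMap θ₁ θ₂ (s, p)) = periodize third (0, 0, 1) f (leaf θ₁ θ₂ s p) := by
  rw [leaf, periodize_third]
  rfl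

theorem contDiff_leaf (θ₁ θ₂ s : ℝ) : ContDiff ℝ ∞ (leaf θ₁ θ₂ s) := by
  unfold leaf
  fun_prop

theorem leaf_add (θ₁ θ₂ s t : ℝ) (p : ℝ × ℝ) (j : Fin 2) :
    leaf θ₁ θ₂ s (p + t • planeFrame j) = leaf θ₁ θ₂ s p + t • cutFrame θ₁ θ₂ j := by
  fin_cases j
  · simp [leaf, planeFrame, cutFrame]
  · refine Prod.ext (by simp [leaf, planeFrame, cutFrame]) (Prod.ext ?_ ?_)
    · simp [leaf, planeFrame, cutFrame]
      ring
    · simp [leaf, planeFrame, cutFrame]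
      ring

theorem fderiv_comp_leaf {F : Type*} [NormedAddCommGroup F] [NormedSpace ℝ F]
    {f : ℝ × ℝ × ℝ → F} (hf : Differentiable ℝ f) (θ₁ θ₂ s : ℝ) (p : ℝ × ℝ) (j : Fin 2) :
    fderiv ℝ (fun p => f (leaf θ₁ θ₂ s p)) p (planeFrame j) =
      fderiv ℝ f (leaf θ₁ θ₂ s p) (cutFrame θ₁ θ₂ j) := by
  have h1 : HasLineDerivAt ℝ (fun p => f (leaf θ₁ θ₂ s p))
      (fderiv ℝ f (leaf θ₁ θ₂ s p) (cutFrame θ₁ θ₂ j)) p (planeFrame j) := by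
    have h2 := (hf (leaf θ₁ θ₂ s p)).hasFDerivAt.hasLineDerivAt (cutFrame θ₁ θ₂ j)
    unfold HasLineDerivAt at h2 ⊢
    simpa only [leaf_add] using h2
  have h3 : DifferentiableAt ℝ (fun p => f (leaf θ₁ θ₂ s p)) p :=
    (hf _).comp p ((contDiff_leaf θ₁ θ₂ s).differentiable (by simp) p)
  exact (h3.hasFDerivAt.hasLineDerivAt (planeFrame j)).unique h1

/-- A test function in `Ω_per`, restricted to a leaf. -/
theorem IsTest.comp_cutMap {I : Set ℝ} {φ : ℝ × ℝ × ℝ → ℝ} (hφ : IsTest (OmegaPer I) φ) {θ₁ θ₂ : ℝ}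
    (hθ : θ₁ ≠ 0) (s : ℝ) : IsTest (Q I) (fun p => φ (cutMap θ₁ θ₂ (s, p))) ∧
      ∀ p j, fderiv ℝ (fun p => φ (cutMap θ₁ θ₂ (s, p))) p (planeFrame j) =
        fderiv ℝ φ (cutMap θ₁ θ₂ (s, p)) (cutFrame θ₁ θ₂ j) := by
  have hw : third (0, 0, 1) = 1 := rfl
  have hs : ∀ y ∈ tsupport φ, third y ∈ Ioo (0 : ℝ) 1 := fun y hy => by
    have := hφ.2.2 hy
    rw [interior_Omega] at this
    exact this.2.2
  have hs0 : ∀ y, third y ∉ Ioo (0 : ℝ) 1 → φ y = 0 := fun y hy =>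
    image_eq_zero_of_notMem_tsupport fun hm => hy (hs y hm)
  have hc := contDiff_periodize hw hs0 hφ.1
  have e : (fun p => φ (cutMap θ₁ θ₂ (s, p))) = fun p => periodize third (0, 0, 1) φ (leaf θ₁ θ₂ s p) :=
    funext fun p => cutMap_eq θ₁ θ₂ s p φ
  -- A leaf winds around in the periodic variable, so compactness of the support on it comes from
  -- the first two coordinates alone.
  have hK : IsCompact ((fun y : ℝ × ℝ × ℝ => (y.1, y.2.1 / θ₁)) '' tsupport φ) :=
    hφ.2.1.isCompact.image (by fun_prop)
  have hz : ∀ p, p ∉ (fun y : ℝ × ℝ × ℝ => (y.1, y.2.1 / θ₁)) '' tsupport φ →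
      φ (cutMap θ₁ θ₂ (s, p)) = 0 := fun p hp =>
    image_eq_zero_of_notMem_tsupport fun hm => hp ⟨_, hm, by simp [cutMap, hθ]⟩
  refine ⟨⟨?_, HasCompactSupport.intro hK hz, ?_⟩, fun p j => ?_⟩
  · rw [e]
    exact hc.comp (contDiff_leaf θ₁ θ₂ s)
  · refine (closure_minimal (fun p hp => ?_) hK.isClosed).trans (image_subset_iff.2 fun y hy => ?_)
    · by_contra h
      exact hp (hz p h)
    · have := hφ.2.2 hy
      rw [interior_Omega] at this
      rw [mem_preimage, interior_Q]
      exact ⟨this.1, mem_univ _⟩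
  · rw [e, fderiv_comp_leaf (hc.differentiable (by simp)), fderiv_periodize hw hs hφ.1,
      cutMap_eq θ₁ θ₂ s p (fderiv ℝ φ)]

/-! ### Families on the leaves -/

section Leafwise

set_option linter.unusedSectionVars false

variable {S X Y : Type*} [MeasurableSpace S] [MeasurableSpace X] [MeasurableSpace Y]
  {σ : Measure S} {μ : Measure X} {ν : Measure Y} {Sh : S × X → Y} {c : ℝ}
  [IsFiniteMeasure σ] [SFinite μ]
  {A : Type*} [NormedAddCommGroup A] [InnerProductSpace ℂ A] [CompleteSpace A]
  {H : Type*} [NormedAddCommGroup H] [InnerProductSpace ℂ H]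
  {H' : Type*} [NormedAddCommGroup H'] [InnerProductSpace ℂ H']

/-- The function on the sheared product, given on the leaves by the images under `P` of a family
of vectors. -/
def leafMap (h : IsShear σ μ ν Sh c) (P : H →L[ℂ] Lp A 2 μ) : Lp H 2 σ →L[ℂ] Lp A 2 ν :=
  (unshear h).comp (P.compLpL 2 σ)

theorem fib_leafMap (h : IsShear σ μ ν Sh c) (P : H →L[ℂ] Lp A 2 μ) (F : Lp H 2 σ) :
    ∀ᵐ s ∂σ, P (F s) =ᵐ[μ] fun x => leafMap h P F (Sh (s, x)) := by
  filter_upwards [fib_unshear h (P.compLpL 2 σ F), P.coeFn_compLpL F] with s h1 h2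
  rwa [← h2]

theorem inner_leafMap (h : IsShear σ μ ν Sh c) (P : H →L[ℂ] Lp A 2 μ) (P' : H' →L[ℂ] Lp A 2 μ)
    (F : Lp H 2 σ) (F' : Lp H' 2 σ) :
    inner ℂ (P.compLpL 2 σ F) (P'.compLpL 2 σ F') =
      (c : ℂ) * inner ℂ (leafMap h P F) (leafMap h P' F') :=
  Fib.inner h (fib_unshear h _) (fib_unshear h _)

end Leafwise

/-! ### Isomorphisms obtained from norm identities. -/

/-- A surjective linear map which is bounded above and below, as an isomorphism. -/
def equivOfBound {M N : Type*} [NormedAddCommGroup M] [NormedSpace ℂ M] [NormedAddCommGroup N]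
    [NormedSpace ℂ N] (T : M →L[ℂ] N) (hs : Function.Surjective T) {C : ℝ}
    (hC : ∀ F, ‖F‖ ≤ C * ‖T F‖) : M ≃L[ℂ] N :=
  let e : M ≃ₗ[ℂ] N := LinearEquiv.ofBijective T.toLinearMap
    ⟨(injective_iff_map_eq_zero _).2 fun F hF => by
      have h1 := hC F
      rw [show T F = 0 from hF, norm_zero, mul_zero] at h1
      exact norm_le_zero_iff.1 h1, hs⟩
  e.toContinuousLinearEquivOfBounds ‖T‖ C (fun F => T.le_opNorm F) fun V => by
    refine (hC _).trans (le_of_eq ?_)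
    exact congrArg (fun W : N => C * ‖W‖) (e.apply_symm_apply V)

theorem prod_two_ext {A B : Type*} {x y : WithLp 2 (A × B)} (h1 : x.fst = y.fst)
    (h2 : x.snd = y.snd) : x = y :=
  WithLp.ofLp_injective 2 (Prod.ext h1 h2)

section EquivPair

variable {M A B : Type*} [NormedAddCommGroup M] [NormedSpace ℂ M] [NormedAddCommGroup A]
  [NormedSpace ℂ A] [NormedAddCommGroup B] [NormedSpace ℂ B]

/-- Two maps, as a map to the product with the `ℓ²` norm. -/
def pairTwo (P : M →L[ℂ] A) (P' : M →L[ℂ] B) : M →L[ℂ] WithLp 2 (A × B) :=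
  ((WithLp.prodContinuousLinearEquiv 2 ℂ A B).symm : (A × B) →L[ℂ] WithLp 2 (A × B)).comp
    (P.prod P')

theorem norm_pairTwo_sq (P : M →L[ℂ] A) (P' : M →L[ℂ] B) (F : M) :
    ‖pairTwo P P' F‖ ^ 2 = ‖P F‖ ^ 2 + ‖P' F‖ ^ 2 := WithLp.prod_norm_sq_eq_of_L2 (pairTwo P P' F)

/-- Used with `P` and `P'` gluing a family and its leafwise derivative: the norm identity gives
injectivity and both bounds, so only surjectivity onto the graph space is left to check. -/
theorem exists_equiv_pair (P : M →L[ℂ] A) (P' : M →L[ℂ] B) {c : ℝ} (hc : 0 ≤ c)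
    (hn : ∀ F, ‖F‖ ^ 2 = c * (‖P F‖ ^ 2 + ‖P' F‖ ^ 2)) (R : Submodule ℂ (WithLp 2 (A × B)))
    (hR : ∀ F, WithLp.toLp 2 (P F, P' F) ∈ R)
    (hs : ∀ V ∈ R, ∃ F, P F = V.fst ∧ P' F = V.snd) :
    ∃ e : M ≃L[ℂ] R, (∀ F, (e F).1.fst = P F ∧ (e F).1.snd = P' F) ∧
      ∀ V, P (e.symm V) = V.1.fst ∧ P' (e.symm V) = V.1.snd := by
  have hT : Function.Surjective ((pairTwo P P').codRestrict R hR) := by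
    rintro ⟨V, hV⟩
    have h0 := hs V hV
    obtain ⟨F, h1, h2⟩ := h0
    have h3 : pairTwo P P' F = V := prod_two_ext h1 h2
    refine ⟨F, ?_⟩
    apply Subtype.ext
    exact h3
  have hC : ∀ F, ‖F‖ ≤ Real.sqrt c * ‖(pairTwo P P').codRestrict R hR F‖ := by
    intro F
    change _ ≤ Real.sqrt c * ‖pairTwo P P' F‖
    refine (abs_le_of_sq_le_sq' (le_of_eq ?_) (by positivity)).2
    rw [mul_pow, Real.sq_sqrt hc, norm_pairTwo_sq, hn]
  let e := equivOfBound (M := M) (N := R) ((pairTwo P P').codRestrict R hR) hT (C := Real.sqrt c) hC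
  refine ⟨e, fun F => ⟨rfl, rfl⟩, fun V => ?_⟩
  have h1 : pairTwo P P' (e.symm V) = V.1 := congrArg Subtype.val (e.apply_symm_apply V)
  exact ⟨congrArg WithLp.fst h1, congrArg WithLp.snd h1⟩

end EquivPair

section InnerComp

variable {S : Type*} [MeasurableSpace S] {σ : Measure S}
  {A : Type*} [NormedAddCommGroup A] [InnerProductSpace ℂ A]
  {H : Type*} [NormedAddCommGroup H] [InnerProductSpace ℂ H]
  {H' : Type*} [NormedAddCommGroup H'] [InnerProductSpace ℂ H']

theorem inner_comp_ae (P : H →L[ℂ] A) (P' : H' →L[ℂ] A) (F : Lp H 2 σ) (F' : Lp H' 2 σ) :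
    (fun s => inner ℂ (P.compLpL 2 σ F s) (P'.compLpL 2 σ F' s)) =ᵐ[σ]
      fun s => inner ℂ (P (F s)) (P' (F' s)) := by
  filter_upwards [P.coeFn_compLpL F, P'.coeFn_compLpL F'] with s h1 h2
  rw [h1, h2]

theorem inner_compLpL (P : H →L[ℂ] A) (P' : H' →L[ℂ] A) (F : Lp H 2 σ) (F' : Lp H' 2 σ) :
    inner ℂ (P.compLpL 2 σ F) (P'.compLpL 2 σ F') = ∫ s, inner ℂ (P (F s)) (P' (F' s)) ∂σ := by
  rw [L2.inner_def]
  exact integral_congr_ae (inner_comp_ae P P' F F')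

theorem integrable_inner_comp (P : H →L[ℂ] A) (P' : H' →L[ℂ] A) (F : Lp H 2 σ)
    (F' : Lp H' 2 σ) : Integrable (fun s => inner ℂ (P (F s)) (P' (F' s))) σ :=
  (L2.integrable_inner _ _).congr (inner_comp_ae P P' F F')

end InnerComp

section LeafInner

variable {S X Y : Type*} [MeasurableSpace S] [MeasurableSpace X] [MeasurableSpace Y]
  {σ : Measure S} {μ : Measure X} {ν : Measure Y} {Sh : S × X → Y} {c : ℝ}
  [IsFiniteMeasure σ] [SFinite μ]
  {A : Type*} [NormedAddCommGroup A] [InnerProductSpace ℂ A] [CompleteSpace A]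
  {B : Type*} [NormedAddCommGroup B] [InnerProductSpace ℂ B] [CompleteSpace B]
  {H : Type*} [NormedAddCommGroup H] [InnerProductSpace ℂ H]
  {H' : Type*} [NormedAddCommGroup H'] [InnerProductSpace ℂ H']

theorem inner_add_inner_leafMap (h : IsShear σ μ ν Sh c) (P : H →L[ℂ] Lp A 2 μ)
    (P' : H →L[ℂ] Lp B 2 μ) (R : H' →L[ℂ] Lp A 2 μ) (R' : H' →L[ℂ] Lp B 2 μ)
    (F : Lp H 2 σ) (G : Lp H' 2 σ) :
    ∫ s, (inner ℂ (P (F s)) (R (G s)) + inner ℂ (P' (F s)) (R' (G s))) ∂σ =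
      (c : ℂ) * (inner ℂ (leafMap h P F) (leafMap h R G) +
        inner ℂ (leafMap h P' F) (leafMap h R' G)) := by
  rw [integral_add (integrable_inner_comp P R F G) (integrable_inner_comp P' R' F G),
    ← inner_compLpL, ← inner_compLpL, inner_leafMap h, inner_leafMap h, mul_add]

/-- The inner product of `H` splits into two `L²` inner products, and the shear scales each of them
by the same factor `c`. -/
theorem norm_sq_leafMap (h : IsShear σ μ ν Sh c) (P : H →L[ℂ] Lp A 2 μ)
    (P' : H →L[ℂ] Lp B 2 μ)
    (hP : ∀ x y : H, inner ℂ x y = inner ℂ (P x) (P y) + inner ℂ (P' x) (P' y)) (F : Lp H 2 σ) :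
    ‖F‖ ^ 2 = c * (‖leafMap h P F‖ ^ 2 + ‖leafMap h P' F‖ ^ 2) := by
  have h1 := inner_add_inner_leafMap h P P' P P' F F
  simp only [← hP] at h1
  rw [← L2.inner_def, inner_self_eq_norm_sq_to_K, inner_self_eq_norm_sq_to_K,
    inner_self_eq_norm_sq_to_K] at h1
  apply Complex.ofReal_injective
  push_cast
  exact h1

end LeafInner

/-! ### The spaces on the leaves -/

variable {I : Set ℝ} {θ₁ θ₂ : ℝ}

/-- `H¹(Q)`, as a type with an opaque norm. -/
def LeafH1 (I : Set ℝ) : Type := H1Q I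

instance : NormedAddCommGroup (LeafH1 I) := inferInstanceAs (NormedAddCommGroup (H1Q I))

instance : InnerProductSpace ℂ (LeafH1 I) := inferInstanceAs (InnerProductSpace ℂ (H1Q I))

instance : CompleteSpace (LeafH1 I) := inferInstanceAs (CompleteSpace (H1Q I))

/-- `LeafH1 I` is `H1Q I`. -/
def LeafH1.equiv (I : Set ℝ) : LeafH1 I ≃L[ℂ] H1Q I := ContinuousLinearEquiv.refl ℂ (H1Q I)

/-- The first component. -/
def LeafH1.fst (I : Set ℝ) : LeafH1 I →L[ℂ] L2 (Q I) ℂ :=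
  (WithLp.fstL 2 ℂ (L2 (Q I) ℂ) (L2 (Q I) C2)).comp
    ((gradSpace (Q I) planeFrame).subtypeL.comp (LeafH1.equiv I : LeafH1 I →L[ℂ] H1Q I))

/-- The second component. -/
def LeafH1.snd (I : Set ℝ) : LeafH1 I →L[ℂ] L2 (Q I) C2 :=
  (WithLp.sndL 2 ℂ (L2 (Q I) ℂ) (L2 (Q I) C2)).comp
    ((gradSpace (Q I) planeFrame).subtypeL.comp (LeafH1.equiv I : LeafH1 I →L[ℂ] H1Q I))

theorem LeafH1.inner_eq (x y : LeafH1 I) : inner ℂ x y =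
    inner ℂ (LeafH1.fst I x) (LeafH1.fst I y) + inner ℂ (LeafH1.snd I x) (LeafH1.snd I y) := rfl

theorem LeafH1.fst_eq (x : LeafH1 I) : LeafH1.fst I x = (LeafH1.equiv I x).1.fst := rfl

/-- `H(div; Q)`, as a type with an opaque norm. -/
def LeafDiv (I : Set ℝ) : Type := HdivQ I

instance : NormedAddCommGroup (LeafDiv I) := inferInstanceAs (NormedAddCommGroup (HdivQ I))

instance : InnerProductSpace ℂ (LeafDiv I) := inferInstanceAs (InnerProductSpace ℂ (HdivQ I))

instance : CompleteSpace (LeafDiv I) := inferInstanceAs (CompleteSpace (HdivQ I))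

/-- `LeafDiv I` is `HdivQ I`. -/
def LeafDiv.equiv (I : Set ℝ) : LeafDiv I ≃L[ℂ] HdivQ I := ContinuousLinearEquiv.refl ℂ (HdivQ I)

/-- The first component. -/
def LeafDiv.fst (I : Set ℝ) : LeafDiv I →L[ℂ] L2 (Q I) C2 :=
  (WithLp.fstL 2 ℂ (L2 (Q I) C2) (L2 (Q I) ℂ)).comp
    ((divSpace (Q I) planeFrame).subtypeL.comp (LeafDiv.equiv I : LeafDiv I →L[ℂ] HdivQ I))

/-- The second component. -/
def LeafDiv.snd (I : Set ℝ) : LeafDiv I →L[ℂ] L2 (Q I) ℂ :=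
  (WithLp.sndL 2 ℂ (L2 (Q I) C2) (L2 (Q I) ℂ)).comp
    ((divSpace (Q I) planeFrame).subtypeL.comp (LeafDiv.equiv I : LeafDiv I →L[ℂ] HdivQ I))

theorem LeafDiv.inner_eq (x y : LeafDiv I) : inner ℂ x y =
    inner ℂ (LeafDiv.fst I x) (LeafDiv.fst I y) + inner ℂ (LeafDiv.snd I x) (LeafDiv.snd I y) := rfl

theorem LeafDiv.fst_eq (x : LeafDiv I) : LeafDiv.fst I x = (LeafDiv.equiv I x).1.fst := rfl

/-! ### Leafwise weak derivatives -/

variable {I : Set ℝ} {θ₁ θ₂ : ℝ}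

theorem exists_family_congr {S H H' : Type*} [MeasurableSpace S] {σ : Measure S}
    [NormedAddCommGroup H] [NormedSpace ℂ H] [NormedAddCommGroup H'] [NormedSpace ℂ H']
    (e : H →L[ℂ] H') (F : Lp H 2 σ) : ∃ F' : Lp H' 2 σ, ∀ᵐ s ∂σ, F' s = e (F s) :=
  ⟨e.compLpL 2 σ F, e.coeFn_compLpL F⟩

instance isAddHaarMeasure_space : (volume : Measure (ℝ × ℝ × ℝ)).IsAddHaarMeasure :=
  Measure.prod.instIsAddHaarMeasure (volume : Measure ℝ) (volume : Measure (ℝ × ℝ))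

/-- The function in `Ω_per` given by a family of functions of `H¹(Q)` on the leaves. -/
def glueGrad (I : Set ℝ) (θ₂ : ℝ) (hθ : θ₁ ≠ 0) :
    Lp (LeafH1 I) 2 unitMeasure →L[ℂ] L2 (OmegaPer I) ℂ :=
  leafMap (isShear_cutMap (θ₂ := θ₂) hθ) (LeafH1.fst I)

/-- The second component of the same family. -/
def glueGradSnd (I : Set ℝ) (θ₂ : ℝ) (hθ : θ₁ ≠ 0) :
    Lp (LeafH1 I) 2 unitMeasure →L[ℂ] L2 (OmegaPer I) C2 :=
  leafMap (isShear_cutMap (θ₂ := θ₂) hθ) (LeafH1.snd I)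

theorem fib_glueGrad (hθ : θ₁ ≠ 0) (F : Lp (LeafH1 I) 2 unitMeasure) :
    ∀ᵐ s ∂unitMeasure, LeafH1.fst I (F s) =ᵐ[volume.restrict (Q I)] fun p =>
      glueGrad I θ₂ hθ F (cutMap θ₁ θ₂ (s, p)) :=
  fib_leafMap (isShear_cutMap (θ₂ := θ₂) hθ) (LeafH1.fst I) F

theorem fib_glueGradSnd (hθ : θ₁ ≠ 0) (F : Lp (LeafH1 I) 2 unitMeasure) :
    ∀ᵐ s ∂unitMeasure, LeafH1.snd I (F s) =ᵐ[volume.restrict (Q I)] fun p =>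
      glueGradSnd I θ₂ hθ F (cutMap θ₁ θ₂ (s, p)) :=
  fib_leafMap (isShear_cutMap (θ₂ := θ₂) hθ) (LeafH1.snd I) F

/-- A test function on `Ω_per` restricts to a test function on `Q` on each leaf, with the directions
of the cut frame becoming those of the plane (`IsTest.comp_cutMap`). The leafwise identities are
then integrated over `s`. -/
theorem isWeakGrad_glue (hθ : θ₁ ≠ 0) (F : Lp (LeafH1 I) 2 unitMeasure) :
    IsWeakGrad (OmegaPer I) (cutFrame θ₁ θ₂) (glueGrad I θ₂ hθ F)
      (glueGradSnd I θ₂ hθ F) := by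
  intro φ hφ j
  set h := isShear_cutMap (I := I) (θ₂ := θ₂) hθ
  have i1 := integrable_smul_of_compactSupport (glueGrad I θ₂ hθ F)
    (hφ.deriv_continuous (cutFrame θ₁ θ₂ j)) (hφ.deriv_compact _)
  have i2 := integrable_smul_apply_of_compactSupport (glueGradSnd I θ₂ hθ F) hφ.1.continuous hφ.2.1 j
  refine smul_right_injective ℂ h.pos.ne' ?_
  simp only
  rw [smul_neg, ← h.integral i1, ← h.integral i2, ← integral_neg]
  refine integral_congr_ae ?_
  filter_upwards [fib_glueGrad (θ₂ := θ₂) hθ F, fib_glueGradSnd (θ₂ := θ₂) hθ F] with s h1 h2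
  obtain ⟨ht, hd⟩ := hφ.comp_cutMap (θ₂ := θ₂) hθ s
  have h3 := (LeafH1.equiv I (F s)).2 _ ht j
  change ∫ p in Q I, _ • LeafH1.fst I (F s) p = -∫ p in Q I, _ • LeafH1.snd I (F s) p j at h3
  rw [integral_congr_ae (g := fun p => fderiv ℝ φ (cutMap θ₁ θ₂ (s, p)) (cutFrame θ₁ θ₂ j) •
    (glueGrad I θ₂ hθ F) (cutMap θ₁ θ₂ (s, p))) (by filter_upwards [h1] with p hp; rw [hp, hd])] at h3
  rw [h3]
  congr 1
  refine integral_congr_ae ?_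
  filter_upwards [h2] with p hp
  rw [hp]

theorem glueGrad_mem (hθ : θ₁ ≠ 0) (F : Lp (LeafH1 I) 2 unitMeasure) :
    glueGrad I θ₂ hθ F ∈ gradPer I θ₁ θ₂ hθ := by
  obtain ⟨F', hF'⟩ := exists_family_congr (LeafH1.equiv I : LeafH1 I →L[ℂ] H1Q I) F
  refine ⟨F', ?_⟩
  filter_upwards [hF', fib_glueGrad (θ₂ := θ₂) hθ F] with s h1 h2
  rw [h1]
  exact h2

/-- The family in the definition of `gradPer` glues back to `V`, since the two agree on almost every
slice. Its glued gradient is a weak gradient of `V`, hence the only one. -/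
theorem exists_glueGrad (hfr : (frontier I).Finite) (hθ : θ₁ ≠ 0) (V : L2 (OmegaPer I) ℂ)
    (hV : V ∈ gradPer I θ₁ θ₂ hθ) : ∃ F : Lp (LeafH1 I) 2 unitMeasure,
      glueGrad I θ₂ hθ F = V ∧ ∀ G : L2 (OmegaPer I) C2,
        IsWeakGrad (OmegaPer I) (cutFrame θ₁ θ₂) V G → glueGradSnd I θ₂ hθ F = G := by
  obtain ⟨F', hF'⟩ := hV
  obtain ⟨F, hF⟩ := exists_family_congr ((LeafH1.equiv I).symm : H1Q I →L[ℂ] LeafH1 I) F'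
  have h1 : glueGrad I θ₂ hθ F = V := by
    refine Lp.ext ((isShear_cutMap (θ₂ := θ₂) hθ).ae_eq_of_slices (Lp.aestronglyMeasurable _)
      (Lp.aestronglyMeasurable _) ?_)
    filter_upwards [fib_glueGrad (θ₂ := θ₂) hθ F, hF, hF'] with s h1 h2 h3
    rw [h2] at h1
    exact h1.symm.trans h3
  refine ⟨F, h1, fun G hG => ?_⟩
  have h2 := isWeakGrad_glue (θ₂ := θ₂) hθ F
  rw [h1] at h2
  exact weakGrad_unique (restrict_Omega hfr) h2 hG

theorem existsUnique_weakGrad (hfr : (frontier I).Finite) (hθ : θ₁ ≠ 0) (V : L2 (OmegaPer I) ℂ)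
    (hV : V ∈ gradPer I θ₁ θ₂ hθ) : ∃! G : L2 (OmegaPer I) C2,
      IsWeakGrad (OmegaPer I) (cutFrame θ₁ θ₂) V G := by
  obtain ⟨F, h1, h2⟩ := exists_glueGrad hfr hθ V hV
  have h3 := isWeakGrad_glue (θ₂ := θ₂) hθ F
  rw [h1] at h3
  exact ⟨_, h3, fun G hG => (h2 G hG).symm⟩

theorem exists_gradIso (hfr : (frontier I).Finite) (θ₂ : ℝ) (hθ : θ₁ ≠ 0) :
    ∃ e : Lp (LeafH1 I) 2 unitMeasure ≃L[ℂ] H1per I θ₁ θ₂ hθ,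
      (∀ F, (e F).1.fst = glueGrad I θ₂ hθ F ∧ (e F).1.snd = glueGradSnd I θ₂ hθ F) ∧
        ∀ V, glueGrad I θ₂ hθ (e.symm V) = V.1.fst ∧ glueGradSnd I θ₂ hθ (e.symm V) = V.1.snd := by
  refine exists_equiv_pair (glueGrad I θ₂ hθ) (glueGradSnd I θ₂ hθ) (c := |θ₁⁻¹|) (abs_nonneg _)
    (norm_sq_leafMap (isShear_cutMap (θ₂ := θ₂) hθ) (LeafH1.fst I) (LeafH1.snd I) LeafH1.inner_eq)
    (H1per I θ₁ θ₂ hθ) (fun F => ⟨isWeakGrad_glue hθ F, glueGrad_mem hθ F⟩) ?_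
  intro V hV
  obtain ⟨F, h1, h2⟩ := exists_glueGrad hfr hθ V.fst hV.2
  exact ⟨F, h1, h2 V.snd hV.1⟩

/-- The field in `Ω_per` given by a family of fields of `H(div; Q)` on the leaves. -/
def glueDiv (I : Set ℝ) (θ₂ : ℝ) (hθ : θ₁ ≠ 0) :
    Lp (LeafDiv I) 2 unitMeasure →L[ℂ] L2 (OmegaPer I) C2 :=
  leafMap (isShear_cutMap (θ₂ := θ₂) hθ) (LeafDiv.fst I)

/-- The second component of the same family. -/
def glueDivSnd (I : Set ℝ) (θ₂ : ℝ) (hθ : θ₁ ≠ 0) :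
    Lp (LeafDiv I) 2 unitMeasure →L[ℂ] L2 (OmegaPer I) ℂ :=
  leafMap (isShear_cutMap (θ₂ := θ₂) hθ) (LeafDiv.snd I)

theorem fib_glueDiv (hθ : θ₁ ≠ 0) (F : Lp (LeafDiv I) 2 unitMeasure) :
    ∀ᵐ s ∂unitMeasure, LeafDiv.fst I (F s) =ᵐ[volume.restrict (Q I)] fun p =>
      glueDiv I θ₂ hθ F (cutMap θ₁ θ₂ (s, p)) :=
  fib_leafMap (isShear_cutMap (θ₂ := θ₂) hθ) (LeafDiv.fst I) F

theorem fib_glueDivSnd (hθ : θ₁ ≠ 0) (F : Lp (LeafDiv I) 2 unitMeasure) :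
    ∀ᵐ s ∂unitMeasure, LeafDiv.snd I (F s) =ᵐ[volume.restrict (Q I)] fun p =>
      glueDivSnd I θ₂ hθ F (cutMap θ₁ θ₂ (s, p)) :=
  fib_leafMap (isShear_cutMap (θ₂ := θ₂) hθ) (LeafDiv.snd I) F

theorem isWeakDiv_glue (hθ : θ₁ ≠ 0) (F : Lp (LeafDiv I) 2 unitMeasure) :
    IsWeakDiv (OmegaPer I) (cutFrame θ₁ θ₂) (glueDiv I θ₂ hθ F)
      (glueDivSnd I θ₂ hθ F) := by
  intro φ hφ
  set h := isShear_cutMap (I := I) (θ₂ := θ₂) hθ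
  have i1 : Integrable (fun x => ∑ j : Fin 2, (fderiv ℝ φ x (cutFrame θ₁ θ₂ j)) •
      (glueDiv I θ₂ hθ F) x j) (volume.restrict (OmegaPer I)) :=
    integrable_finsetSum _ fun j _ => integrable_smul_apply_of_compactSupport (glueDiv I θ₂ hθ F)
      (hφ.deriv_continuous (cutFrame θ₁ θ₂ j)) (hφ.deriv_compact _) j
  have i2 := integrable_smul_of_compactSupport (glueDivSnd I θ₂ hθ F) hφ.1.continuous hφ.2.1
  refine smul_right_injective ℂ h.pos.ne' ?_
  simp only
  rw [smul_neg, ← h.integral i1, ← h.integral i2, ← integral_neg]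
  refine integral_congr_ae ?_
  filter_upwards [fib_glueDiv (θ₂ := θ₂) hθ F, fib_glueDivSnd (θ₂ := θ₂) hθ F] with s h1 h2
  obtain ⟨ht, hd⟩ := hφ.comp_cutMap (θ₂ := θ₂) hθ s
  have h3 := (LeafDiv.equiv I (F s)).2 _ ht
  change ∫ p in Q I, ∑ j : Fin 2, _ • LeafDiv.fst I (F s) p j = -∫ p in Q I, _ • LeafDiv.snd I (F s) p at h3
  rw [integral_congr_ae (g := fun p => ∑ j : Fin 2,
    fderiv ℝ φ (cutMap θ₁ θ₂ (s, p)) (cutFrame θ₁ θ₂ j) •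
    (glueDiv I θ₂ hθ F) (cutMap θ₁ θ₂ (s, p)) j) (by
      filter_upwards [h1] with p hp
      simp only [hp, hd])] at h3
  rw [h3]
  congr 1
  refine integral_congr_ae ?_
  filter_upwards [h2] with p hp
  rw [hp]

theorem glueDiv_mem (hθ : θ₁ ≠ 0) (F : Lp (LeafDiv I) 2 unitMeasure) :
    glueDiv I θ₂ hθ F ∈ divPer I θ₁ θ₂ hθ := by
  obtain ⟨F', hF'⟩ := exists_family_congr (LeafDiv.equiv I : LeafDiv I →L[ℂ] HdivQ I) F
  refine ⟨F', ?_⟩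
  filter_upwards [hF', fib_glueDiv (θ₂ := θ₂) hθ F] with s h1 h2
  rw [h1]
  exact h2

theorem exists_glueDiv (hfr : (frontier I).Finite) (hθ : θ₁ ≠ 0) (W : L2 (OmegaPer I) C2)
    (hW : W ∈ divPer I θ₁ θ₂ hθ) : ∃ F : Lp (LeafDiv I) 2 unitMeasure,
      glueDiv I θ₂ hθ F = W ∧ ∀ G : L2 (OmegaPer I) ℂ,
        IsWeakDiv (OmegaPer I) (cutFrame θ₁ θ₂) W G → glueDivSnd I θ₂ hθ F = G := by
  obtain ⟨F', hF'⟩ := hW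
  obtain ⟨F, hF⟩ := exists_family_congr ((LeafDiv.equiv I).symm : HdivQ I →L[ℂ] LeafDiv I) F'
  have h1 : glueDiv I θ₂ hθ F = W := by
    refine Lp.ext ((isShear_cutMap (θ₂ := θ₂) hθ).ae_eq_of_slices (Lp.aestronglyMeasurable _)
      (Lp.aestronglyMeasurable _) ?_)
    filter_upwards [fib_glueDiv (θ₂ := θ₂) hθ F, hF, hF'] with s h1 h2 h3
    rw [h2] at h1
    exact h1.symm.trans h3
  refine ⟨F, h1, fun G hG => ?_⟩
  have h2 := isWeakDiv_glue (θ₂ := θ₂) hθ F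
  rw [h1] at h2
  exact weakDiv_unique (restrict_Omega hfr) h2 hG

theorem existsUnique_weakDiv (hfr : (frontier I).Finite) (hθ : θ₁ ≠ 0) (W : L2 (OmegaPer I) C2)
    (hW : W ∈ divPer I θ₁ θ₂ hθ) : ∃! G : L2 (OmegaPer I) ℂ,
      IsWeakDiv (OmegaPer I) (cutFrame θ₁ θ₂) W G := by
  obtain ⟨F, h1, h2⟩ := exists_glueDiv hfr hθ W hW
  have h3 := isWeakDiv_glue (θ₂ := θ₂) hθ F
  rw [h1] at h3
  exact ⟨_, h3, fun G hG => (h2 G hG).symm⟩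

theorem exists_divIso (hfr : (frontier I).Finite) (θ₂ : ℝ) (hθ : θ₁ ≠ 0) :
    ∃ e : Lp (LeafDiv I) 2 unitMeasure ≃L[ℂ] Hdivper I θ₁ θ₂ hθ,
      (∀ F, (e F).1.fst = glueDiv I θ₂ hθ F ∧ (e F).1.snd = glueDivSnd I θ₂ hθ F) ∧
        ∀ V, glueDiv I θ₂ hθ (e.symm V) = V.1.fst ∧ glueDivSnd I θ₂ hθ (e.symm V) = V.1.snd := by
  refine exists_equiv_pair (glueDiv I θ₂ hθ) (glueDivSnd I θ₂ hθ) (c := |θ₁⁻¹|) (abs_nonneg _)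
    (norm_sq_leafMap (isShear_cutMap (θ₂ := θ₂) hθ) (LeafDiv.fst I) (LeafDiv.snd I) LeafDiv.inner_eq)
    (Hdivper I θ₁ θ₂ hθ) (fun F => ⟨isWeakDiv_glue hθ F, glueDiv_mem hθ F⟩) ?_
  intro V hV
  obtain ⟨F, h1, h2⟩ := exists_glueDiv hfr hθ V.fst hV.2
  exact ⟨F, h1, h2 V.snd hV.1⟩

variable {I : Set ℝ} {θ₁ θ₂ : ℝ}

/-- `H¹_{C,per}(Ω_per)` is the space of square integrable families of functions of `H¹(Q)`. -/
def gradIso (hfr : (frontier I).Finite) (θ₂ : ℝ) (hθ : θ₁ ≠ 0) :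
    Lp (LeafH1 I) 2 unitMeasure ≃L[ℂ] H1per I θ₁ θ₂ hθ :=
  (exists_gradIso hfr θ₂ hθ).choose

/-- `H_{C,per}(div; Ω_per)` is the space of square integrable families of fields of
`H(div; Q)`. -/
def divIso (hfr : (frontier I).Finite) (θ₂ : ℝ) (hθ : θ₁ ≠ 0) :
    Lp (LeafDiv I) 2 unitMeasure ≃L[ℂ] Hdivper I θ₁ θ₂ hθ :=
  (exists_divIso hfr θ₂ hθ).choose

theorem gradIso_fst (hfr : (frontier I).Finite) (θ₂ : ℝ) (hθ : θ₁ ≠ 0)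
    (F : Lp (LeafH1 I) 2 unitMeasure) : (gradIso hfr θ₂ hθ F).1.fst = glueGrad I θ₂ hθ F :=
  ((exists_gradIso hfr θ₂ hθ).choose_spec.1 F).1

theorem divIso_fst (hfr : (frontier I).Finite) (θ₂ : ℝ) (hθ : θ₁ ≠ 0)
    (F : Lp (LeafDiv I) 2 unitMeasure) : (divIso hfr θ₂ hθ F).1.fst = glueDiv I θ₂ hθ F :=
  ((exists_divIso hfr θ₂ hθ).choose_spec.1 F).1

theorem gradIso_symm_fst (hfr : (frontier I).Finite) (θ₂ : ℝ) (hθ : θ₁ ≠ 0)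
    (V : H1per I θ₁ θ₂ hθ) : glueGrad I θ₂ hθ ((gradIso hfr θ₂ hθ).symm V) = V.1.fst :=
  ((exists_gradIso hfr θ₂ hθ).choose_spec.2 V).1

theorem gradIso_symm_snd (hfr : (frontier I).Finite) (θ₂ : ℝ) (hθ : θ₁ ≠ 0)
    (V : H1per I θ₁ θ₂ hθ) : glueGradSnd I θ₂ hθ ((gradIso hfr θ₂ hθ).symm V) = V.1.snd :=
  ((exists_gradIso hfr θ₂ hθ).choose_spec.2 V).2

theorem divIso_symm_fst (hfr : (frontier I).Finite) (θ₂ : ℝ) (hθ : θ₁ ≠ 0)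
    (V : Hdivper I θ₁ θ₂ hθ) : glueDiv I θ₂ hθ ((divIso hfr θ₂ hθ).symm V) = V.1.fst :=
  ((exists_divIso hfr θ₂ hθ).choose_spec.2 V).1

theorem divIso_symm_snd (hfr : (frontier I).Finite) (θ₂ : ℝ) (hθ : θ₁ ≠ 0)
    (V : Hdivper I θ₁ θ₂ hθ) : glueDivSnd I θ₂ hθ ((divIso hfr θ₂ hθ).symm V) = V.1.snd :=
  ((exists_divIso hfr θ₂ hθ).choose_spec.2 V).2

/-- The pairing on the leaves. -/
def leafPairing (w : LeafDiv I) (v : LeafH1 I) : ℂ :=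
  inner ℂ (LeafH1.fst I v) (LeafDiv.snd I w) + inner ℂ (LeafH1.snd I v) (LeafDiv.fst I w)

/-! ### The trace space -/

/-- `H^{1/2}(ℝ)`, as a type with an opaque norm. -/
def LeafHalf : Type := Hhalf

instance : NormedAddCommGroup LeafHalf := inferInstanceAs (NormedAddCommGroup Hhalf)

instance : InnerProductSpace ℂ LeafHalf := inferInstanceAs (InnerProductSpace ℂ Hhalf)

/-- `LeafHalf` is `Hhalf`. -/
def LeafHalf.equiv : LeafHalf ≃L[ℂ] Hhalf := ContinuousLinearEquiv.refl ℂ Hhalf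

/-- The underlying function. -/
def LeafHalf.fst : LeafHalf →L[ℂ] Lp ℂ 2 (volume : Measure ℝ) :=
  (WithLp.fstL 2 ℂ (Lp ℂ 2 (volume : Measure ℝ)) (Lp ℂ 2 (volume : Measure ℝ))).comp
    (Hhalf.subtypeL.comp (LeafHalf.equiv : LeafHalf →L[ℂ] Hhalf))

theorem LeafHalf.fst_eq (x : LeafHalf) : LeafHalf.fst x = (LeafHalf.equiv x).1.fst := rfl

/-- The function on the face given by a family of functions of `H^{1/2}(ℝ)`. -/
def glueHalf (θ₂ : ℝ) (hθ : θ₁ ≠ 0) : Lp LeafHalf 2 unitMeasure →L[ℂ] L2 SigmaPer ℂ :=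
  leafMap (isShear_faceMap (θ₂ := θ₂) hθ) LeafHalf.fst

theorem fib_glueHalf (θ₂ : ℝ) (hθ : θ₁ ≠ 0) (Φ : Lp LeafHalf 2 unitMeasure) :
    ∀ᵐ s ∂unitMeasure, LeafHalf.fst (Φ s) =ᵐ[volume] fun z =>
      glueHalf θ₂ hθ Φ (faceMap θ₁ θ₂ (s, z)) :=
  fib_leafMap (isShear_faceMap (θ₂ := θ₂) hθ) LeafHalf.fst Φ

/-- Each element of `R` is determined by its second component, so the inverse is read off there.
This matches the encoding of `Hhalfper` by pairs `(Φ, SΦ)`. -/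
theorem exists_equiv_graph {M A N : Type*} [NormedAddCommGroup M] [NormedSpace ℂ M]
    [NormedAddCommGroup A] [NormedSpace ℂ A] [NormedAddCommGroup N] [NormedSpace ℂ N]
    (P : M →L[ℂ] A) (e : M ≃L[ℂ] N) (R : Submodule ℂ (WithLp 2 (A × N)))
    (hR : ∀ F, WithLp.toLp 2 (P F, e F) ∈ R) (hs : ∀ V ∈ R, P (e.symm V.snd) = V.fst) :
    ∃ f : M ≃L[ℂ] R, (∀ F, (f F).1.fst = P F) ∧ ∀ V, P (f.symm V) = V.1.fst := by
  refine ⟨ContinuousLinearEquiv.equivOfInverse ((pairTwo P (e : M →L[ℂ] N)).codRestrict R hR)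
    ((e.symm : N →L[ℂ] M).comp ((WithLp.sndL 2 ℂ A N).comp R.subtypeL)) (fun F => ?_) fun V => ?_,
    fun F => rfl, fun V => hs V.1 V.2⟩
  · exact e.symm_apply_apply F
  · exact Subtype.ext (prod_two_ext (hs V.1 V.2) (e.apply_symm_apply V.1.snd))

/-- Equality of classes of families, from an equivalence of the spaces of values. -/
def compEquiv {S H H' : Type*} [MeasurableSpace S] {σ : Measure S}
    [NormedAddCommGroup H] [NormedSpace ℂ H] [NormedAddCommGroup H'] [NormedSpace ℂ H']
    (e : H ≃L[ℂ] H') : Lp H 2 σ ≃L[ℂ] Lp H' 2 σ :=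
  ContinuousLinearEquiv.equivOfInverse ((e : H →L[ℂ] H').compLpL 2 σ)
    ((e.symm : H' →L[ℂ] H).compLpL 2 σ)
    (fun F => by
      refine Lp.ext ?_
      filter_upwards [(e : H →L[ℂ] H').coeFn_compLpL F,
        (e.symm : H' →L[ℂ] H).coeFn_compLpL ((e : H →L[ℂ] H').compLpL 2 σ F)] with s h1 h2
      rw [h2, h1]
      exact e.symm_apply_apply _)
    fun F => by
      refine Lp.ext ?_
      filter_upwards [(e.symm : H' →L[ℂ] H).coeFn_compLpL F,
        (e : H →L[ℂ] H').coeFn_compLpL ((e.symm : H' →L[ℂ] H).compLpL 2 σ F)] with s h1 h2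
      rw [h2, h1]
      exact e.apply_symm_apply _

theorem coeFn_compEquiv {S H H' : Type*} [MeasurableSpace S] {σ : Measure S}
    [NormedAddCommGroup H] [NormedSpace ℂ H] [NormedAddCommGroup H'] [NormedSpace ℂ H']
    (e : H ≃L[ℂ] H') (F : Lp H 2 σ) : ∀ᵐ s ∂σ, compEquiv e F s = e (F s) :=
  (e : H →L[ℂ] H').coeFn_compLpL F

theorem coeFn_compEquiv_symm {S H H' : Type*} [MeasurableSpace S] {σ : Measure S}
    [NormedAddCommGroup H] [NormedSpace ℂ H] [NormedAddCommGroup H'] [NormedSpace ℂ H']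
    (e : H ≃L[ℂ] H') (F : Lp H' 2 σ) : ∀ᵐ s ∂σ, (compEquiv e).symm F s = e.symm (F s) :=
  (e.symm : H' →L[ℂ] H).coeFn_compLpL F

theorem exists_equiv_family {S H H' A : Type*} [MeasurableSpace S] {σ : Measure S}
    [NormedAddCommGroup H] [NormedSpace ℂ H] [NormedAddCommGroup H'] [NormedSpace ℂ H']
    [NormedAddCommGroup A] [NormedSpace ℂ A] (P : Lp H 2 σ →L[ℂ] A) (e : H ≃L[ℂ] H')
    (R : Submodule ℂ (WithLp 2 (A × Lp H' 2 σ)))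
    (hR : ∀ (F : Lp H 2 σ) (G : Lp H' 2 σ), (∀ᵐ s ∂σ, G s = e (F s)) → WithLp.toLp 2 (P F, G) ∈ R)
    (hs : ∀ V ∈ R, ∀ F : Lp H 2 σ, (∀ᵐ s ∂σ, V.snd s = e (F s)) → P F = V.fst) :
    ∃ f : Lp H 2 σ ≃L[ℂ] R, (∀ F, (f F).1.fst = P F) ∧ ∀ V, P (f.symm V) = V.1.fst := by
  refine exists_equiv_graph P (compEquiv e) R (fun F => hR F _ (coeFn_compEquiv e F))
    fun V hV => hs V hV _ ?_
  filter_upwards [coeFn_compEquiv_symm e V.snd] with s h1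
  rw [h1, e.apply_symm_apply]

theorem exists_halfIso (θ₂ : ℝ) (hθ : θ₁ ≠ 0) :
    ∃ f : Lp LeafHalf 2 unitMeasure ≃L[ℂ] Hhalfper θ₁ θ₂ hθ,
      (∀ F, (f F).1.fst = glueHalf θ₂ hθ F) ∧ ∀ V, glueHalf θ₂ hθ (f.symm V) = V.1.fst := by
  refine exists_equiv_family (glueHalf θ₂ hθ) LeafHalf.equiv (Hhalfper θ₁ θ₂ hθ)
    (fun F G hG => ?_) fun V hV F hF => ?_
  · change ∀ᵐ s ∂unitMeasure, _ =ᵐ[volume] _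
    filter_upwards [hG, fib_glueHalf θ₂ hθ F] with s h1 h2
    exact (congrArg (fun x : Hhalf => (x.1.fst : ℝ → ℂ)) h1).eventuallyEq.trans h2
  · refine Lp.ext ((isShear_faceMap (θ₂ := θ₂) hθ).ae_eq_of_slices (Lp.aestronglyMeasurable _)
      (Lp.aestronglyMeasurable _) ?_)
    have hV' : ∀ᵐ s ∂unitMeasure,
      ((V.snd s).1.fst : ℝ → ℂ) =ᵐ[volume] fun z => faceShear θ₁ θ₂ V.fst z s := hV
    filter_upwards [fib_glueHalf θ₂ hθ F, hF, hV'] with s h1 h2 h3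
    rw [h2] at h3
    exact h1.symm.trans h3

/-- `H^{1/2}_{C,per}(Σ^τ_per)` is the space of square integrable families of functions of
`H^{1/2}(ℝ)`. -/
def halfIso (θ₂ : ℝ) (hθ : θ₁ ≠ 0) : Lp LeafHalf 2 unitMeasure ≃L[ℂ] Hhalfper θ₁ θ₂ hθ :=
  (exists_halfIso θ₂ hθ).choose

theorem halfIso_fst (θ₂ : ℝ) (hθ : θ₁ ≠ 0) (F : Lp LeafHalf 2 unitMeasure) :
    (halfIso θ₂ hθ F).1.fst = glueHalf θ₂ hθ F := (exists_halfIso θ₂ hθ).choose_spec.1 F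

theorem halfIso_symm (θ₂ : ℝ) (hθ : θ₁ ≠ 0) (Φ : Hhalfper θ₁ θ₂ hθ) :
    glueHalf θ₂ hθ ((halfIso θ₂ hθ).symm Φ) = Φ.1.fst := (exists_halfIso θ₂ hθ).choose_spec.2 Φ

theorem LeafHalf.ext {x y : LeafHalf} (h : LeafHalf.fst x = LeafHalf.fst y) : x = y := by
  rw [LeafHalf.fst_eq, LeafHalf.fst_eq] at h
  exact LeafHalf.equiv.injective (Hhalf_ext h)

theorem glueHalf_injective (θ₂ : ℝ) (hθ : θ₁ ≠ 0) {F G : Lp LeafHalf 2 unitMeasure}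
    (h : glueHalf θ₂ hθ F = glueHalf θ₂ hθ G) : F = G := by
  refine Lp.ext ?_
  filter_upwards [fib_glueHalf θ₂ hθ F, fib_glueHalf θ₂ hθ G] with s h1 h2
  rw [← h] at h2
  exact LeafHalf.ext (Lp.ext (h1.trans h2.symm))

theorem Hhalfper_ext {θ₂ : ℝ} {hθ : θ₁ ≠ 0} {Φ Ψ : Hhalfper θ₁ θ₂ hθ}
    (h : Φ.1.fst = Ψ.1.fst) : Φ = Ψ := by
  have h1 := halfIso_symm θ₂ hθ Φ
  have h2 := halfIso_symm θ₂ hθ Ψ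
  have h3 := glueHalf_injective θ₂ hθ (h1.trans (h.trans h2.symm))
  exact (halfIso θ₂ hθ).symm.injective h3

/-! ### Smooth periodic functions on the leaves -/

section SmoothPer

variable {F : Type*} [NormedAddCommGroup F] [NormedSpace ℝ F] {f : ℝ × ℝ × ℝ → F}

theorem IsSmoothPer.fract (hf : IsSmoothPer f) (a b t : ℝ) : f (a, b, Int.fract t) = f (a, b, t) := by
  have h : Function.Periodic (fun t => f (a, b, t)) 1 := hf.2.1 a b
  have := h.sub_int_mul_eq ⌊t⌋ (x := t)
  rwa [mul_one, Int.self_sub_floor] at this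

theorem IsSmoothPer.cutMap (hf : IsSmoothPer f) (θ₁ θ₂ s : ℝ) (p : ℝ × ℝ) :
    f (cutMap θ₁ θ₂ (s, p)) = f (leaf θ₁ θ₂ s p) := hf.fract _ _ _

theorem IsSmoothPer.comp_leaf (hf : IsSmoothPer f) {θ₁ : ℝ} (hθ : θ₁ ≠ 0) (θ₂ s : ℝ) :
    IsSmoothC fun p => f (leaf θ₁ θ₂ s p) := by
  refine ⟨hf.1.comp (contDiff_leaf θ₁ θ₂ s), ?_⟩
  obtain ⟨R, hR⟩ := hf.2.2
  refine HasCompactSupport.intro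
    ((isCompact_Icc (a := -R) (b := R)).prod (isCompact_Icc (a := -(R / |θ₁|)) (b := R / |θ₁|)))
    fun p hp => hR _ _ _ ?_
  by_contra! h
  refine hp ⟨abs_le.1 h.1, abs_le.1 ((le_div_iff₀ (abs_pos.2 hθ)).2 ?_)⟩
  rw [← abs_mul, mul_comm]
  exact h.2

/-- The function is `χ_per(z₂ - θ₂ z₁/θ₁) g(x, z₁/θ₁)`: in sheared coordinates the first argument is
`s`. Leaves with parameters `s` and `s + 1` are identified by periodicity, and the compact support
of `χ` in `(0, 1)` makes the values match smoothly there. -/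
theorem isSmoothPer_tensor {χ : ℝ → ℝ} (hχ : IsTest (Ioo 0 1) χ) {g : ℝ × ℝ → F}
    (hg : IsSmoothC g) {θ₁ : ℝ} (hθ : θ₁ ≠ 0) (θ₂ : ℝ) :
    ∃ f : ℝ × ℝ × ℝ → F, IsSmoothPer f ∧
      ∀ s ∈ Ioo (0 : ℝ) 1, ∀ p, f (leaf θ₁ θ₂ s p) = χ s • g p := by
  have hs : ∀ y : ℝ, ContinuousLinearMap.id ℝ ℝ y ∉ Ioo (0 : ℝ) 1 → χ y = 0 := fun y hy =>
    image_eq_zero_of_notMem_tsupport fun hm => hy (interior_subset (hχ.2.2 hm))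
  have hc := contDiff_periodize (w := (1 : ℝ)) (by simp) hs hχ.1
  have hp : ∀ t, periodize (ContinuousLinearMap.id ℝ ℝ) 1 χ (t + 1) =
      periodize (ContinuousLinearMap.id ℝ ℝ) 1 χ t := periodize_periodic (by simp) χ
  refine ⟨fun y => periodize (ContinuousLinearMap.id ℝ ℝ) 1 χ (y.2.2 - θ₂ * (y.2.1 / θ₁)) •
    g (y.1, y.2.1 / θ₁), ⟨?_, ?_, ?_⟩, ?_⟩
  · refine (hc.comp (by fun_prop)).smul (hg.1.comp (by fun_prop))
  · intro x z₁ z₂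
    simp only
    rw [add_sub_right_comm, hp]
  · obtain ⟨R, hR⟩ := hg.2.isCompact.isBounded.exists_norm_le
    refine ⟨max R (R * |θ₁|), fun x z₁ z₂ h => ?_⟩
    simp only
    rw [image_eq_zero_of_notMem_tsupport (f := g), smul_zero]
    intro hm
    have h1 := hR _ hm
    rw [Prod.norm_def, max_le_iff, Real.norm_eq_abs, Real.norm_eq_abs, abs_div,
      div_le_iff₀ (abs_pos.2 hθ)] at h1
    rcases h with h | h
    · exact absurd h1.1 (not_le.2 ((le_max_left _ _).trans_lt h))
    · exact absurd h1.2 (not_le.2 ((le_max_right _ _).trans_lt h))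
  · intro s hs p
    have e : θ₁ * p.2 / θ₁ = p.2 := by field_simp
    simp only [leaf, e]
    rw [add_sub_cancel_left, periodize]
    have : ⌊s⌋ = 0 := Int.floor_eq_zero_iff.2 ⟨hs.1.le, hs.2⟩
    simp [this]

end SmoothPer

/-! ### Elementary tensors -/

section Tensor

variable {H : Type*} [NormedAddCommGroup H] [InnerProductSpace ℂ H]

theorem memLp_tensor {χ : ℝ → ℝ} (hχ : IsTest (Ioo 0 1) χ) (e : H) :
    MemLp (fun s => (χ s : ℂ) • e) 2 unitMeasure := by
  refine (Continuous.memLp_of_hasCompactSupport (μ := volume) ?_ ?_).restrict _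
  · exact (Complex.continuous_ofReal.comp hχ.1.continuous).smul continuous_const
  · refine hχ.2.1.mono fun s hs => ?_
    contrapose! hs
    simp only [Function.mem_support, not_not] at hs ⊢
    simp [hs]

/-- The family `s ↦ χ s • e`. -/
def tensor {χ : ℝ → ℝ} (hχ : IsTest (Ioo 0 1) χ) (e : H) : Lp H 2 unitMeasure :=
  (memLp_tensor hχ e).toLp

theorem coeFn_tensor {χ : ℝ → ℝ} (hχ : IsTest (Ioo 0 1) χ) (e : H) :
    ∀ᵐ s ∂unitMeasure, tensor hχ e s = (χ s : ℂ) • e := (memLp_tensor hχ e).coeFn_toLp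

theorem restrict_interior_Ioo :
    (volume : Measure ℝ).restrict (interior (Ioo (0 : ℝ) 1)) = volume.restrict (Ioo 0 1) := by
  rw [isOpen_Ioo.interior_eq]

theorem integrable_test_smul {χ : ℝ → ℝ} (hχ : IsTest (Ioo 0 1) χ) (F : Lp H 2 unitMeasure) :
    Integrable (fun s => χ s • F s) unitMeasure :=
  integrable_smul_of_compactSupport F hχ.1.continuous hχ.2.1

variable [CompleteSpace H]

theorem inner_tensor {χ : ℝ → ℝ} (hχ : IsTest (Ioo 0 1) χ) (e : H) (F : Lp H 2 unitMeasure) :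
    inner ℂ (tensor hχ e) F = inner ℂ e (∫ s, χ s • F s ∂unitMeasure) := by
  rw [L2.inner_def, ← innerSL_apply_apply ℂ e,
    ← ContinuousLinearMap.integral_comp_comm _ (integrable_test_smul hχ F)]
  refine integral_congr_ae ?_
  filter_upwards [coeFn_tensor hχ e] with s hs
  rw [hs, inner_smul_left, Complex.conj_ofReal, innerSL_apply_apply]
  rw [← Complex.coe_smul (χ s), inner_smul_right]

/-- For each `χ` the vector `∫ χ F` is orthogonal to `D`, hence zero; the fundamental lemma for
vector valued functions gives `F = 0`. -/
theorem eq_zero_of_inner_tensor {D : Set H} (hD : ∀ y : H, (∀ e ∈ D, inner ℂ e y = 0) → y = 0)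
    (F : Lp H 2 unitMeasure)
    (h : ∀ (χ : ℝ → ℝ) (hχ : IsTest (Ioo 0 1) χ), ∀ e ∈ D, inner ℂ (tensor hχ e) F = 0) :
    F = 0 := by
  refine Lp.ext (Filter.EventuallyEq.trans ?_ (Lp.coeFn_zero H 2 unitMeasure).symm)
  refine ae_eq_zero_of_isTest restrict_interior_Ioo
    ((Lp.memLp F).locallyIntegrable (by norm_num)) fun χ hχ => hD _ fun e he => ?_
  rw [← inner_tensor hχ e F]
  exact h χ hχ e he

theorem clm_ext_tensor {N : Type*} [NormedAddCommGroup N] [NormedSpace ℂ N] {D : Set H}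
    (hD : ∀ y : H, (∀ e ∈ D, inner ℂ e y = 0) → y = 0) (T T' : Lp H 2 unitMeasure →L[ℂ] N)
    (h : ∀ (χ : ℝ → ℝ) (hχ : IsTest (Ioo 0 1) χ), ∀ e ∈ D, T (tensor hχ e) = T' (tensor hχ e)) :
    T = T' := by
  let K : Submodule ℂ (Lp H 2 unitMeasure) := LinearMap.ker (T - T').toLinearMap
  have hK : IsClosed (K : Set (Lp H 2 unitMeasure)) := (T - T').isClosed_ker
  have : K = ⊤ := by
    have : CompleteSpace K := hK.completeSpace_coe
    rw [← Submodule.orthogonal_eq_bot_iff, Submodule.eq_bot_iff]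
    intro F hF
    refine eq_zero_of_inner_tensor hD F fun χ hχ e he => ?_
    refine (Submodule.mem_orthogonal _ _).1 hF _ ?_
    exact sub_eq_zero.2 (h χ hχ e he)
  ext1 F
  have hF : F ∈ K := this ▸ Submodule.mem_top
  exact sub_eq_zero.1 hF

end Tensor

variable {I : Set ℝ} {θ₁ θ₂ : ℝ}

/-! ### Traces on the leaves -/

/-- A smooth function with compact support, as an element of `LeafH1`. -/
def leafGradElem (I : Set ℝ) {f : ℝ × ℝ → ℂ} (h : IsSmoothC f) : LeafH1 I :=
  (LeafH1.equiv I).symm (gradElem (Q I) planeFrame h)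

/-- A smooth field with compact support, as an element of `LeafDiv`. -/
def leafDivElem (I : Set ℝ) {f : ℝ × ℝ → C2} (h : IsSmoothC f) : LeafDiv I :=
  (LeafDiv.equiv I).symm (divElem (Q I) planeFrame h)

theorem leafGradElem_fst {f : ℝ × ℝ → ℂ} (h : IsSmoothC f) :
    LeafH1.fst I (leafGradElem I h) =ᵐ[volume.restrict (Q I)] f := (h.memLp (Q I)).coeFn_toLp

theorem leafDivElem_fst {f : ℝ × ℝ → C2} (h : IsSmoothC f) :
    LeafDiv.fst I (leafDivElem I h) =ᵐ[volume.restrict (Q I)] f := (h.memLp (Q I)).coeFn_toLp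

theorem LeafH1.ext (hfr : (frontier I).Finite) {x y : LeafH1 I}
    (h : LeafH1.fst I x = LeafH1.fst I y) : x = y := by
  rw [LeafH1.fst_eq, LeafH1.fst_eq] at h
  exact (LeafH1.equiv I).injective (gradSpace_ext (restrict_Q hfr) h)

theorem LeafDiv.ext (hfr : (frontier I).Finite) {x y : LeafDiv I}
    (h : LeafDiv.fst I x = LeafDiv.fst I y) : x = y := by
  rw [LeafDiv.fst_eq, LeafDiv.fst_eq] at h
  exact (LeafDiv.equiv I).injective (divSpace_ext (restrict_Q hfr) h)

/-- The trace, on the leaves. -/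
def leafTrace (hfr : (frontier I).Finite) (τ : ℝ) : LeafH1 I →L[ℂ] LeafHalf :=
  (LeafHalf.equiv.symm : Hhalf →L[ℂ] LeafHalf).comp
    ((traceQ hfr τ).comp (LeafH1.equiv I : LeafH1 I →L[ℂ] H1Q I))

theorem leafTrace_smooth (hI : I.OrdConnected) (hI_int : (interior I).Nonempty)
    (hI_ne : I ≠ univ) (hfr : (frontier I).Finite) (τ : frontier I) {f : ℝ × ℝ → ℂ}
    (h : IsSmoothC f) :
    LeafHalf.fst (leafTrace hfr τ (leafGradElem I h)) =ᵐ[volume] fun z => f (τ, z) := by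
  have h1 := traceQ_smooth hI hI_int hI_ne hfr τ h
  have h2 : LeafHalf.fst (leafTrace hfr τ (leafGradElem I h)) =
      (traceQ hfr τ (gradElem (Q I) planeFrame h)).1.fst := rfl
  rw [h2, h1]
  exact hhalfElem_fst _

theorem exists_leafLift (hI : I.OrdConnected) (hI_int : (interior I).Nonempty)
    (hI_ne : I ≠ univ) (hfr : (frontier I).Finite) (τ : frontier I) :
    ∃ L : LeafHalf →L[ℂ] LeafH1 I, (∀ Φ, leafTrace hfr τ (L Φ) = Φ) ∧
      (∀ τ' : frontier I, τ' ≠ τ → ∀ Φ, leafTrace hfr τ' (L Φ) = 0) ∧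
      ∀ (f : ℝ × ℝ → C2) (hf : IsSmoothC f) (Φ : LeafHalf),
        leafPairing (leafDivElem I hf) (L Φ) =
          (outward I τ : ℂ) * ∫ z, f (τ, z) 0 * conj (LeafHalf.fst Φ z) := by
  obtain ⟨L, h1, h2⟩ := exists_lift_clm hI hI_int hI_ne hfr τ
  refine ⟨((LeafH1.equiv I).symm : H1Q I →L[ℂ] LeafH1 I).comp
    (L.comp (LeafHalf.equiv : LeafHalf →L[ℂ] Hhalf)), fun Φ => ?_, fun τ' h Φ => ?_,
    fun f hf Φ => pairing_smooth_lift hI hI_int hI_ne hfr h1 h2 hf (LeafHalf.equiv Φ)⟩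
  · exact h1 (LeafHalf.equiv Φ)
  · exact h2 τ' h (LeafHalf.equiv Φ)

/-- A lifting of the trace on `x = τ` with vanishing trace on the other end. -/
def leafLift (hI : I.OrdConnected) (hI_int : (interior I).Nonempty)
    (hI_ne : I ≠ univ) (hfr : (frontier I).Finite) (τ : frontier I) : LeafHalf →L[ℂ] LeafH1 I :=
  (exists_leafLift hI hI_int hI_ne hfr τ).choose

theorem leafPairing_eq_zero (hI : I.OrdConnected) (hI_int : (interior I).Nonempty)
    (hI_ne : I ≠ univ) (hfr : (frontier I).Finite) {v : LeafH1 I}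
    (hv : ∀ τ : frontier I, leafTrace hfr τ v = 0) (w : LeafDiv I) : leafPairing w v = 0 :=
  pairing_eq_zero_of_traceQ hI hI_int hI_ne hfr (V := LeafH1.equiv I v) hv (LeafDiv.equiv I w)

/-! ### The pairing as a sesquilinear map -/

section Sesq

variable {H D A B : Type*} [NormedAddCommGroup H] [NormedSpace ℂ H] [NormedAddCommGroup D]
  [NormedSpace ℂ D] [NormedAddCommGroup A] [InnerProductSpace ℂ A] [NormedAddCommGroup B]
  [InnerProductSpace ℂ B]

/-- The map `w ↦ (v ↦ ⟪P v, R w⟫ + ⟪P' v, R' w⟫)`. -/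
def sesq (P : H →L[ℂ] A) (P' : H →L[ℂ] B) (R : D →L[ℂ] A) (R' : D →L[ℂ] B) :
    D →L[ℂ] (H →L⋆[ℂ] ℂ) :=
  LinearMap.mkContinuous₂
    (LinearMap.mk₂'ₛₗ (RingHom.id ℂ) (starRingEnd ℂ)
      (fun w v => inner ℂ (P v) (R w) + inner ℂ (P' v) (R' w))
      (fun w w' v => by simp only [map_add, inner_add_right]; ring)
      (fun c w v => by simp only [map_smul, inner_smul_right, RingHom.id_apply, smul_eq_mul]; ring)
      (fun w v v' => by simp only [map_add, inner_add_left]; ring)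
      (fun c w v => by simp only [map_smul, inner_smul_left, smul_eq_mul]; ring))
    (‖P‖ * ‖R‖ + ‖P'‖ * ‖R'‖) fun w v => by
      change ‖inner ℂ (P v) (R w) + inner ℂ (P' v) (R' w)‖ ≤ _
      refine (norm_add_le _ _).trans ?_
      have h1 : ‖inner ℂ (P v) (R w)‖ ≤ (‖P‖ * ‖v‖) * (‖R‖ * ‖w‖) :=
        (norm_inner_le_norm _ _).trans (by gcongr <;> exact ContinuousLinearMap.le_opNorm _ _)
      have h2 : ‖inner ℂ (P' v) (R' w)‖ ≤ (‖P'‖ * ‖v‖) * (‖R'‖ * ‖w‖) :=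
        (norm_inner_le_norm _ _).trans (by gcongr <;> exact ContinuousLinearMap.le_opNorm _ _)
      refine (add_le_add h1 h2).trans (le_of_eq ?_)
      ring

theorem sesq_apply (P : H →L[ℂ] A) (P' : H →L[ℂ] B) (R : D →L[ℂ] A) (R' : D →L[ℂ] B) (w : D)
    (v : H) : sesq P P' R R' w v = inner ℂ (P v) (R w) + inner ℂ (P' v) (R' w) := rfl

/-- A sesquilinear map, composed with linear maps. -/
def sesqComp {K M : Type*} [AddCommGroup K] [Module ℂ K] [TopologicalSpace K] [AddCommGroup M]
    [Module ℂ M] [TopologicalSpace M] (S : D →L[ℂ] (H →L⋆[ℂ] ℂ)) (a : K →L[ℂ] D)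
    (b : M →L[ℂ] H) : K →L[ℂ] (M →L⋆[ℂ] ℂ) :=
  (ContinuousLinearMap.precomp ℂ b).comp (S.comp a)

theorem sesqComp_apply {K M : Type*} [AddCommGroup K] [Module ℂ K] [TopologicalSpace K]
    [AddCommGroup M] [Module ℂ M] [TopologicalSpace M] (S : D →L[ℂ] (H →L⋆[ℂ] ℂ)) (a : K →L[ℂ] D)
    (b : M →L[ℂ] H) (w : K) (v : M) : sesqComp S a b w v = S (a w) (b v) := rfl

end Sesq

/-- The pairing, for families of functions on the leaves. -/
def famPairing (I : Set ℝ) (θ₂ : ℝ) (hθ : θ₁ ≠ 0) :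
    Lp (LeafDiv I) 2 unitMeasure →L[ℂ] (Lp (LeafH1 I) 2 unitMeasure →L⋆[ℂ] ℂ) :=
  sesq (glueGrad I θ₂ hθ) (glueGradSnd I θ₂ hθ) (glueDivSnd I θ₂ hθ) (glueDiv I θ₂ hθ)

theorem pairing_eq_famPairing (hfr : (frontier I).Finite) (hθ : θ₁ ≠ 0)
    (W : Hdivper I θ₁ θ₂ hθ) (V : H1per I θ₁ θ₂ hθ) :
    pairing W.1 V.1 = famPairing I θ₂ hθ ((divIso hfr θ₂ hθ).symm W)
      ((gradIso hfr θ₂ hθ).symm V) := by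
  rw [famPairing, sesq_apply, pairing, gradIso_symm_fst, gradIso_symm_snd, divIso_symm_fst,
    divIso_symm_snd]

theorem famPairing_eq (hθ : θ₁ ≠ 0) (W : Lp (LeafDiv I) 2 unitMeasure)
    (V : Lp (LeafH1 I) 2 unitMeasure) :
    ∫ s, leafPairing (W s) (V s) ∂unitMeasure = (|θ₁⁻¹| : ℝ) * famPairing I θ₂ hθ W V :=
  inner_add_inner_leafMap (isShear_cutMap (θ₂ := θ₂) hθ) (LeafH1.fst I) (LeafH1.snd I)
    (LeafDiv.snd I) (LeafDiv.fst I) V W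

theorem famPairing_eq_zero (hI : I.OrdConnected) (hI_int : (interior I).Nonempty)
    (hI_ne : I ≠ univ) (hfr : (frontier I).Finite) (hθ : θ₁ ≠ 0)
    {V : Lp (LeafH1 I) 2 unitMeasure}
    (hV : ∀ τ : frontier I, (leafTrace hfr τ).compLpL 2 unitMeasure V = 0)
    (W : Lp (LeafDiv I) 2 unitMeasure) : famPairing I θ₂ hθ W V = 0 := by
  have := hfr.fintype
  have h1 := famPairing_eq (θ₂ := θ₂) hθ W V
  have h0 : ∫ s, leafPairing (W s) (V s) ∂unitMeasure = 0 := by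
    refine integral_eq_zero_of_ae ?_
    have h2 : ∀ᵐ s ∂unitMeasure, ∀ τ : frontier I, leafTrace hfr τ (V s) = 0 := by
      rw [ae_all_iff]
      intro τ
      have h3 := (leafTrace hfr τ).coeFn_compLpL (p := 2) (μ := unitMeasure) V
      rw [hV τ] at h3
      filter_upwards [h3, Lp.coeFn_zero LeafHalf 2 unitMeasure] with s h4 h5
      rw [← h4, h5]
      rfl
    filter_upwards [h2] with s hs
    exact leafPairing_eq_zero hI hI_int hI_ne hfr hs (W s)
  rw [h0] at h1
  refine (mul_eq_zero.1 h1.symm).resolve_left ?_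
  exact_mod_cast abs_ne_zero.2 (inv_ne_zero hθ)

/-! ### The traces -/

/-- The trace on `x = τ`. -/
def tracePer (hfr : (frontier I).Finite) (θ₂ : ℝ) (hθ : θ₁ ≠ 0) (τ : ℝ) :
    H1per I θ₁ θ₂ hθ →L[ℂ] Hhalfper θ₁ θ₂ hθ :=
  (halfIso θ₂ hθ : Lp LeafHalf 2 unitMeasure →L[ℂ] Hhalfper θ₁ θ₂ hθ).comp
    (((leafTrace hfr τ).compLpL 2 unitMeasure).comp
      ((gradIso hfr θ₂ hθ).symm : H1per I θ₁ θ₂ hθ →L[ℂ] Lp (LeafH1 I) 2 unitMeasure))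

/-- The normal trace on `x = τ`, for families. -/
def normalFam (hI : I.OrdConnected) (hI_int : (interior I).Nonempty)
    (hI_ne : I ≠ univ) (hfr : (frontier I).Finite) (θ₂ : ℝ) (hθ : θ₁ ≠ 0) (τ : frontier I) :
    Lp (LeafDiv I) 2 unitMeasure →L[ℂ] (Lp LeafHalf 2 unitMeasure →L⋆[ℂ] ℂ) :=
  sesqComp (famPairing I θ₂ hθ) (ContinuousLinearMap.id ℂ _)
    ((leafLift hI hI_int hI_ne hfr τ).compLpL 2 unitMeasure)

theorem normalFam_apply (hI : I.OrdConnected) (hI_int : (interior I).Nonempty)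
    (hI_ne : I ≠ univ) (hfr : (frontier I).Finite) (θ₂ : ℝ) (hθ : θ₁ ≠ 0) (τ : frontier I)
    (W : Lp (LeafDiv I) 2 unitMeasure) (Φ : Lp LeafHalf 2 unitMeasure) :
    normalFam hI hI_int hI_ne hfr θ₂ hθ τ W Φ =
      famPairing I θ₂ hθ W ((leafLift hI hI_int hI_ne hfr τ).compLpL 2 unitMeasure Φ) := rfl

/-- The normal trace on `x = τ`. -/
def normalPer (hI : I.OrdConnected) (hI_int : (interior I).Nonempty)
    (hI_ne : I ≠ univ) (hfr : (frontier I).Finite) (θ₂ : ℝ) (hθ : θ₁ ≠ 0) (τ : frontier I) :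
    Hdivper I θ₁ θ₂ hθ →L[ℂ] Hminushalfper θ₁ θ₂ hθ :=
  sesqComp (K := Hdivper I θ₁ θ₂ hθ) (M := Hhalfper θ₁ θ₂ hθ)
    (normalFam hI hI_int hI_ne hfr θ₂ hθ τ)
    ((divIso hfr θ₂ hθ).symm : Hdivper I θ₁ θ₂ hθ →L[ℂ] Lp (LeafDiv I) 2 unitMeasure)
    ((halfIso θ₂ hθ).symm : Hhalfper θ₁ θ₂ hθ →L[ℂ] Lp LeafHalf 2 unitMeasure)

theorem normalPer_apply (hI : I.OrdConnected) (hI_int : (interior I).Nonempty)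
    (hI_ne : I ≠ univ) (hfr : (frontier I).Finite) (θ₂ : ℝ) (hθ : θ₁ ≠ 0) (τ : frontier I)
    (W : Hdivper I θ₁ θ₂ hθ) (Φ : Hhalfper θ₁ θ₂ hθ) :
    normalPer hI hI_int hI_ne hfr θ₂ hθ τ W Φ = normalFam hI hI_int hI_ne hfr θ₂ hθ τ
      ((divIso hfr θ₂ hθ).symm W) ((halfIso θ₂ hθ).symm Φ) :=
  sesqComp_apply _ _ _ W Φ

variable {I : Set ℝ} {θ₁ θ₂ : ℝ}

/-! ### The traces extend the traces of smooth functions -/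

theorem ae_eq_leafGradElem (hfr : (frontier I).Finite) (hθ : θ₁ ≠ 0)
    {F : Lp (LeafH1 I) 2 unitMeasure} {f : ℝ × ℝ × ℝ → ℂ} (hf : IsSmoothPer f)
    (h : glueGrad I θ₂ hθ F =ᵐ[volume.restrict (OmegaPer I)] f) :
    ∀ᵐ s ∂unitMeasure, F s = leafGradElem I (hf.comp_leaf hθ θ₂ s) := by
  filter_upwards [fib_glueGrad (θ₂ := θ₂) hθ F, (isShear_cutMap (θ₂ := θ₂) hθ).ae h] with s h1 h2
  refine LeafH1.ext hfr (Lp.ext ((h1.trans ?_).trans (leafGradElem_fst _).symm))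
  filter_upwards [h2] with p h3
  rw [h3, hf.cutMap]

theorem ae_eq_leafDivElem (hfr : (frontier I).Finite) (hθ : θ₁ ≠ 0)
    {F : Lp (LeafDiv I) 2 unitMeasure} {f : ℝ × ℝ × ℝ → C2} (hf : IsSmoothPer f)
    (h : glueDiv I θ₂ hθ F =ᵐ[volume.restrict (OmegaPer I)] f) :
    ∀ᵐ s ∂unitMeasure, F s = leafDivElem I (hf.comp_leaf hθ θ₂ s) := by
  filter_upwards [fib_glueDiv (θ₂ := θ₂) hθ F, (isShear_cutMap (θ₂ := θ₂) hθ).ae h] with s h1 h2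
  refine LeafDiv.ext hfr (Lp.ext ((h1.trans ?_).trans (leafDivElem_fst _).symm))
  filter_upwards [h2] with p h3
  rw [h3, hf.cutMap]

theorem smooth_of_tensor {E : Type*} [NormedAddCommGroup E] [NormedSpace ℂ E] (hθ : θ₁ ≠ 0)
    {χ : ℝ → ℝ} (hχ : IsTest (Ioo 0 1) χ) {g : ℝ × ℝ → E} (hg : IsSmoothC g)
    {v : L2 (OmegaPer I) E} {F : ℝ → L2 (Q I) E} {e : L2 (Q I) E}
    (he : e =ᵐ[volume.restrict (Q I)] g) (hF : ∀ᵐ s ∂unitMeasure, F s = (χ s : ℂ) • e)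
    (hv : ∀ᵐ s ∂unitMeasure, F s =ᵐ[volume.restrict (Q I)] fun p => v (cutMap θ₁ θ₂ (s, p))) :
    ∃ f : ℝ × ℝ × ℝ → E, IsSmoothPer f ∧ v =ᵐ[volume.restrict (OmegaPer I)] f := by
  obtain ⟨f, hf, h⟩ := isSmoothPer_tensor hχ hg hθ θ₂
  refine ⟨f, hf, (isShear_cutMap (θ₂ := θ₂) hθ).ae_eq_of_slices (Lp.aestronglyMeasurable _)
    hf.1.continuous.aestronglyMeasurable ?_⟩
  filter_upwards [hF, hv, ae_restrict_mem measurableSet_Ioo] with s h1 h2 h3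
  rw [h1] at h2
  filter_upwards [h2, Lp.coeFn_smul (χ s : ℂ) e, he] with p h4 h5 h6
  rw [← h4, h5, hf.cutMap, h s h3, Pi.smul_apply, h6, Complex.coe_smul]

theorem smooth_of_tensor_grad (θ₂ : ℝ) (hθ : θ₁ ≠ 0) {χ : ℝ → ℝ} (hχ : IsTest (Ioo 0 1) χ)
    {g : ℝ × ℝ → ℂ} (hg : IsSmoothC g) :
    ∃ f : ℝ × ℝ × ℝ → ℂ, IsSmoothPer f ∧
      glueGrad I θ₂ hθ (tensor hχ (leafGradElem I hg)) =ᵐ[volume.restrict (OmegaPer I)] f := by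
  refine smooth_of_tensor hθ hχ hg (leafGradElem_fst hg)
    (F := fun s => LeafH1.fst I (tensor hχ (leafGradElem I hg) s)) ?_ (fib_glueGrad hθ _)
  filter_upwards [coeFn_tensor hχ (leafGradElem I hg)] with s h1
  rw [h1, map_smul]

theorem smooth_of_tensor_div (θ₂ : ℝ) (hθ : θ₁ ≠ 0) {χ : ℝ → ℝ} (hχ : IsTest (Ioo 0 1) χ)
    {g : ℝ × ℝ → C2} (hg : IsSmoothC g) :
    ∃ f : ℝ × ℝ × ℝ → C2, IsSmoothPer f ∧
      glueDiv I θ₂ hθ (tensor hχ (leafDivElem I hg)) =ᵐ[volume.restrict (OmegaPer I)] f := by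
  refine smooth_of_tensor hθ hχ hg (leafDivElem_fst hg)
    (F := fun s => LeafDiv.fst I (tensor hχ (leafDivElem I hg) s)) ?_ (fib_glueDiv hθ _)
  filter_upwards [coeFn_tensor hχ (leafDivElem I hg)] with s h1
  rw [h1, map_smul]

theorem LeafH1.eq_zero_of_inner (hI : I.OrdConnected) (hI_int : (interior I).Nonempty)
    (y : LeafH1 I)
    (h : ∀ e ∈ {e | ∃ (g : ℝ × ℝ → ℂ) (hg : IsSmoothC g), leafGradElem I hg = e},
      inner ℂ e y = 0) : y = 0 := by
  have h1 : LeafH1.equiv I y = 0 :=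
    H1Q_eq_zero hI hI_int _ fun φ hφ => h _ ⟨_, hφ.ofReal, rfl⟩
  exact (LeafH1.equiv I).map_eq_zero_iff.1 h1

theorem LeafDiv.eq_zero_of_inner (hI : I.OrdConnected) (hI_int : (interior I).Nonempty)
    (y : LeafDiv I)
    (h : ∀ e ∈ {e | ∃ (g : ℝ × ℝ → C2) (hg : IsSmoothC g), leafDivElem I hg = e},
      inner ℂ e y = 0) : y = 0 := by
  have h1 : LeafDiv.equiv I y = 0 :=
    HdivQ_eq_zero hI hI_int _ fun φ hφ j => h _ ⟨_, hφ.ofReal.clm_comp (axis j), rfl⟩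
  exact (LeafDiv.equiv I).map_eq_zero_iff.1 h1

theorem glueHalf_leafTrace (hI : I.OrdConnected) (hI_int : (interior I).Nonempty)
    (hI_ne : I ≠ univ) (hfr : (frontier I).Finite) (hθ : θ₁ ≠ 0) (τ : frontier I)
    {F : Lp (LeafH1 I) 2 unitMeasure} {f : ℝ × ℝ × ℝ → ℂ} (hf : IsSmoothPer f)
    (h : glueGrad I θ₂ hθ F =ᵐ[volume.restrict (OmegaPer I)] f) :
    glueHalf θ₂ hθ ((leafTrace hfr τ).compLpL 2 unitMeasure F) =ᵐ[volume.restrict SigmaPer]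
      fun y => f (τ, y) := by
  have hc : Continuous fun y : ℝ × ℝ => f (τ, y) := hf.1.continuous.comp (by fun_prop)
  refine (isShear_faceMap (θ₂ := θ₂) hθ).ae_eq_of_slices (Lp.aestronglyMeasurable _)
    hc.aestronglyMeasurable ?_
  filter_upwards [ae_eq_leafGradElem hfr hθ hf h, fib_glueHalf θ₂ hθ
    ((leafTrace hfr τ).compLpL 2 unitMeasure F),
    (leafTrace hfr τ).coeFn_compLpL (p := 2) (μ := unitMeasure) F] with s h1 h2 h3
  refine h2.symm.trans ?_
  rw [h3, h1]
  refine (leafTrace_smooth hI hI_int hI_ne hfr τ _).trans (Filter.Eventually.of_forall fun z => ?_)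
  exact (hf.fract _ _ _).symm

theorem extendsTrace_tracePer (hI : I.OrdConnected) (hI_int : (interior I).Nonempty)
    (hI_ne : I ≠ univ) (hfr : (frontier I).Finite) (hθ : θ₁ ≠ 0) (τ : frontier I) :
    ExtendsTrace I θ₁ θ₂ hθ τ (tracePer hfr θ₂ hθ τ) := by
  intro V f hf hV
  have h1 : (tracePer hfr θ₂ hθ τ V).1.fst = glueHalf θ₂ hθ
      ((leafTrace hfr τ).compLpL 2 unitMeasure ((gradIso hfr θ₂ hθ).symm V)) := halfIso_fst _ _ _
  have h2 := gradIso_symm_fst hfr θ₂ hθ V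
  exact (congrArg (fun v : L2 SigmaPer ℂ => (v : ℝ × ℝ → ℂ)) h1).eventuallyEq.trans
    (glueHalf_leafTrace hI hI_int hI_ne hfr hθ τ hf
      ((congrArg (fun v : L2 (OmegaPer I) ℂ => (v : ℝ × ℝ × ℝ → ℂ)) h2).eventuallyEq.trans hV))

/-- Transported to families, the two operators agree on the tensors `χ ⊗ g`, which glue to smooth
periodic functions and are total. -/
theorem ExtendsTrace.unique (hI : I.OrdConnected) (hI_int : (interior I).Nonempty)
    (hfr : (frontier I).Finite) (hθ : θ₁ ≠ 0) {τ : ℝ}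
    {T T' : H1per I θ₁ θ₂ hθ →L[ℂ] Hhalfper θ₁ θ₂ hθ} (hT : ExtendsTrace I θ₁ θ₂ hθ τ T)
    (hT' : ExtendsTrace I θ₁ θ₂ hθ τ T') : T = T' := by
  let P : (H1per I θ₁ θ₂ hθ →L[ℂ] Hhalfper θ₁ θ₂ hθ) →
      (Lp (LeafH1 I) 2 unitMeasure →L[ℂ] Lp LeafHalf 2 unitMeasure) := fun T =>
    ((halfIso θ₂ hθ).symm : Hhalfper θ₁ θ₂ hθ →L[ℂ] Lp LeafHalf 2 unitMeasure).comp
      (T.comp (gradIso hfr θ₂ hθ : Lp (LeafH1 I) 2 unitMeasure →L[ℂ] H1per I θ₁ θ₂ hθ))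
  have key : P T = P T' := by
    refine clm_ext_tensor (LeafH1.eq_zero_of_inner hI hI_int) (P T) (P T') ?_
    rintro χ hχ e ⟨g, hg, rfl⟩
    obtain ⟨f, hf, h⟩ := smooth_of_tensor_grad (I := I) θ₂ hθ hχ hg
    have h' := (congrArg (fun v : L2 (OmegaPer I) ℂ => (v : ℝ × ℝ × ℝ → ℂ))
      (gradIso_fst hfr θ₂ hθ (tensor hχ (leafGradElem I hg)))).eventuallyEq.trans h
    exact congrArg (halfIso θ₂ hθ).symm
      (Hhalfper_ext (Lp.ext ((hT _ f hf h').trans (hT' _ f hf h').symm)))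
  refine ContinuousLinearMap.ext fun V => ?_
  have e := (gradIso hfr θ₂ hθ).apply_symm_apply V
  have h : (halfIso θ₂ hθ).symm (T (gradIso hfr θ₂ hθ ((gradIso hfr θ₂ hθ).symm V))) =
    (halfIso θ₂ hθ).symm (T' (gradIso hfr θ₂ hθ ((gradIso hfr θ₂ hθ).symm V))) :=
    DFunLike.congr_fun key ((gradIso hfr θ₂ hθ).symm V)
  have h' := (halfIso θ₂ hθ).symm.injective h
  exact (congrArg T e).symm.trans (h'.trans (congrArg T' e))

theorem ExtendsNormalTrace.unique (hI : I.OrdConnected) (hI_int : (interior I).Nonempty)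
    (hfr : (frontier I).Finite) (hθ : θ₁ ≠ 0) {τ : ℝ}
    {T T' : Hdivper I θ₁ θ₂ hθ →L[ℂ] Hminushalfper θ₁ θ₂ hθ}
    (hT : ExtendsNormalTrace I θ₁ θ₂ hθ τ T) (hT' : ExtendsNormalTrace I θ₁ θ₂ hθ τ T') :
    T = T' := by
  refine ContinuousLinearMap.ext fun W => ContinuousLinearMap.ext fun Φ => ?_
  let P : (Hdivper I θ₁ θ₂ hθ →L[ℂ] Hminushalfper θ₁ θ₂ hθ) →
      (Lp (LeafDiv I) 2 unitMeasure →L[ℂ] (Lp LeafHalf 2 unitMeasure →L⋆[ℂ] ℂ)) := fun T =>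
    (ContinuousLinearMap.precomp ℂ
      (halfIso θ₂ hθ : Lp LeafHalf 2 unitMeasure →L[ℂ] Hhalfper θ₁ θ₂ hθ)).comp (T.comp (divIso hfr θ₂ hθ : Lp (LeafDiv I) 2 unitMeasure →L[ℂ] Hdivper I θ₁ θ₂ hθ))
  have key : P T = P T' := by
    refine clm_ext_tensor (N := Lp LeafHalf 2 unitMeasure →L⋆[ℂ] ℂ)
      (LeafDiv.eq_zero_of_inner hI hI_int) (P T) (P T') ?_
    rintro χ hχ e ⟨g, hg, rfl⟩
    obtain ⟨f, hf, h⟩ := smooth_of_tensor_div (I := I) θ₂ hθ hχ hg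
    have h' := (congrArg (fun v : L2 (OmegaPer I) C2 => (v : ℝ × ℝ × ℝ → C2))
      (divIso_fst hfr θ₂ hθ (tensor hχ (leafDivElem I hg)))).eventuallyEq.trans h
    refine ContinuousLinearMap.ext fun F => ?_
    exact (hT _ f hf h' _).trans (hT' _ f hf h' _).symm
  have e := (divIso hfr θ₂ hθ).apply_symm_apply W
  have e' := (halfIso θ₂ hθ).apply_symm_apply Φ
  have h : T (divIso hfr θ₂ hθ ((divIso hfr θ₂ hθ).symm W)) (halfIso θ₂ hθ ((halfIso θ₂ hθ).symm Φ)) =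
    T' (divIso hfr θ₂ hθ ((divIso hfr θ₂ hθ).symm W)) (halfIso θ₂ hθ ((halfIso θ₂ hθ).symm Φ)) :=
    DFunLike.congr_fun (DFunLike.congr_fun key ((divIso hfr θ₂ hθ).symm W))
      ((halfIso θ₂ hθ).symm Φ)
  exact (congrArg₂ (fun v w => T v w) e e').symm.trans (h.trans (congrArg₂ (fun v w => T' v w) e e'))

variable {I : Set ℝ} {θ₁ θ₂ : ℝ}

theorem IsSmoothPer.memLp_face {E : Type*} [NormedAddCommGroup E] [NormedSpace ℝ E]
    {f : ℝ × ℝ × ℝ → E} (hf : IsSmoothPer f) (τ : ℝ) :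
    MemLp (fun y => f (τ, y)) 2 (volume.restrict SigmaPer) := by
  have hc : Continuous fun y : ℝ × ℝ => f (τ, y) := hf.1.continuous.comp (by fun_prop)
  obtain ⟨R, hR⟩ := hf.2.2
  let K : Set (ℝ × ℝ) := Icc (-R) R ×ˢ Icc 0 1
  have hK : IsCompact K := isCompact_Icc.prod isCompact_Icc
  have hm : MemLp (fun y => f (τ, y)) 2 (volume.restrict K) := by
    have : IsFiniteMeasure ((volume : Measure (ℝ × ℝ)).restrict K) :=
      isFiniteMeasure_restrict.2 hK.measure_lt_top.ne
    obtain ⟨C, hC⟩ := hK.exists_bound_of_continuousOn hc.continuousOn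
    exact MemLp.of_bound hc.aestronglyMeasurable C
      ((ae_restrict_mem hK.measurableSet).mono hC)
  refine (((memLp_indicator_iff_restrict hK.measurableSet).2 hm).restrict SigmaPer).ae_eq ?_
  filter_upwards [ae_restrict_mem (MeasurableSet.univ.prod measurableSet_Ioo)] with y hy
  by_cases h : y ∈ K
  · exact indicator_of_mem h _
  · rw [indicator_of_notMem h, hR τ y.1 y.2 (Or.inr ?_)]
    by_contra! h'
    exact h ⟨abs_le.1 h', Ioo_subset_Icc_self hy.2⟩

/-- On almost every leaf this is the pairing of a smooth field with a lift, that is, Green's formula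
at the single endpoint `τ`. Integration over `s` produces the factor `|θ₁|⁻¹` both in the volume and
on the face, and it cancels. -/
theorem normalFam_smooth (hI : I.OrdConnected) (hI_int : (interior I).Nonempty)
    (hI_ne : I ≠ univ) (hfr : (frontier I).Finite) (hθ : θ₁ ≠ 0) (τ : frontier I)
    {W : Lp (LeafDiv I) 2 unitMeasure} {f : ℝ × ℝ × ℝ → C2} (hf : IsSmoothPer f)
    (h : glueDiv I θ₂ hθ W =ᵐ[volume.restrict (OmegaPer I)] f) (Φ : Lp LeafHalf 2 unitMeasure) :
    normalFam hI hI_int hI_ne hfr θ₂ hθ τ W Φ =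
      outward I τ * ∫ y in SigmaPer, f (τ, y) 0 * conj (glueHalf θ₂ hθ Φ y) := by
  have hg : Integrable (fun y => f (τ, y) 0 * conj (glueHalf θ₂ hθ Φ y))
      (volume.restrict SigmaPer) := by
    have h1 : MemLp (fun y => f (τ, y) 0) 2 (volume.restrict SigmaPer) :=
      (EuclideanSpace.proj (𝕜 := ℂ) (0 : Fin 2) : C2 →L[ℂ] ℂ).comp_memLp' (hf.memLp_face τ)
    exact h1.integrable_mul (Lp.memLp (glueHalf θ₂ hθ Φ)).star
  have h1 := (isShear_faceMap (θ₂ := θ₂) hθ).integral hg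
  have h2 := famPairing_eq (θ₂ := θ₂) hθ W
    ((leafLift hI hI_int hI_ne hfr τ).compLpL 2 unitMeasure Φ)
  have h3 : ∫ s, leafPairing (W s)
      ((leafLift hI hI_int hI_ne hfr τ).compLpL 2 unitMeasure Φ s) ∂unitMeasure =
      ∫ s, outward I τ * (∫ z, f (τ, (faceMap θ₁ θ₂ (s, z))) 0 *
        conj (glueHalf θ₂ hθ Φ (faceMap θ₁ θ₂ (s, z)))) ∂unitMeasure := by
    refine integral_congr_ae ?_
    filter_upwards [ae_eq_leafDivElem hfr hθ hf h, fib_glueHalf θ₂ hθ Φ,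
      (leafLift hI hI_int hI_ne hfr τ).coeFn_compLpL (p := 2) (μ := unitMeasure) Φ] with s h4 h5 h6
    rw [h4, h6]
    refine ((exists_leafLift hI hI_int hI_ne hfr τ).choose_spec.2.2 _ _ _).trans ?_
    congr 1
    refine integral_congr_ae ?_
    filter_upwards [h5] with z h7
    have h8 : f (τ, faceMap θ₁ θ₂ (s, z)) = f (leaf θ₁ θ₂ s (τ, z)) := hf.fract _ _ _
    rw [h7, h8]
  rw [integral_const_mul, h1, h2, Complex.real_smul, mul_left_comm] at h3
  refine mul_left_cancel₀ ?_ h3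
  exact_mod_cast abs_ne_zero.2 (inv_ne_zero hθ)

theorem cutNormal_eq (ν : ℝ) (w : C2) : cutNormal θ₁ θ₂ ν w = ν * w 0 := by
  simp [cutNormal, cutFrame]

theorem extendsNormalTrace_normalPer (hI : I.OrdConnected) (hI_int : (interior I).Nonempty)
    (hI_ne : I ≠ univ) (hfr : (frontier I).Finite) (hθ : θ₁ ≠ 0) (τ : frontier I) :
    ExtendsNormalTrace I θ₁ θ₂ hθ τ (normalPer hI hI_int hI_ne hfr θ₂ hθ τ) := by
  intro W f hf hW Φ
  have h1 := (congrArg (fun v : L2 (OmegaPer I) C2 => (v : ℝ × ℝ × ℝ → C2))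
    (divIso_symm_fst hfr θ₂ hθ W)).eventuallyEq.trans hW
  have h2 := normalFam_smooth hI hI_int hI_ne hfr hθ τ hf h1 ((halfIso θ₂ hθ).symm Φ)
  refine (normalPer_apply hI hI_int hI_ne hfr θ₂ hθ τ W Φ).trans (h2.trans ?_)
  have h3 := halfIso_symm θ₂ hθ Φ
  have h4 : ∀ v : L2 SigmaPer ℂ, (outward I τ : ℂ) * ∫ y in SigmaPer, f (τ, y) 0 * conj (v y) =
      ∫ y in SigmaPer, cutNormal θ₁ θ₂ (outward I τ) (f (τ, y)) * conj (v y) := by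
    intro v
    simp only [cutNormal_eq, mul_assoc]
    exact (integral_const_mul _ _).symm
  exact (h4 _).trans (congrArg (fun v : L2 SigmaPer ℂ =>
    ∫ y in SigmaPer, cutNormal θ₁ θ₂ (outward I τ) (f (τ, y)) * conj (v y)) h3)

/-! ### Green's formula -/

theorem leafTrace_leafLift_family (hI : I.OrdConnected) (hI_int : (interior I).Nonempty)
    (hI_ne : I ≠ univ) (hfr : (frontier I).Finite) (τ τ' : frontier I) [Decidable (τ = τ')]
    (Φ : Lp LeafHalf 2 unitMeasure) :
    (leafTrace hfr τ).compLpL 2 unitMeasure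
      ((leafLift hI hI_int hI_ne hfr τ').compLpL 2 unitMeasure Φ) = if τ = τ' then Φ else 0 := by
  refine Lp.ext ?_
  filter_upwards [(leafTrace hfr τ).coeFn_compLpL (p := 2) (μ := unitMeasure)
    ((leafLift hI hI_int hI_ne hfr τ').compLpL 2 unitMeasure Φ),
    (leafLift hI hI_int hI_ne hfr τ').coeFn_compLpL (p := 2) (μ := unitMeasure) Φ,
    Lp.coeFn_zero LeafHalf 2 unitMeasure] with s h2 h3 h4
  rw [h2, h3]
  split_ifs with h
  · subst h
    exact (exists_leafLift hI hI_int hI_ne hfr τ).choose_spec.1 _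
  · rw [h4]
    exact (exists_leafLift hI hI_int hI_ne hfr τ').choose_spec.2.1 τ h _

/-- Subtracting from `V` the lifts of all its traces leaves a function with no traces, since each
lift vanishes at the other endpoint. Such a function pairs to zero with `W`. -/
theorem famPairing_green (hI : I.OrdConnected) (hI_int : (interior I).Nonempty)
    (hI_ne : I ≠ univ) (hfr : (frontier I).Finite) (hθ : θ₁ ≠ 0)
    (W : Lp (LeafDiv I) 2 unitMeasure) (V : Lp (LeafH1 I) 2 unitMeasure) :
    famPairing I θ₂ hθ W V = ∑ᶠ τ : frontier I,
      normalFam hI hI_int hI_ne hfr θ₂ hθ τ W ((leafTrace hfr τ).compLpL 2 unitMeasure V) := by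
  have := hfr.fintype
  classical
  rw [finsum_eq_sum_of_fintype]
  have h2 := famPairing_eq_zero (θ₂ := θ₂) hI hI_int hI_ne hfr hθ
    (V := V - ∑ τ : frontier I, (leafLift hI hI_int hI_ne hfr τ).compLpL 2 unitMeasure
      ((leafTrace hfr τ).compLpL 2 unitMeasure V)) (fun τ => ?_) W
  · rw [map_sub, sub_eq_zero, map_sum] at h2
    exact h2
  · rw [map_sub, map_sum, Finset.sum_congr rfl fun τ' _ =>
      leafTrace_leafLift_family hI hI_int hI_ne hfr τ τ' _]
    simp

theorem green_per (hI : I.OrdConnected) (hI_int : (interior I).Nonempty)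
    (hI_ne : I ≠ univ) (hfr : (frontier I).Finite) (hθ : θ₁ ≠ 0)
    (V : H1per I θ₁ θ₂ hθ) (W : Hdivper I θ₁ θ₂ hθ) :
    ∫ x in OmegaPer I, (W.1.snd x * conj (V.1.fst x) +
        ∑ j : Fin 2, W.1.fst x j * conj (V.1.snd x j)) =
      ∑ᶠ τ : frontier I, normalPer hI hI_int hI_ne hfr θ₂ hθ τ W (tracePer hfr θ₂ hθ τ V) := by
  refine (pairing_eq_integral W.1 V.1).symm.trans ((pairing_eq_famPairing hfr hθ W V).trans
    ((famPairing_green hI hI_int hI_ne hfr hθ _ _).trans (finsum_congr fun τ => ?_)))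
  refine Eq.trans ?_ (normalPer_apply hI hI_int hI_ne hfr θ₂ hθ τ W _).symm
  exact congrArg _ ((halfIso θ₂ hθ).symm_apply_apply _).symm

variable {I : Set ℝ} {θ₁ θ₂ : ℝ}

/-! ### Surjectivity of the normal trace -/

section Orthogonal

variable {H : Type*} [NormedAddCommGroup H] [InnerProductSpace ℂ H] [CompleteSpace H]

/-- Projecting onto the closed span of `D` reduces the claim to the vanishing of one vector valued
function, so a single null set of `s` serves all elements of `D` at once. -/
theorem ae_mem_orthogonal_of_inner_tensor {D : Set H} (F : Lp H 2 unitMeasure)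
    (h : ∀ (χ : ℝ → ℝ) (hχ : IsTest (Ioo 0 1) χ), ∀ e ∈ D, inner ℂ (tensor hχ e) F = 0) :
    ∀ᵐ s ∂unitMeasure, F s ∈ (Submodule.span ℂ D)ᗮ := by
  let P : H →L[ℂ] H := (Submodule.span ℂ D)ᗮᗮ.starProjection
  have h1 : (fun s => P (F s)) =ᵐ[unitMeasure] 0 := by
    refine ae_eq_zero_of_isTest restrict_interior_Ioo
      ((P.comp_memLp' (Lp.memLp F)).locallyIntegrable (by norm_num)) fun χ hχ => ?_
    have h2 := P.integral_comp_comm (integrable_test_smul hχ F)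
    have h3 : ∫ s, χ s • F s ∂unitMeasure ∈ (Submodule.span ℂ D)ᗮ := by
      rw [Submodule.mem_orthogonal]
      intro u hu
      induction hu using Submodule.span_induction with
      | mem e he => rw [← inner_tensor hχ e F, h χ hχ e he]
      | zero => exact inner_zero_left _
      | add x y _ _ hx hy => rw [inner_add_left, hx, hy, add_zero]
      | smul a x _ hx => rw [inner_smul_left, hx, mul_zero]
    have h4 : P (∫ s, χ s • F s ∂unitMeasure) = 0 :=
      (Submodule.starProjection_apply_eq_zero_iff _).2 ((Submodule.le_orthogonal_orthogonal _) h3)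
    rw [h4] at h2
    rw [← h2]
    refine integral_congr_ae (Filter.Eventually.of_forall fun s => ?_)
    exact (P.map_smul_of_tower (χ s) (F s)).symm
  filter_upwards [h1] with s hs
  have h5 := (Submodule.starProjection_apply_eq_zero_iff _).1 hs
  rwa [Submodule.triorthogonal_eq_orthogonal] at h5

/-- The Riesz representation of the conjugate functional, which is linear. -/
theorem exists_inner_eq_antilinear (ℓ : H →L⋆[ℂ] ℂ) : ∃ R : H, ∀ F, ℓ F = inner ℂ F R := by
  let m : H →L[ℂ] ℂ := ((starL ℂ : ℂ ≃L⋆[ℂ] ℂ) : ℂ →L⋆[ℂ] ℂ).comp ℓ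
  refine ⟨(InnerProductSpace.toDual ℂ H).symm m, fun F => ?_⟩
  rw [← inner_conj_symm, InnerProductSpace.toDual_symm_apply]
  exact (Complex.conj_conj _).symm

end Orthogonal

/-- The functions of `C_c^∞` of the interior of `Q`. -/
def leafTestElems (I : Set ℝ) : Set (LeafH1 I) :=
  {e | ∃ (φ : ℝ × ℝ → ℝ) (h : IsTest (Q I) φ), leafGradElem I h.isSmoothC.ofReal = e}

theorem leafTrace_test (hI : I.OrdConnected) (hI_int : (interior I).Nonempty)
    (hI_ne : I ≠ univ) (hfr : (frontier I).Finite) (τ : frontier I) {e : LeafH1 I}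
    (he : e ∈ leafTestElems I) : leafTrace hfr τ e = 0 := by
  obtain ⟨φ, h, rfl⟩ := he
  refine LeafHalf.ext ?_
  rw [map_zero]
  refine Lp.ext ((leafTrace_smooth hI hI_int hI_ne hfr τ _).trans ?_)
  filter_upwards [Lp.coeFn_zero ℂ 2 (volume : Measure ℝ)] with z hz
  rw [hz, image_eq_zero_of_notMem_tsupport (f := φ), Complex.ofReal_zero]
  · rfl
  · intro hm
    have h1 := h.2.2 hm
    rw [interior_Q] at h1
    exact τ.2.2 h1.1

/-- Orthogonality of `u` to test functions in `H¹(Q)` reads `⟪∇φ, ∇u⟫ + ⟪φ, u⟫ = 0`, that is, `div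
∇u = u`. So `∇u` is a field in `H(div; Q)` with divergence `u`. -/
theorem exists_leafField (I : Set ℝ) :
    ∃ J : (Submodule.span ℂ (leafTestElems I))ᗮ →L[ℂ] LeafDiv I, ∀ u,
      LeafDiv.fst I (J u) = LeafH1.snd I u ∧ LeafDiv.snd I (J u) = LeafH1.fst I u := by
  let N := (Submodule.span ℂ (leafTestElems I))ᗮ
  let p : N →L[ℂ] WithLp 2 (L2 (Q I) C2 × L2 (Q I) ℂ) :=
    pairTwo ((LeafH1.snd I).comp N.subtypeL) ((LeafH1.fst I).comp N.subtypeL)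
  have hp : ∀ u, p u ∈ divSpace (Q I) planeFrame := by
    intro u
    refine (isWeakDiv_iff_inner _ _ _ _).2 fun φ h => ?_
    rw [add_comm]
    exact (LeafH1.inner_eq _ _).symm.trans
      ((Submodule.mem_orthogonal _ _).1 u.2 _ (Submodule.subset_span ⟨φ, h, rfl⟩))
  exact ⟨((LeafDiv.equiv I).symm : HdivQ I →L[ℂ] LeafDiv I).comp
    (p.codRestrict (divSpace (Q I) planeFrame) hp), fun u => ⟨rfl, rfl⟩⟩

/-- With the field `∇R`, whose divergence is `R`, the Green pairing with `V` becomes the `H¹` inner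
product on each leaf. The scalar `|θ₁|⁻¹` compensates the change of measure under the shear. -/
theorem exists_famPairing_eq_inner (θ₂ : ℝ) (hθ : θ₁ ≠ 0) {R : Lp (LeafH1 I) 2 unitMeasure}
    (hR : ∀ᵐ s ∂unitMeasure, R s ∈ (Submodule.span ℂ (leafTestElems I))ᗮ) :
    ∃ W : Lp (LeafDiv I) 2 unitMeasure, ∀ V, famPairing I θ₂ hθ W V = inner ℂ V R := by
  obtain ⟨J, hJ⟩ := exists_leafField I
  let K : LeafH1 I →L[ℂ] LeafDiv I :=
    J.comp (Submodule.span ℂ (leafTestElems I))ᗮ.orthogonalProjectionOnto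
  have hK : ∀ᵐ s ∂unitMeasure, LeafDiv.fst I (K (R s)) = LeafH1.snd I (R s) ∧
      LeafDiv.snd I (K (R s)) = LeafH1.fst I (R s) := by
    filter_upwards [hR] with s hs
    have h1 := hJ ((Submodule.span ℂ (leafTestElems I))ᗮ.orthogonalProjectionOnto (R s))
    rw [← Submodule.starProjection_apply, Submodule.starProjection_eq_self_iff.2 hs] at h1
    exact h1
  have hθ' : ((|θ₁⁻¹| : ℝ) : ℂ) ≠ 0 := by exact_mod_cast abs_ne_zero.2 (inv_ne_zero hθ)
  refine ⟨((|θ₁⁻¹| : ℝ) : ℂ) • K.compLpL 2 unitMeasure R, fun V => ?_⟩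
  rw [map_smul]
  refine (famPairing_eq hθ _ _).symm.trans ?_
  rw [L2.inner_def]
  refine integral_congr_ae ?_
  filter_upwards [hK, K.coeFn_compLpL (p := 2) (μ := unitMeasure) R] with s h1 h2
  rw [h2, leafPairing, h1.1, h1.2, LeafH1.inner_eq]

/-- The functional `V ↦ ψ(trace V)` has a Riesz representative `R`. Test functions have no trace, so
`R` is orthogonal to them on almost every leaf and the functional is the pairing with some field
`W`. Evaluating at the lift of `Φ`, whose trace is `Φ`, gives the claim. -/
theorem normalFam_surjective (hI : I.OrdConnected) (hI_int : (interior I).Nonempty)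
    (hI_ne : I ≠ univ) (hfr : (frontier I).Finite) (θ₂ : ℝ) (hθ : θ₁ ≠ 0) (τ : frontier I) :
    Function.Surjective (normalFam hI hI_int hI_ne hfr θ₂ hθ τ) := by
  classical
  intro ψ
  obtain ⟨R, hR⟩ := exists_inner_eq_antilinear (ψ.comp ((leafTrace hfr τ).compLpL 2 unitMeasure))
  obtain ⟨W, hW⟩ := exists_famPairing_eq_inner θ₂ hθ (R := R) (by
    refine ae_mem_orthogonal_of_inner_tensor R fun χ hχ e he => ?_
    have h0 : (leafTrace hfr τ).compLpL 2 unitMeasure (tensor hχ e) = 0 := by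
      refine Lp.ext ?_
      filter_upwards [(leafTrace hfr τ).coeFn_compLpL (p := 2) (μ := unitMeasure) (tensor hχ e),
        coeFn_tensor hχ e, Lp.coeFn_zero LeafHalf 2 unitMeasure] with s h1 h2 h3
      rw [h1, h2, h3, map_smul, leafTrace_test hI hI_int hI_ne hfr τ he, smul_zero]
      rfl
    rw [← hR, ContinuousLinearMap.comp_apply, h0, map_zero])
  refine ⟨W, ContinuousLinearMap.ext fun Φ => ?_⟩
  rw [normalFam_apply, hW, ← hR, ContinuousLinearMap.comp_apply,
    leafTrace_leafLift_family hI hI_int hI_ne hfr τ τ, if_pos rfl]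

variable {I : Set ℝ} {θ₁ θ₂ : ℝ}

theorem exists_pullback (θ₂ : ℝ) (hθ : θ₁ ≠ 0) (Ψ : Hminushalfper θ₁ θ₂ hθ) :
    ∃ ψ : Lp LeafHalf 2 unitMeasure →L⋆[ℂ] ℂ, ∀ Φ, ψ ((halfIso θ₂ hθ).symm Φ) = Ψ Φ := by
  let P : Hminushalfper θ₁ θ₂ hθ →L[ℂ] (Lp LeafHalf 2 unitMeasure →L⋆[ℂ] ℂ) :=
    ContinuousLinearMap.precomp ℂ
      (halfIso θ₂ hθ : Lp LeafHalf 2 unitMeasure →L[ℂ] Hhalfper θ₁ θ₂ hθ)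
  refine ⟨P Ψ, fun Φ => ?_⟩
  have h2 := (halfIso θ₂ hθ).apply_symm_apply Φ
  exact congrArg Ψ h2

theorem exists_normalPer_apply_eq (hI : I.OrdConnected) (hI_int : (interior I).Nonempty)
    (hI_ne : I ≠ univ) (hfr : (frontier I).Finite) {hθ : θ₁ ≠ 0} (τ : frontier I)
    (Ψ : Hminushalfper θ₁ θ₂ hθ) : ∃ W : Hdivper I θ₁ θ₂ hθ, ∀ Φ : Hhalfper θ₁ θ₂ hθ,
      normalPer hI hI_int hI_ne hfr θ₂ hθ τ W Φ = Ψ Φ := by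
  refine Exists.elim (exists_pullback θ₂ hθ Ψ) fun ψ hψ => ?_
  refine Exists.elim (normalFam_surjective hI hI_int hI_ne hfr θ₂ hθ τ ψ) fun W hW => ?_
  refine ⟨divIso hfr θ₂ hθ W, fun Φ => ?_⟩
  have h1 := (divIso hfr θ₂ hθ).symm_apply_apply W
  have h3 : normalFam hI hI_int hI_ne hfr θ₂ hθ τ ((divIso hfr θ₂ hθ).symm (divIso hfr θ₂ hθ W))
    ((halfIso θ₂ hθ).symm Φ) = ψ ((halfIso θ₂ hθ).symm Φ) := DFunLike.congr_fun
      ((congrArg (normalFam hI hI_int hI_ne hfr θ₂ hθ τ) h1).trans hW) _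
  exact (normalPer_apply hI hI_int hI_ne hfr θ₂ hθ τ _ Φ).trans (h3.trans (hψ Φ))

theorem normalPer_surjective (hI : I.OrdConnected) (hI_int : (interior I).Nonempty)
    (hI_ne : I ≠ univ) (hfr : (frontier I).Finite) (θ₂ : ℝ) (hθ : θ₁ ≠ 0) (τ : frontier I) :
    Function.Surjective (normalPer hI hI_int hI_ne hfr θ₂ hθ τ) := fun Ψ =>
  Exists.elim (exists_normalPer_apply_eq hI hI_int hI_ne hfr τ Ψ) fun W hW =>
    ⟨W, ContinuousLinearMap.ext hW⟩

end CutPer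

end

theorem mainTheorem8 (θ₁ θ₂ : ℝ) (hθ : θ₁ ≠ 0) (I : Set ℝ) (hI : I.OrdConnected)
    (hI_int : (interior I).Nonempty) (hI_ne : I ≠ Set.univ) :
    (∀ V ∈ CutPer.gradPer I θ₁ θ₂ hθ, ∃! G : CutPer.L2 (CutPer.OmegaPer I) CutPer.C2,
      CutPer.IsWeakGrad (CutPer.OmegaPer I) (CutPer.cutFrame θ₁ θ₂) V G) ∧
    (∀ W ∈ CutPer.divPer I θ₁ θ₂ hθ, ∃! D : CutPer.L2 (CutPer.OmegaPer I) ℂ,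
      CutPer.IsWeakDiv (CutPer.OmegaPer I) (CutPer.cutFrame θ₁ θ₂) W D) ∧
    ∃ (γ₀ : frontier I → (CutPer.H1per I θ₁ θ₂ hθ →L[ℂ] CutPer.Hhalfper θ₁ θ₂ hθ))
      (γ₁ : frontier I → (CutPer.Hdivper I θ₁ θ₂ hθ →L[ℂ] CutPer.Hminushalfper θ₁ θ₂ hθ)),
      (∀ τ : frontier I, CutPer.ExtendsTrace I θ₁ θ₂ hθ τ (γ₀ τ) ∧
        ∀ T, CutPer.ExtendsTrace I θ₁ θ₂ hθ τ T → T = γ₀ τ) ∧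
      (∀ τ : frontier I, CutPer.ExtendsNormalTrace I θ₁ θ₂ hθ τ (γ₁ τ) ∧
        (∀ T, CutPer.ExtendsNormalTrace I θ₁ θ₂ hθ τ T → T = γ₁ τ) ∧
        Function.Surjective (γ₁ τ)) ∧
      ∀ (V : CutPer.H1per I θ₁ θ₂ hθ) (W : CutPer.Hdivper I θ₁ θ₂ hθ),
        ∫ x in CutPer.OmegaPer I, (W.1.snd x * (starRingEnd ℂ) (V.1.fst x) +
            ∑ j : Fin 2, W.1.fst x j * (starRingEnd ℂ) (V.1.snd x j)) =
          ∑ᶠ τ : frontier I, γ₁ τ W (γ₀ τ V) := by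
  have hfr := CutPer.finite_frontier hI hI_int hI_ne
  exact ⟨CutPer.existsUnique_weakGrad hfr hθ, CutPer.existsUnique_weakDiv hfr hθ,
    fun τ => CutPer.tracePer hfr θ₂ hθ τ,
    fun τ => CutPer.normalPer hI hI_int hI_ne hfr θ₂ hθ τ,
    fun τ => ⟨CutPer.extendsTrace_tracePer hI hI_int hI_ne hfr hθ τ, fun T hT =>
      hT.unique hI hI_int hfr hθ (CutPer.extendsTrace_tracePer hI hI_int hI_ne hfr hθ τ)⟩,
    fun τ => ⟨CutPer.extendsNormalTrace_normalPer hI hI_int hI_ne hfr hθ τ, fun T hT =>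
      hT.unique hI hI_int hfr hθ (CutPer.extendsNormalTrace_normalPer hI hI_int hI_ne hfr hθ τ),
      CutPer.normalPer_surjective hI hI_int hI_ne hfr θ₂ hθ τ⟩,
    CutPer.green_per hI hI_int hI_ne hfr hθ⟩
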